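/- Let $A=\bigoplus_{n\in\mathbb Z}A_n$ be a commutative $\mathbb{Z}$-graded ring (with $xy=yx$), let $\mathrm{Gr}(A)$ be the abelian category of $\mathbb Z$-graded $A$-modules and degree-$0$ maps, and let $\mathcal D(\mathrm{Gr}(A))$ be its unbounded derived category. Write $M(n)_j=M_{n+j}$, and let $\underline{\mathrm{Hom}}_A$ be the internal Hom, whose degree-$i$ part consists of the $A$-linear maps that are homogeneous of degree $i$. Let $I\subset A$ be a graded ideal generated by homogeneous elements $f_1,\dots,f_r$. For a homogeneous element $f\in A_m$ and a cochain complex $M$ in $\mathrm{Gr}(A)$ put $$A_{\{f\}}=\mathrm{hocolim}\,[A\xrightarrow{f}A(m)\xrightarrow{f}A(2m)\to\cdots],\qquad T(M,f)=\mathrm{holim}\,[M\xleftarrow{f}M(-m)\xleftarrow{f}M(-2m)\leftarrow\cdots],$$ where the homotopy colimit is the cone of $\mathrm{id}-\mathrm{shift}$ on the coproduct and the homotopy limit is the cocone of $\mathrm{id}-\mathrm{shift}$ on the product. An object $M\in\mathcal D(\mathrm{Gr}(A))$ is derived $I$-complete if $T(M,f)$ has zero cohomology for every homogeneous $f\in I$.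 Let $\iota:\mathcal D_{I\text{-comp}}(\mathrm{Gr}(A))\to\mathcal D(\mathrm{Gr}(A))$ be the inclusion of the full subcategory of derived $I$-complete objects. Let $\widetilde{\mathbf R\Gamma}_{(f_1,\dots,f_r)}(A)$ be the total complex of the double complex $$A\to\prod_{i}A_{\{f_i\}}\to\prod_{i<j}A_{\{f_if_j\}}\to\cdots\to A_{\{f_1\cdots f_r\}}$$ with the alternating \v{C}ech differentials, where the map $A_{\{f\}}\to A_{\{fg\}}$ (for homogeneous $f,g$ of degrees $m,n$) is induced by $g^i:A(im)\to A(i(m+n))$, and $A\to A_{\{f\}}$ is the inclusion of the $0$-th term. For a cochain complex $M$ put $$\mathbf L\Lambda_{(f_1,\dots,f_r)}(M)=\underline{\mathrm{Hom}}_A\bigl(\widetilde{\mathbf R\Gamma}_{(f_1,\dots,f_r)}(A),M\bigr),$$ and let $\epsilon^\vee_M:M\to\mathbf L\Lambda_{(f_1,\dots,f_r)}(M)$ be the natural map induced by the projection $\widetilde{\mathbf R\Gamma}_{(f_1,\dots,f_r)}(A)\to A$ to the first component. Then $\mathbf L\Lambda_{(f_1,\dots,f_r)}$ preserves quasi-isomorphisms,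 and the functor it induces on $\mathcal D(\mathrm{Gr}(A))$ takes values in derived $I$-complete objects. The resulting functor $\mathbf L\Lambda_I:\mathcal D(\mathrm{Gr}(A))\to\mathcal D_{I\text{-comp}}(\mathrm{Gr}(A))$ is left adjoint to $\iota$, with unit $\epsilon^\vee:\mathrm{id}\Rightarrow\iota\circ\mathbf L\Lambda_I$. -/

import Mathlib

open CategoryTheory Limits

universe w u

noncomputable section

/-- A `ℤ`-graded module over the `ℤ`-graded ring `A = ⨁ 𝒜 i`, given by its homogeneous components
`obj j` together with the multiplication maps `𝒜 i × obj j → obj (i + j)`. -/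
structure GrMod {A : Type u} [CommRing A] (𝒜 : ℤ → AddSubgroup A) [GradedRing 𝒜] where
  obj : ℤ → Type u
  [grp : ∀ j, AddCommGroup (obj j)]
  smul : ∀ {i j k : ℤ}, i + j = k → 𝒜 i →+ obj j →+ obj k
  one_smul : ∀ (j : ℤ) (x : obj j),
    smul (zero_add j) ⟨1, SetLike.GradedOne.one_mem⟩ x = x
  mul_smul : ∀ {i i' i'' j k l : ℤ} (h : i' + j = k) (h' : i + k = l) (h'' : i'' + j = l)
    (a : 𝒜 i) (b : 𝒜 i') (c : 𝒜 i'') (x : obj j),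
    (c : A) = a * b → smul h'' c x = smul h' a (smul h b x)

attribute [instance] GrMod.grp

namespace GrMod

variable {A : Type u} [CommRing A] {𝒜 : ℤ → AddSubgroup A} [GradedRing 𝒜]

/-- Morphisms of graded modules: linear maps that are homogeneous of degree `0`. -/
@[ext]
structure Hom (M N : GrMod 𝒜) where
  app : ∀ j, M.obj j →+ N.obj j
  app_smul : ∀ {i j k : ℤ} (h : i + j = k) (a : 𝒜 i) (x : M.obj j),
    app k (M.smul h a x) = N.smul h a (app j x)

/-- The category `Gr(A)` of graded modules. -/
instance : Category (GrMod 𝒜) where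
  Hom := Hom
  id M := ⟨fun _ => AddMonoidHom.id _, fun _ _ _ => rfl⟩
  comp f g := ⟨fun j => (g.app j).comp (f.app j), fun h a x => by
    simp [f.app_smul, g.app_smul]⟩

/-- The component in degree `j` of a morphism of graded modules. -/
def app {M N : GrMod 𝒜} (f : M ⟶ N) (j : ℤ) : M.obj j →+ N.obj j := Hom.app f j

/-- Construct a morphism of graded modules from its components. -/
def mkHom {M N : GrMod 𝒜} (f : ∀ j, M.obj j →+ N.obj j)
    (hf : ∀ {i j k : ℤ} (h : i + j = k) (a : 𝒜 i) (x : M.obj j),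
      f k (M.smul h a x) = N.smul h a (f j x)) : M ⟶ N := Hom.mk f hf

@[simp]
lemma app_mkHom {M N : GrMod 𝒜} (f : ∀ j, M.obj j →+ N.obj j)
    (hf : ∀ {i j k : ℤ} (h : i + j = k) (a : 𝒜 i) (x : M.obj j),
      f k (M.smul h a x) = N.smul h a (f j x)) (j : ℤ) : app (mkHom f hf) j = f j := rfl

@[simp]
lemma app_smul {M N : GrMod 𝒜} (f : M ⟶ N) {i j k : ℤ} (h : i + j = k) (a : 𝒜 i) (x : M.obj j) :
    app f k (M.smul h a x) = N.smul h a (app f j x) := Hom.app_smul f h a x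

@[simp] lemma app_id (M : GrMod 𝒜) (j : ℤ) (x : M.obj j) : app (𝟙 M) j x = x := rfl

@[simp] lemma app_comp {M N P : GrMod 𝒜} (f : M ⟶ N) (g : N ⟶ P) (j : ℤ) (x : M.obj j) :
    app (f ≫ g) j x = app g j (app f j x) := rfl

lemma app_injective {M N : GrMod 𝒜} : Function.Injective (app : (M ⟶ N) → _) :=
  fun _ _ h => Hom.ext h

@[ext]
lemma hom_ext {M N : GrMod 𝒜} {f g : M ⟶ N} (h : ∀ j x, app f j x = app g j x) : f = g :=
  app_injective (funext fun j => AddMonoidHom.ext (h j))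

instance (M N : GrMod 𝒜) : Zero (M ⟶ N) := ⟨mkHom (fun _ => 0) (by simp)⟩
instance (M N : GrMod 𝒜) : Add (M ⟶ N) :=
  ⟨fun f g => mkHom (fun j => app f j + app g j) (by simp)⟩
instance (M N : GrMod 𝒜) : Neg (M ⟶ N) := ⟨fun f => mkHom (fun j => - app f j) (by simp)⟩
instance (M N : GrMod 𝒜) : Sub (M ⟶ N) :=
  ⟨fun f g => mkHom (fun j => app f j - app g j) (by simp)⟩
instance (M N : GrMod 𝒜) : SMul ℕ (M ⟶ N) := ⟨fun n f => mkHom (fun j => n • app f j) (by simp)⟩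
instance (M N : GrMod 𝒜) : SMul ℤ (M ⟶ N) := ⟨fun n f => mkHom (fun j => n • app f j) (by simp)⟩

instance (M N : GrMod 𝒜) : AddCommGroup (M ⟶ N) :=
  Function.Injective.addCommGroup (app : (M ⟶ N) → ∀ j, M.obj j →+ N.obj j) app_injective
    rfl (fun _ _ => rfl) (fun _ => rfl) (fun _ _ => rfl) (fun _ _ => rfl) (fun _ _ => rfl)

@[simp] lemma app_zero (M N : GrMod 𝒜) (j : ℤ) : app (0 : M ⟶ N) j = 0 := rfl
@[simp] lemma app_add {M N : GrMod 𝒜} (f g : M ⟶ N) (j : ℤ) :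
    app (f + g) j = app f j + app g j := rfl
@[simp] lemma app_neg {M N : GrMod 𝒜} (f : M ⟶ N) (j : ℤ) : app (-f) j = -app f j := rfl
@[simp] lemma app_sub {M N : GrMod 𝒜} (f g : M ⟶ N) (j : ℤ) :
    app (f - g) j = app f j - app g j := rfl

instance : Preadditive (GrMod 𝒜) where

/-- Degreewise product of graded modules. -/
def prod {ι : Type} (X : ι → GrMod 𝒜) : GrMod 𝒜 where
  obj j := ∀ t, (X t).obj j
  smul h := AddMonoidHom.mk' (fun a => AddMonoidHom.mk' (fun x t => (X t).smul h a (x t))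
    (fun x y => by ext; simp)) (fun a b => by ext; simp)
  one_smul j x := by ext; simp [one_smul]
  mul_smul h h' h'' a b c x e := by ext t; simpa using (X t).mul_smul h h' h'' a b c (x t) e

instance {ι : Type} (X : ι → GrMod 𝒜) : HasProduct X := HasLimit.mk
    { cone := Fan.mk (prod X) fun t => mkHom (fun j => Pi.evalAddMonoidHom _ t)
        (fun _ _ _ => rfl)
      isLimit := Fan.IsLimit.mk _ (fun s => mkHom
          (fun j => AddMonoidHom.mk' (fun x t => app (s.proj t) j x)
            (fun x y => funext fun t => map_add (app (s.proj t) j) x y))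
          (fun h a x => funext fun t => app_smul (s.proj t) h a x))
        (fun s t => rfl)
        (fun s m hm => by
          ext j x
          funext t
          exact DFunLike.congr_fun (congrFun (congrArg app (hm t)) j) x) }

instance (ι : Type) : HasProductsOfShape ι (GrMod 𝒜) :=
  ⟨fun _ => hasLimit_of_iso Discrete.natIsoFunctor.symm⟩

instance : HasFiniteProducts (GrMod 𝒜) := ⟨fun _ => inferInstance⟩

/-- Degreewise direct sum of graded modules. -/
def directSum {ι : Type} (X : ι → GrMod 𝒜) : GrMod 𝒜 where
  obj j := Π₀ t, (X t).obj j
  smul h := AddMonoidHom.mk' (fun a => DFinsupp.mapRange.addMonoidHom fun t => (X t).smul h a)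
    (fun a b => by
      refine AddMonoidHom.ext fun x => DFinsupp.ext fun _ => ?_
      simp)
  one_smul j x := DFinsupp.ext fun t => (X t).one_smul j (x t)
  mul_smul h h' h'' a b c x e :=
    DFinsupp.ext fun t => (X t).mul_smul h h' h'' a b c (x t) e

open Classical in
/-- The inclusion of a summand. -/
def directSumι {ι : Type} (X : ι → GrMod 𝒜) (t : ι) : X t ⟶ directSum X :=
  mkHom (fun j => DFinsupp.singleAddHom (fun t => (X t).obj j) t)
    (fun h a x => (DFinsupp.mapRange_single (f := fun t => (X t).smul h a)
      (hf := fun _ => map_zero _) (i := t) (b := x)).symm)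

open Classical in
lemma directSum_addHom_ext {ι : Type} {X : ι → GrMod 𝒜} {j : ℤ} {G : Type u} [AddCommGroup G]
    {f g : (directSum X).obj j →+ G}
    (h : ∀ t y, f (app (directSumι X t) j y) = g (app (directSumι X t) j y)) : f = g :=
  DFinsupp.addHom_ext h

open Classical in
/-- The additive map out of a component of a direct sum given on the summands. -/
def directSumLift {ι : Type} {X : ι → GrMod 𝒜} {j : ℤ} {G : Type u} [AddCommGroup G]
    (φ : ∀ t, (X t).obj j →+ G) : (directSum X).obj j →+ G :=
  DFinsupp.liftAddHom φ

lemma directSumLift_ι {ι : Type} {X : ι → GrMod 𝒜} {j : ℤ} {G : Type u} [AddCommGroup G]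
    (φ : ∀ t, (X t).obj j →+ G) (t : ι) (x : (X t).obj j) :
    directSumLift φ (app (directSumι X t) j x) = φ t x := by
  classical
  exact DFinsupp.liftAddHom_apply_single φ t x

/-- The morphism out of a direct sum given by its restrictions to the summands. -/
def directSumDesc {ι : Type} {X : ι → GrMod 𝒜} {P : GrMod 𝒜} (p : ∀ t, X t ⟶ P) :
    directSum X ⟶ P :=
  mkHom (fun j => directSumLift fun t => app (p t) j) (fun {i j k} h a x => by
    have : (directSumLift fun t => app (p t) k).comp ((directSum X).smul h a) =
        (P.smul h a).comp (directSumLift fun t => app (p t) j) := by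
      refine directSum_addHom_ext fun t y => ?_
      rw [AddMonoidHom.comp_apply, AddMonoidHom.comp_apply, ← app_smul, directSumLift_ι,
        directSumLift_ι, app_smul]
    exact DFunLike.congr_fun this x)

lemma directSumι_desc {ι : Type} {X : ι → GrMod 𝒜} {P : GrMod 𝒜} (p : ∀ t, X t ⟶ P) (t : ι) :
    directSumι X t ≫ directSumDesc p = p t := by
  ext j x
  exact directSumLift_ι (fun t => app (p t) j) t x

instance {ι : Type} (X : ι → GrMod 𝒜) : HasCoproduct X := HasColimit.mk
  { cocone := Cofan.mk (directSum X) (directSumι X)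
    isColimit := Cofan.IsColimit.mk _ (fun s => directSumDesc s.inj)
      (fun s t => directSumι_desc _ t)
      (fun s m hm => by
        apply app_injective
        funext j
        refine directSum_addHom_ext fun t y => ?_
        exact DFunLike.congr_fun (congrFun (congrArg app
          ((hm t).trans (directSumι_desc _ t).symm)) j) y) }

instance (ι : Type) : HasCoproductsOfShape ι (GrMod 𝒜) :=
  ⟨fun _ => hasColimit_of_iso Discrete.natIsoFunctor⟩

/-- Degreewise kernel of a morphism of graded modules. -/
def ker {M N : GrMod 𝒜} (f : M ⟶ N) : GrMod 𝒜 where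
  obj j := (app f j).ker
  smul h := AddMonoidHom.mk' (fun a => ((M.smul h a).comp (AddSubgroup.subtype _)).codRestrict _
      (fun x => by simp [AddMonoidHom.mem_ker, AddMonoidHom.mem_ker.1 x.2]))
    (fun a b => by
      ext x
      exact DFunLike.congr_fun (map_add (M.smul h) a b) x.1)
  one_smul j x := Subtype.ext (M.one_smul j x.1)
  mul_smul h h' h'' a b c x e := Subtype.ext (M.mul_smul h h' h'' a b c x.1 e)

/-- The inclusion of the kernel. -/
def kerι {M N : GrMod 𝒜} (f : M ⟶ N) : ker f ⟶ M :=
  mkHom (fun _ => AddSubgroup.subtype _) (fun _ _ _ => rfl)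

lemma kerι_comp {M N : GrMod 𝒜} (f : M ⟶ N) : kerι f ≫ f = 0 := by
  ext j x
  exact x.2

instance {M N : GrMod 𝒜} (f : M ⟶ N) : HasKernel f := HasLimit.mk
  { cone := KernelFork.ofι (kerι f) (kerι_comp f)
    isLimit := KernelFork.IsLimit.ofι _ _
      (fun g hg => mkHom (fun j => (app g j).codRestrict _
          (fun x => DFunLike.congr_fun (congrFun (congrArg app hg) j) x))
        (fun h a x => Subtype.ext (app_smul g h a x)))
      (fun g hg => rfl)
      (fun g hg m hm => by
        ext j x
        exact Subtype.ext (DFunLike.congr_fun (congrFun (congrArg app hm) j) x)) }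

/-- Degreewise cokernel of a morphism of graded modules. -/
def coker {M N : GrMod 𝒜} (f : M ⟶ N) : GrMod 𝒜 where
  obj j := N.obj j ⧸ (app f j).range
  smul h := AddMonoidHom.mk' (fun a => QuotientAddGroup.map _ _ (N.smul h a) (by
      rintro _ ⟨y, rfl⟩
      exact ⟨M.smul h a y, app_smul f h a y⟩))
    (fun a b => by
      ext x
      simp)
  one_smul j x := by
    obtain ⟨x, rfl⟩ := QuotientAddGroup.mk_surjective x
    exact congrArg _ (N.one_smul j x)
  mul_smul h h' h'' a b c x e := by
    obtain ⟨x, rfl⟩ := QuotientAddGroup.mk_surjective x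
    exact congrArg _ (N.mul_smul h h' h'' a b c x e)

/-- The projection to the cokernel. -/
def cokerπ {M N : GrMod 𝒜} (f : M ⟶ N) : N ⟶ coker f :=
  mkHom (fun _ => QuotientAddGroup.mk' _) (fun _ _ _ => rfl)

lemma comp_cokerπ {M N : GrMod 𝒜} (f : M ⟶ N) : f ≫ cokerπ f = 0 := by
  ext j x
  exact (QuotientAddGroup.eq_zero_iff _).2 ⟨x, rfl⟩

instance {M N : GrMod 𝒜} (f : M ⟶ N) : HasCokernel f := HasColimit.mk
  { cocone := CokernelCofork.ofπ (cokerπ f) (comp_cokerπ f)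
    isColimit := CokernelCofork.IsColimit.ofπ _ _
      (fun g hg => mkHom (fun j => QuotientAddGroup.lift _ (app g j) (by
            rintro _ ⟨y, rfl⟩
            exact DFunLike.congr_fun (congrFun (congrArg app hg) j) y))
        (fun h a x => by
          obtain ⟨x, rfl⟩ := QuotientAddGroup.mk_surjective x
          exact app_smul g h a x))
      (fun g hg => rfl)
      (fun g hg m hm => by
        ext j x
        obtain ⟨x, rfl⟩ := QuotientAddGroup.mk_surjective x
        exact DFunLike.congr_fun (congrFun (congrArg app hm) j) x) }

lemma app_injective_of_mono {M N : GrMod 𝒜} (f : M ⟶ N) [Mono f] (j : ℤ) :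
    Function.Injective (app f j) := by
  have h : kerι f = 0 := by rw [← cancel_mono f, kerι_comp, zero_comp]
  refine (injective_iff_map_eq_zero _).2 fun x hx => ?_
  exact DFunLike.congr_fun (congrFun (congrArg app h) j) ⟨x, hx⟩

lemma app_surjective_of_epi {M N : GrMod 𝒜} (f : M ⟶ N) [Epi f] (j : ℤ) :
    Function.Surjective (app f j) := by
  have h : cokerπ f = 0 := by rw [← cancel_epi f, comp_cokerπ, comp_zero]
  intro y
  exact (QuotientAddGroup.eq_zero_iff _).1 (DFunLike.congr_fun (congrFun (congrArg app h) j) y)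

/-- A monomorphism is the kernel of its cokernel. -/
abbrev normalMono {M N : GrMod 𝒜} (f : M ⟶ N) [Mono f] : NormalMono f where
  Z := coker f
  g := cokerπ f
  w := comp_cokerπ f
  isLimit := KernelFork.IsLimit.ofι _ _
    (fun {W} g hg =>
      have hr : ∀ j x, app g j x ∈ (app f j).range := fun j x =>
        (QuotientAddGroup.eq_zero_iff _).1 (DFunLike.congr_fun (congrFun (congrArg app hg) j) x)
      let e := fun j => AddMonoidHom.ofInjective (app_injective_of_mono f j)
      have he : ∀ j y, app f j ((e j).symm y) = y.1 := fun j y =>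
        congrArg Subtype.val ((e j).apply_symm_apply y)
      mkHom (fun j => (e j).symm.toAddMonoidHom.comp ((app g j).codRestrict _ (hr j)))
        (fun {i j k} h a x => app_injective_of_mono f k (by
          rw [app_smul]
          refine (he k _).trans ?_
          refine (app_smul g h a x).trans ?_
          exact congrArg (N.smul h a) (he j ⟨app g j x, hr j x⟩).symm)))
    (fun {W} g hg => by
      ext j x
      exact congrArg Subtype.val ((AddMonoidHom.ofInjective (app_injective_of_mono f j)).apply_symm_apply
        ⟨app g j x, _⟩))
    (fun {W} g hg m hm => by
      rw [← cancel_mono f, hm]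
      ext j x
      exact (congrArg Subtype.val ((AddMonoidHom.ofInjective
        (app_injective_of_mono f j)).apply_symm_apply ⟨app g j x, _⟩)).symm)

/-- An epimorphism is the cokernel of its kernel. -/
abbrev normalEpi {M N : GrMod 𝒜} (f : M ⟶ N) [Epi f] : NormalEpi f where
  W := ker f
  g := kerι f
  w := kerι_comp f
  isColimit := CokernelCofork.IsColimit.ofπ _ _
    (fun {W} g hg =>
      have hk : ∀ j, (app f j).ker ≤ (app g j).ker := fun j x hx =>
        show app g j x = 0 from DFunLike.congr_fun (congrFun (congrArg app hg) j)
          (show (ker f).obj j from ⟨x, hx⟩)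
      mkHom (fun j => (app f j).liftOfSurjective (app_surjective_of_epi f j) ⟨app g j, hk j⟩)
        (fun {i j k} h a x => by
          obtain ⟨x, rfl⟩ := app_surjective_of_epi f j x
          rw [← app_smul]
          exact (AddMonoidHom.liftOfRightInverse_comp_apply _ _ _ ⟨app g k, hk k⟩ _).trans
            ((app_smul g h a x).trans (congrArg (W.smul h a)
              (AddMonoidHom.liftOfRightInverse_comp_apply _ _ _ ⟨app g j, hk j⟩ x).symm))))
    (fun {W} g hg => by
      ext j x
      simp [AddMonoidHom.liftOfRightInverse_comp_apply])
    (fun {W} g hg m hm => by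
      rw [← cancel_epi f, hm]
      ext j x
      simp [AddMonoidHom.liftOfRightInverse_comp_apply])

/-- `Gr(A)` is an abelian category. -/
instance : Abelian (GrMod 𝒜) where
  normalMonoOfMono f _ := ⟨normalMono f⟩
  normalEpiOfEpi f _ := ⟨normalEpi f⟩
  has_kernels := ⟨inferInstance⟩
  has_cokernels := ⟨inferInstance⟩

/-- The twist `M(n)`, with `M(n)_j = M_{n+j}`. -/
def twistObj (n : ℤ) (M : GrMod 𝒜) : GrMod 𝒜 where
  obj j := M.obj (n + j)
  smul {i j k} h := M.smul (show i + (n + j) = n + k by lia)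
  one_smul j x := M.one_smul (n + j) x
  mul_smul h h' h'' a b c x e := M.mul_smul _ _ _ a b c x e

/-- The twist functor `M ↦ M(n)`. -/
def twist (n : ℤ) : GrMod 𝒜 ⥤ GrMod 𝒜 where
  obj M := twistObj n M
  map f := mkHom (fun j => app f (n + j)) (fun _ _ _ => app_smul f _ _ _)

instance (n : ℤ) : (twist (𝒜 := 𝒜) n).Additive where

lemma smul_comm (M : GrMod 𝒜) {i i' j k k' l : ℤ} (h : i' + j = k) (h' : i + k = l)
    (g : i + j = k') (g' : i' + k' = l) (a : 𝒜 i) (b : 𝒜 i') (x : M.obj j) :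
    M.smul h' a (M.smul h b x) = M.smul g' b (M.smul g a x) := by
  have hm : (a : A) * b ∈ 𝒜 (i + i') := SetLike.mul_mem_graded a.2 b.2
  rw [← M.mul_smul h h' (show i + i' + j = l by lia) a b ⟨_, hm⟩ x rfl,
    ← M.mul_smul g g' (show i + i' + j = l by lia) b a ⟨_, hm⟩ x (mul_comm _ _)]

/-- Multiplication by a homogeneous element `a` of degree `i`, as a natural transformation
`M(j) ⟶ M(k)` for `i + j = k`. -/
def mulTwist {i j k : ℤ} (h : i + j = k) (a : 𝒜 i) : twist (𝒜 := 𝒜) j ⟶ twist k where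
  app M := mkHom (fun t => M.smul (show i + (j + t) = k + t by lia) a)
    (fun _ _ _ => M.smul_comm _ _ _ _ _ _ _)
  naturality _ _ f := by
    ext t x
    exact (app_smul f _ _ _).symm

lemma mulTwist_add {i j k : ℤ} (h : i + j = k) (a b : 𝒜 i) :
    mulTwist h (a + b) = mulTwist h a + mulTwist h b := by
  ext M t x
  exact DFunLike.congr_fun (map_add (M.smul _) a b) x

lemma mulTwist_one (j : ℤ) :
    mulTwist (zero_add j) (⟨1, SetLike.GradedOne.one_mem⟩ : 𝒜 0) = 𝟙 _ := by
  ext M t x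
  exact (twistObj j M).one_smul t x

lemma mulTwist_comp {i i' i'' j k l : ℤ} (h : i' + j = k) (h' : i + k = l) (h'' : i'' + j = l)
    (a : 𝒜 i) (b : 𝒜 i') (c : 𝒜 i'') (e : (c : A) = a * b) :
    mulTwist h b ≫ mulTwist h' a = mulTwist h'' c := by
  ext M t x
  exact (M.mul_smul _ _ _ a b c x e).symm

/-- The isomorphism `M ⟶ M(0)`. -/
def toTwistZero (M : GrMod 𝒜) {n : ℤ} (hn : n = 0) : M ⟶ (twist n).obj M :=
  mkHom (fun j => M.smul (show 0 + j = n + j by lia) ⟨1, SetLike.GradedOne.one_mem⟩)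
    (fun _ _ _ => M.smul_comm _ _ _ _ _ _ _)

variable (𝒜) in
/-- The graded ring `A` as a graded module over itself. -/
def self : GrMod 𝒜 where
  obj j := 𝒜 j
  smul {i j k} h := AddMonoidHom.mk' (fun a => AddMonoidHom.mk'
      (fun x => ⟨a * x, h ▸ SetLike.mul_mem_graded a.2 x.2⟩)
      (fun x y => Subtype.ext (mul_add _ _ _)))
    (fun a b => by
      ext x
      exact add_mul _ _ _)
  one_smul j x := Subtype.ext (one_mul _)
  mul_smul h h' h'' a b c x e := Subtype.ext (by
    show (c : A) * x = a * (b * x)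
    rw [e, mul_assoc])

/-- The morphism `A ⟶ M(j)` sending `1` to the element `x` of degree `j`. -/
def selfHom (M : GrMod 𝒜) (j : ℤ) : M.obj j →+ (self 𝒜 ⟶ (twist j).obj M) :=
  AddMonoidHom.mk' (fun x => mkHom
      (fun t => AddMonoidHom.mk' (fun a : 𝒜 t => M.smul (add_comm t j) a x)
        (fun a b => DFunLike.congr_fun (map_add (M.smul (add_comm t j)) a b) x))
      (fun _ a b => M.mul_smul _ _ _ a b _ x rfl))
    (fun x y => by
      ext t a
      exact map_add (M.smul (add_comm t j) a) x y)

lemma selfHom_naturality {M N : GrMod 𝒜} (f : M ⟶ N) (j : ℤ) (x : M.obj j) :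
    selfHom M j x ≫ (twist j).map f = selfHom N j (app f j x) := by
  ext t a
  exact app_smul f _ _ _

lemma selfHom_smul {M : GrMod 𝒜} {i j k : ℤ} (h : i + j = k) (a : 𝒜 i) (x : M.obj j) :
    selfHom M j x ≫ (mulTwist h a).app M = selfHom M k (M.smul h a x) := by
  ext t b
  exact M.smul_comm _ _ _ _ _ _ _

end GrMod

open CochainComplex HomologicalComplex

section Generic

variable {C : Type*} [Category C] [Preadditive C]

/-- The map `α : ∐ X n ⟶ ∐ X n` given by `id - f n` on `X n`. -/
def hocolimMap (X : ℕ → CochainComplex C ℤ) [HasCoproduct X] (f : ∀ n, X n ⟶ X (n + 1)) :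
    (∐ X) ⟶ ∐ X :=
  Sigma.desc fun n => Sigma.ι X n - f n ≫ Sigma.ι X (n + 1)

/-- The homotopy colimit of a sequence of cochain complexes. -/
def hocolim [HasBinaryBiproducts C] (X : ℕ → CochainComplex C ℤ) [HasCoproduct X] (f : ∀ n, X n ⟶ X (n + 1)) :
    CochainComplex C ℤ :=
  mappingCone (hocolimMap X f)

/-- The canonical map from a term to the homotopy colimit. -/
def hocolimι [HasBinaryBiproducts C] (X : ℕ → CochainComplex C ℤ) [HasCoproduct X] (f : ∀ n, X n ⟶ X (n + 1)) (n : ℕ) :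
    X n ⟶ hocolim X f :=
  Sigma.ι X n ≫ mappingCone.inr (hocolimMap X f)

lemma hocolimMap_comm {X Y : ℕ → CochainComplex C ℤ} [HasCoproduct X] [HasCoproduct Y]
    {f : ∀ n, X n ⟶ X (n + 1)} {g : ∀ n, Y n ⟶ Y (n + 1)} (φ : ∀ n, X n ⟶ Y n)
    (h : ∀ n, f n ≫ φ (n + 1) = φ n ≫ g n) :
    hocolimMap X f ≫ Limits.Sigma.map φ = Limits.Sigma.map φ ≫ hocolimMap Y g := by
  refine Sigma.hom_ext _ _ fun n => ?_
  simp [hocolimMap, reassoc_of% h]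

/-- The map between homotopy colimits induced by a morphism of sequences. -/
def hocolimFunctorial [HasBinaryBiproducts C] {X Y : ℕ → CochainComplex C ℤ} [HasCoproduct X] [HasCoproduct Y]
    {f : ∀ n, X n ⟶ X (n + 1)} {g : ∀ n, Y n ⟶ Y (n + 1)} (φ : ∀ n, X n ⟶ Y n)
    (h : ∀ n, f n ≫ φ (n + 1) = φ n ≫ g n) : hocolim X f ⟶ hocolim Y g :=
  mappingCone.map _ _ (Limits.Sigma.map φ) (Limits.Sigma.map φ) (hocolimMap_comm φ h)

/-- The map `β : ∏ X n ⟶ ∏ X n` with components `(id, - f n)` on `X n ⊕ X (n + 1)`. -/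
def holimMap (X : ℕ → CochainComplex C ℤ) [HasProduct X] (f : ∀ n, X (n + 1) ⟶ X n) :
    (∏ᶜ X) ⟶ ∏ᶜ X :=
  Pi.lift fun n => Pi.π X n - Pi.π X (n + 1) ≫ f n

/-- The homotopy limit of an inverse sequence of cochain complexes. -/
def holim [HasBinaryBiproducts C] (X : ℕ → CochainComplex C ℤ) [HasProduct X] (f : ∀ n, X (n + 1) ⟶ X n) :
    CochainComplex C ℤ :=
  mappingCocone (holimMap X f)

section Cube

variable [HasFiniteProducts C] {r : ℕ} (F : Finset (Fin r) ⥤ C)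

/-- The sign attached to removing `i` from `U`: it is `(-1)^j` if `i` is the `j`-th element of `U`
(counting from `0`). -/
def cubeSign (U : Finset (Fin r)) (i : Fin r) : ℤ := (-1) ^ (U.filter (· < i)).card

/-- The term in degree `p` of the complex attached to a cubical diagram. -/
abbrev cubeX (p : ℤ) : C := ∏ᶜ fun S : {S : Finset (Fin r) // (S.card : ℤ) = p} => F.obj S.1

/-- The projection of `cubeX F p` to the factor indexed by `U`, or zero if `U` does not have `p`
elements. -/
def cubeπ (p : ℤ) (U : Finset (Fin r)) : cubeX F p ⟶ F.obj U :=
  if h : (U.card : ℤ) = p then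
    Pi.π (fun S : {S : Finset (Fin r) // (S.card : ℤ) = p} => F.obj S.1) ⟨U, h⟩
  else 0

/-- The Čech differential `∑ (-1)^j d_j`. -/
def cubeD (p q : ℤ) : cubeX F p ⟶ cubeX F q :=
  if p + 1 = q then
    Pi.lift fun U => ∑ i ∈ U.1,
      cubeSign U.1 i • (cubeπ F p (U.1.erase i) ≫ F.map (homOfLE (Finset.erase_subset i U.1)))
  else 0

lemma cubeD_π (p q : ℤ) (h : p + 1 = q) (U : Finset (Fin r)) (hU : (U.card : ℤ) = q) :
    cubeD F p q ≫ cubeπ F q U = ∑ i ∈ U,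
      cubeSign U i • (cubeπ F p (U.erase i) ≫ F.map (homOfLE (Finset.erase_subset i U))) := by
  simp [cubeD, cubeπ, h, hU]

lemma cubeSign_swap (U : Finset (Fin r)) {i j : Fin r} (hi : i ∈ U) (hij : i < j) :
    cubeSign U i * cubeSign (U.erase i) j = - (cubeSign U j * cubeSign (U.erase j) i) := by
  have h1 : (U.erase j).filter (· < i) = U.filter (· < i) := by
    ext k
    simp only [Finset.mem_filter, Finset.mem_erase]
    constructor
    · rintro ⟨⟨_, h⟩, h'⟩
      exact ⟨h, h'⟩
    · rintro ⟨h, h'⟩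
      exact ⟨⟨(h'.trans hij).ne, h⟩, h'⟩
  have h2 : (U.erase i).filter (· < j) = (U.filter (· < j)).erase i := by
    ext k
    simp only [Finset.mem_filter, Finset.mem_erase]
    tauto
  have h3 : i ∈ U.filter (· < j) := by simp [hi, hij]
  obtain ⟨m, hm⟩ : ∃ m, (U.filter (· < j)).card = m + 1 :=
    Nat.exists_eq_succ_of_ne_zero (Finset.card_ne_zero_of_mem h3)
  simp only [cubeSign, h1, h2, Finset.card_erase_of_mem h3, hm]
  rw [Nat.add_sub_cancel, pow_succ]
  ring

/-- The cochain complex `F(∅) → ∏_{i} F({i}) → ∏_{i < j} F({i, j}) → ⋯` attached to a cubical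
diagram `F`. -/
def cubeComplex : CochainComplex C ℤ where
  X := cubeX F
  d := cubeD F
  shape p q h := dif_neg h
  d_comp_d' p q s hpq hqs := by
    obtain rfl : p + 1 = q := hpq
    obtain rfl : p + 1 + 1 = s := hqs
    refine Pi.hom_ext _ _ fun ⟨U, hU⟩ => ?_
    have hπ : Pi.π (fun S : {S : Finset (Fin r) // (S.card : ℤ) = p + 1 + 1} => F.obj S.1) ⟨U, hU⟩ =
      cubeπ F _ U := by rw [cubeπ, dif_pos hU]
    rw [hπ, Category.assoc, cubeD_π F _ _ rfl U hU, Preadditive.comp_sum, zero_comp]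
    have key : ∀ i ∈ U, cubeD F p (p + 1) ≫ (cubeSign U i • (cubeπ F (p + 1) (U.erase i) ≫
        F.map (homOfLE (Finset.erase_subset i U)))) =
        ∑ j ∈ U.erase i, (cubeSign U i * cubeSign (U.erase i) j) •
          (cubeπ F p ((U.erase i).erase j) ≫ F.map (homOfLE
            ((Finset.erase_subset j _).trans (Finset.erase_subset i U)))) := by
      intro i hi
      have hc : ((U.erase i).card : ℤ) = p + 1 := by
        have := Finset.card_erase_add_one hi
        lia
      rw [Preadditive.comp_zsmul, ← Category.assoc, cubeD_π F _ _ rfl _ hc, Preadditive.sum_comp,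
        Finset.smul_sum]
      refine Finset.sum_congr rfl fun j _ => ?_
      rw [Preadditive.zsmul_comp, smul_smul, Category.assoc, ← F.map_comp]
      rfl
    rw [Finset.sum_congr rfl key, Finset.sum_sigma']
    refine Finset.sum_involution (fun x _ => ⟨x.2, x.1⟩) ?_ ?_ ?_ ?_
    · rintro ⟨i, j⟩ hx
      simp only [Finset.mem_sigma, Finset.mem_erase] at hx
      obtain ⟨hi, hji, hj⟩ := hx
      have hs : cubeSign U i * cubeSign (U.erase i) j =
          - (cubeSign U j * cubeSign (U.erase j) i) := by
        rcases lt_or_gt_of_ne hji with h | h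
        · rw [cubeSign_swap U hj h, neg_neg]
        · exact cubeSign_swap U hi h
      have ht : ∀ (V W : Finset (Fin r)) (hVW : V = W) (hV : V ⊆ U) (hW : W ⊆ U),
          cubeπ F p V ≫ F.map (homOfLE hV) = cubeπ F p W ≫ F.map (homOfLE hW) := by
        rintro V _ rfl _ _
        rfl
      dsimp only
      rw [hs, neg_smul, ht _ _ (Finset.erase_right_comm (a := i) (b := j) (s := U)) _
        ((Finset.erase_subset _ _).trans (Finset.erase_subset _ _)), neg_add_cancel]
    · rintro ⟨i, j⟩ hx _ h
      simp only [Finset.mem_sigma, Finset.mem_erase] at hx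
      simp only [Sigma.mk.injEq] at h
      exact hx.2.1 h.1
    · rintro ⟨i, j⟩ hx
      simp only [Finset.mem_sigma, Finset.mem_erase] at hx ⊢
      exact ⟨hx.2.2, hx.2.1.symm, hx.1⟩
    · rintro ⟨i, j⟩ _
      rfl

end Cube

end Generic

lemma hocolimFunctorial_id {C : Type*} [Category C] [Preadditive C] [HasBinaryBiproducts C]
    {X : ℕ → CochainComplex C ℤ} [HasCoproduct X] {f : ∀ n, X n ⟶ X (n + 1)}
    (φ : ∀ n, X n ⟶ X n) (hφ : ∀ n, f n ≫ φ (n + 1) = φ n ≫ f n) (e : ∀ n, φ n = 𝟙 (X n)) :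
    hocolimFunctorial φ hφ = 𝟙 (hocolim X f) := by
  have h : Limits.Sigma.map φ = 𝟙 (∐ X) := by
    refine Sigma.hom_ext _ _ fun n => ?_
    simp [e]
  simp only [hocolimFunctorial, h]
  exact mappingCone.map_id _

lemma hocolimFunctorial_comp {C : Type*} [Category C] [Preadditive C] [HasBinaryBiproducts C]
    {X Y Z : ℕ → CochainComplex C ℤ} [HasCoproduct X] [HasCoproduct Y] [HasCoproduct Z]
    {f : ∀ n, X n ⟶ X (n + 1)} {g : ∀ n, Y n ⟶ Y (n + 1)} {k : ∀ n, Z n ⟶ Z (n + 1)}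
    (φ : ∀ n, X n ⟶ Y n) (hφ : ∀ n, f n ≫ φ (n + 1) = φ n ≫ g n)
    (ψ : ∀ n, Y n ⟶ Z n) (hψ : ∀ n, g n ≫ ψ (n + 1) = ψ n ≫ k n)
    (χ : ∀ n, X n ⟶ Z n) (hχ : ∀ n, f n ≫ χ (n + 1) = χ n ≫ k n) (e : ∀ n, φ n ≫ ψ n = χ n) :
    hocolimFunctorial φ hφ ≫ hocolimFunctorial ψ hψ = hocolimFunctorial χ hχ := by
  have h : Limits.Sigma.map φ ≫ Limits.Sigma.map ψ = Limits.Sigma.map χ := by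
    refine Sigma.hom_ext _ _ fun n => ?_
    simp [← e]
  simp only [hocolimFunctorial, ← h]
  exact (mappingCone.map_comp _ _ _ _ _ _ _ _ _).symm

lemma hocolimι_functorial {C : Type*} [Category C] [Preadditive C] [HasBinaryBiproducts C]
    {X Y : ℕ → CochainComplex C ℤ} [HasCoproduct X] [HasCoproduct Y]
    {f : ∀ n, X n ⟶ X (n + 1)} {g : ∀ n, Y n ⟶ Y (n + 1)} (φ : ∀ n, X n ⟶ Y n)
    (h : ∀ n, f n ≫ φ (n + 1) = φ n ≫ g n) (n : ℕ) :
    hocolimι X f n ≫ hocolimFunctorial φ h = φ n ≫ hocolimι Y g n := by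
  have e : mappingCone.inr (hocolimMap X f) ≫ hocolimFunctorial φ h =
      Limits.Sigma.map φ ≫ mappingCone.inr (hocolimMap Y g) := by
    rw [hocolimFunctorial, mappingCone.map]
    exact mappingCone.inr_desc _ _ _ _
  refine (Category.assoc _ _ _).trans ((congrArg (fun z => Sigma.ι X n ≫ z) e).trans ?_)
  refine (Category.assoc _ _ _).symm.trans ((congrArg
    (fun z => z ≫ mappingCone.inr (hocolimMap Y g)) ?_).trans (Category.assoc _ _ _))
  simp

section Total

variable {C : Type*} [Category C] [Preadditive C]
  (K : HomologicalComplex₂ C (ComplexShape.up ℤ) (ComplexShape.up ℤ))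
  {B : CochainComplex C ℤ} (φ : K.X 0 ⟶ B)

/-- The morphism from the total complex which is `φ` on the column `p = 0` and zero on the other
columns, on the component of bidegree `(p, q)`. -/
def totalToAux (p q n : ℤ) (h : p + q = n) : (K.X p).X q ⟶ B.X n :=
  if hp : p = 0 then (K.XXIsoOfEq _ _ _ hp (show q = n by lia)).hom ≫ φ.f n else 0

lemma totalToAux_zero (n : ℤ) : totalToAux K φ 0 n n (zero_add n) = φ.f n := by
  simp [totalToAux]

lemma d_totalToAux (hφ : K.d (-1) 0 ≫ φ = 0) (p q n : ℤ) (h : p + 1 + q = n) :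
    (K.d p (p + 1)).f q ≫ totalToAux K φ (p + 1) q n h = 0 := by
  by_cases hp : p = -1
  · subst hp
    obtain rfl : q = n := by lia
    refine Eq.trans ?_ (congrArg (fun z => HomologicalComplex.Hom.f z q) hφ)
    exact congrArg (fun z => (K.d (-1) 0).f q ≫ z) (totalToAux_zero K φ q)
  · rw [totalToAux, dif_neg (by lia), comp_zero]

/-- The morphism from the total complex of a double complex given by a morphism from the column
`p = 0` that vanishes on the image of the column `p = -1`. -/
def totalTo [K.HasTotal (ComplexShape.up ℤ)] (hφ : K.d (-1) 0 ≫ φ = 0) :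
    K.total (ComplexShape.up ℤ) ⟶ B where
  f n := K.totalDesc (totalToAux K φ · · n)
  comm' i j hij := by
    obtain rfl : i + 1 = j := hij
    refine HomologicalComplex₂.total.hom_ext _ fun p q h' => ?_
    have h : p + q = i := h'
    rw [HomologicalComplex₂.ι_totalDesc_assoc,
      HomologicalComplex₂.total_d, Preadditive.add_comp, Preadditive.comp_add,
      HomologicalComplex₂.ι_D₁_assoc, HomologicalComplex₂.ι_D₂_assoc,
      HomologicalComplex₂.d₁_eq _ _ (show (ComplexShape.up ℤ).Rel p (p + 1) from rfl) q (i + 1)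
        (show p + 1 + q = i + 1 by lia),
      HomologicalComplex₂.d₂_eq _ _ p (show (ComplexShape.up ℤ).Rel q (q + 1) from rfl) (i + 1)
        (show p + (q + 1) = i + 1 by lia), Linear.units_smul_comp, Linear.units_smul_comp,
      Category.assoc, Category.assoc, HomologicalComplex₂.ι_totalDesc,
      HomologicalComplex₂.ι_totalDesc, d_totalToAux K φ hφ, smul_zero, zero_add]
    by_cases hp : p = 0
    · subst hp
      obtain rfl : q = i := by lia
      rw [totalToAux_zero, totalToAux_zero]
      simp
    · rw [totalToAux, totalToAux, dif_neg hp, dif_neg hp]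
      simp

end Total

namespace GrMod

variable {A : Type u} [CommRing A] {𝒜 : ℤ → AddSubgroup A} [GradedRing 𝒜]

/-- The power `a ^ n` of a homogeneous element of degree `m`, of degree `n * m`. -/
def hpow {m : ℤ} (a : 𝒜 m) (n : ℕ) : 𝒜 (n * m) :=
  ⟨(a : A) ^ n, by simpa using SetLike.pow_mem_graded n a.2⟩

variable (𝒜) in
/-- The free module `A(n * m)`, as a complex concentrated in degree `0`. -/
abbrev locX (m : ℤ) (n : ℕ) : CochainComplex (GrMod 𝒜) ℤ :=
  (singleFunctor (GrMod 𝒜) 0).obj ((twist (n * m)).obj (self 𝒜))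

/-- The map `A(n * m) ⟶ A((n + 1) * m)` given by multiplication by `a`. -/
abbrev locStep {m : ℤ} (a : 𝒜 m) (n : ℕ) : locX 𝒜 m n ⟶ locX 𝒜 m (n + 1) :=
  (singleFunctor (GrMod 𝒜) 0).map
    ((mulTwist (show m + n * m = ((n + 1 : ℕ) : ℤ) * m by push_cast; ring) a).app (self 𝒜))

/-- The complex `A_{a} = hocolim [A ⟶ A(m) ⟶ A(2m) ⟶ ⋯]` for `a` homogeneous of degree `m`. -/
def loc {m : ℤ} (a : 𝒜 m) : CochainComplex (GrMod 𝒜) ℤ := hocolim (locX 𝒜 m) (locStep a)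

/-- The canonical map `A ⟶ A_{a}`. -/
def locι {m : ℤ} (a : 𝒜 m) : (singleFunctor (GrMod 𝒜) 0).obj (self 𝒜) ⟶ loc a :=
  (singleFunctor (GrMod 𝒜) 0).map (toTwistZero (self 𝒜) (by simp)) ≫
    hocolimι (locX 𝒜 m) (locStep a) 0

/-- The map `A(n * m) ⟶ A(n * m')` given by multiplication by `c ^ n`, for `c` homogeneous of
degree `m' - m`. -/
abbrev locMapAux {k m m' : ℤ} (h : k + m = m') (c : 𝒜 k) (n : ℕ) : locX 𝒜 m n ⟶ locX 𝒜 m' n :=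
  (singleFunctor (GrMod 𝒜) 0).map
    ((mulTwist (show n * k + n * m = n * m' by rw [← h]; ring) (hpow c n)).app (self 𝒜))

lemma locMapAux_comm {k m m' : ℤ} (h : k + m = m') (c : 𝒜 k) (a : 𝒜 m) (b : 𝒜 m')
    (e : (b : A) = c * a) (n : ℕ) :
    locStep a n ≫ locMapAux h c (n + 1) = locMapAux h c n ≫ locStep b n := by
  rw [← Functor.map_comp, ← Functor.map_comp, ← NatTrans.comp_app, ← NatTrans.comp_app,
    mulTwist_comp _ _ (show (((n + 1 : ℕ) : ℤ) * k + m) + n * m = ((n + 1 : ℕ) : ℤ) * m' by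
      rw [← h]; push_cast; ring) _ _
      ⟨(c : A) ^ (n + 1) * a, SetLike.mul_mem_graded (hpow c (n + 1)).2 a.2⟩ rfl,
    mulTwist_comp _ _ (show (((n + 1 : ℕ) : ℤ) * k + m) + n * m = ((n + 1 : ℕ) : ℤ) * m' by
      rw [← h]; push_cast; ring) _ _
      ⟨(c : A) ^ (n + 1) * a, SetLike.mul_mem_graded (hpow c (n + 1)).2 a.2⟩ (by
        simp only [hpow, e]
        ring)]

/-- The map `A_{a} ⟶ A_{b}` for `b = c * a`, given by `c ^ n : A(n * m) ⟶ A(n * m')`. -/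
def locMap {k m m' : ℤ} (h : k + m = m') (c : 𝒜 k) (a : 𝒜 m) (b : 𝒜 m')
    (e : (b : A) = c * a) : loc a ⟶ loc b :=
  hocolimFunctorial (locMapAux h c) (locMapAux_comm h c a b e)

lemma locMap_id {k m : ℤ} (h : k + m = m) (c : 𝒜 k) (a : 𝒜 m) (e : (a : A) = c * a)
    (hc : (c : A) = 1) : locMap h c a a e = 𝟙 _ := by
  refine hocolimFunctorial_id _ _ fun n => ?_
  refine Eq.trans ?_ ((singleFunctor (GrMod 𝒜) 0).map_id _)
  refine congrArg (fun z => (singleFunctor (GrMod 𝒜) 0).map z) ?_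
  ext t (x : 𝒜 (n * m + t))
  refine Subtype.ext ?_
  change (c : A) ^ n * (x : A) = x
  rw [hc, one_pow, one_mul]

lemma locMap_comp {k k' k'' m m' m'' : ℤ} (h : k + m = m') (h' : k' + m' = m'')
    (h'' : k'' + m = m'') (c : 𝒜 k) (c' : 𝒜 k') (c'' : 𝒜 k'') (a : 𝒜 m) (a' : 𝒜 m') (a'' : 𝒜 m'')
    (e : (a' : A) = c * a) (e' : (a'' : A) = c' * a') (e'' : (a'' : A) = c'' * a)
    (hc : (c'' : A) = c' * c) :
    locMap h c a a' e ≫ locMap h' c' a' a'' e' = locMap h'' c'' a a'' e'' := by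
  refine hocolimFunctorial_comp _ _ _ _ _ _ fun n => ?_
  rw [← Functor.map_comp, ← NatTrans.comp_app]
  refine congrArg (fun z => (singleFunctor (GrMod 𝒜) 0).map (NatTrans.app z (self 𝒜))) ?_
  exact mulTwist_comp _ _ _ _ _ _ (by simp only [hpow, hc, mul_pow])

lemma locι_map {k m m' : ℤ} (h : k + m = m') (c : 𝒜 k) (a : 𝒜 m) (b : 𝒜 m')
    (e : (b : A) = c * a) : locι a ≫ locMap h c a b e = locι b := by
  refine (Category.assoc _ _ _).trans ((congrArg
    (fun z => (singleFunctor (GrMod 𝒜) 0).map (toTwistZero (self 𝒜) (by simp)) ≫ z)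
    (hocolimι_functorial (locMapAux h c) (locMapAux_comm h c a b e) 0)).trans ?_)
  rw [← Category.assoc, ← Functor.map_comp]
  refine congrArg (fun z => (singleFunctor (GrMod 𝒜) 0).map z ≫
    hocolimι (locX 𝒜 m') (locStep b) 0) ?_
  ext t (x : 𝒜 t)
  refine Subtype.ext ?_
  change (c : A) ^ 0 * (1 * (x : A)) = 1 * x
  simp

section Family

variable {r : ℕ} {f : Fin r → A} {d : Fin r → ℤ} (hf : ∀ i, f i ∈ 𝒜 (d i))

/-- The product of the `f i` for `i ∈ S`, as a homogeneous element. -/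
def famProd (S : Finset (Fin r)) : 𝒜 (∑ i ∈ S, d i) :=
  ⟨∏ i ∈ S, f i, SetLike.prod_mem_graded _ _ _ fun i _ => hf i⟩

/-- The transition map `A_{f_S} ⟶ A_{f_T}` for `S ⊆ T`. -/
def famMap {S T : Finset (Fin r)} (h : S ⊆ T) : loc (famProd hf S) ⟶ loc (famProd hf T) :=
  locMap (Finset.sum_sdiff h) (famProd hf (T \ S)) _ _ (Finset.prod_sdiff h).symm

lemma famMap_id (S : Finset (Fin r)) : famMap hf (Finset.Subset.refl S) = 𝟙 _ :=
  locMap_id _ _ _ _ (by simp [famProd])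

lemma famMap_comp {S T U : Finset (Fin r)} (h : S ⊆ T) (h' : T ⊆ U) :
    famMap hf h ≫ famMap hf h' = famMap hf (h.trans h') :=
  locMap_comp _ _ _ _ _ _ _ _ _ _ _ _ (by
    refine (Finset.prod_sdiff (Finset.sdiff_subset_sdiff h' le_rfl)).symm.trans ?_
    refine congrArg (fun V => (∏ i ∈ V, f i) * ∏ i ∈ T \ S, f i) ?_
    ext i
    have h1 : i ∈ S → i ∈ T := fun hi => h hi
    simp only [Finset.mem_sdiff]
    tauto)

lemma locι_famMap {S T : Finset (Fin r)} (h : S ⊆ T) :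
    locι (famProd hf S) ≫ famMap hf h = locι (famProd hf T) :=
  locι_map _ _ _ _ _

/-- The complex attached to `S`: it is `A` if `S` is empty, and `A_{f_S}` otherwise, where `f_S` is
the product of the `f i` for `i ∈ S`. -/
def cechObj (S : Finset (Fin r)) : CochainComplex (GrMod 𝒜) ℤ :=
  if S = ∅ then (singleFunctor (GrMod 𝒜) 0).obj (self 𝒜) else loc (famProd hf S)

lemma cechObj_empty {S : Finset (Fin r)} (h : S = ∅) :
    cechObj hf S = (singleFunctor (GrMod 𝒜) 0).obj (self 𝒜) := if_pos h

lemma cechObj_of_ne {S : Finset (Fin r)} (h : S ≠ ∅) : cechObj hf S = loc (famProd hf S) := if_neg h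

/-- The transition maps between the complexes `cechObj hf S`. -/
def cechMap {S T : Finset (Fin r)} (h : S ⊆ T) : cechObj hf S ⟶ cechObj hf T :=
  if hT : T = ∅ then
    eqToHom (congrArg (cechObj hf) ((Finset.subset_empty.1 (hT ▸ h)).trans hT.symm))
  else if hS : S = ∅ then
    eqToHom (cechObj_empty hf hS) ≫ locι (famProd hf T) ≫ eqToHom (cechObj_of_ne hf hT).symm
  else
    eqToHom (cechObj_of_ne hf hS) ≫ famMap hf h ≫ eqToHom (cechObj_of_ne hf hT).symm

/-- The cubical diagram formed by `A` and the `A_{f_S}`, `S ≠ ∅`. -/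
def cechDiagram : Finset (Fin r) ⥤ CochainComplex (GrMod 𝒜) ℤ where
  obj := cechObj hf
  map φ := cechMap hf φ.le
  map_id S := by
    by_cases hS : S = ∅
    · simp [cechMap, hS]
    · simp only [cechMap, hS, dite_false]
      rw [famMap_id]
      simp
  map_comp {S T U} φ ψ := by
    by_cases hS : S = ∅ <;> by_cases hT : T = ∅ <;> by_cases hU : U = ∅
    · subst hS hT hU
      simp [cechMap]
    · subst hS hT
      simp [cechMap, hU]
    · exact absurd (Finset.subset_empty.1 (hU ▸ ψ.le)) hT
    · subst hS
      simp only [cechMap, hT, hU, dite_true, dite_false, Category.assoc, eqToHom_trans_assoc,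
        eqToHom_refl, Category.id_comp]
      rw [← Category.assoc (locι _) (famMap _ _), locι_famMap]
    · exact absurd (Finset.subset_empty.1 (hT ▸ φ.le)) hS
    · exact absurd (Finset.subset_empty.1 (hT ▸ φ.le)) hS
    · exact absurd (Finset.subset_empty.1 (hU ▸ ψ.le)) hT
    · simp only [cechMap, hS, hT, hU, dite_false, Category.assoc, eqToHom_trans_assoc,
        eqToHom_refl, Category.id_comp]
      rw [← Category.assoc (famMap _ _) (famMap _ _), famMap_comp]

/-- The double complex
`A ⟶ ∏_i A_{f_i} ⟶ ∏_{i < j} A_{f_i f_j} ⟶ ⋯ ⟶ A_{f_1 ⋯ f_r}`. -/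
def cechBicomplex : HomologicalComplex₂ (GrMod 𝒜) (ComplexShape.up ℤ) (ComplexShape.up ℤ) :=
  cubeComplex (cechDiagram hf)

/-- The free resolution of the local cohomology complex of `A`: the total complex of the double
complex above. -/
def freeRΓ : CochainComplex (GrMod 𝒜) ℤ := (cechBicomplex hf).total (ComplexShape.up ℤ)

/-- The projection of the column `p = 0` to `A`. -/
def cechColumnZero : (cechBicomplex hf).X 0 ⟶ (singleFunctor (GrMod 𝒜) 0).obj (self 𝒜) :=
  cubeπ (cechDiagram hf) 0 ∅ ≫ eqToHom (cechObj_empty hf rfl)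

lemma cechBicomplex_d_columnZero : (cechBicomplex hf).d (-1) 0 ≫ cechColumnZero hf = 0 := by
  have e := cubeD_π (cechDiagram hf) (-1) 0 rfl ∅ rfl
  rw [Finset.sum_empty] at e
  exact (Category.assoc _ _ _).symm.trans
    ((congrArg (fun z => z ≫ eqToHom (cechObj_empty hf rfl)) e).trans zero_comp)

/-- The projection `freeRΓ hf ⟶ A` to the first component. -/
def freeRΓπ : freeRΓ hf ⟶ (singleFunctor (GrMod 𝒜) 0).obj (self 𝒜) :=
  totalTo (cechBicomplex hf) (cechColumnZero hf) (cechBicomplex_d_columnZero hf)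

end Family

end GrMod

open HomComplex

namespace GrMod

variable {A : Type u} [CommRing A] {𝒜 : ℤ → AddSubgroup A} [GradedRing 𝒜]

/-- The termwise twist `M ↦ M(n)` of cochain complexes. -/
abbrev twistCh (n : ℤ) : CochainComplex (GrMod 𝒜) ℤ ⥤ CochainComplex (GrMod 𝒜) ℤ :=
  (twist n).mapHomologicalComplex (ComplexShape.up ℤ)

/-- Multiplication by a homogeneous element of degree `i` on a complex `M`, as a morphism
`M(j) ⟶ M(k)` for `i + j = k`. -/
def mulCh (M : CochainComplex (GrMod 𝒜) ℤ) {i j k : ℤ} (h : i + j = k) (a : 𝒜 i) :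
    (twistCh j).obj M ⟶ (twistCh k).obj M :=
  (NatTrans.mapHomologicalComplex (mulTwist h a) (ComplexShape.up ℤ)).app M

lemma mulCh_f (M : CochainComplex (GrMod 𝒜) ℤ) {i j k : ℤ} (h : i + j = k) (a : 𝒜 i) (p : ℤ) :
    (mulCh M h a).f p = (mulTwist h a).app (M.X p) := rfl

lemma mulCh_add (M : CochainComplex (GrMod 𝒜) ℤ) {i j k : ℤ} (h : i + j = k) (a b : 𝒜 i) :
    mulCh M h (a + b) = mulCh M h a + mulCh M h b := by
  refine HomologicalComplex.hom_ext _ _ fun p => ?_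
  exact congrArg (fun z => NatTrans.app z (M.X p)) (mulTwist_add h a b)

lemma mulCh_one (M : CochainComplex (GrMod 𝒜) ℤ) (j : ℤ) :
    mulCh M (zero_add j) ⟨1, SetLike.GradedOne.one_mem⟩ = 𝟙 _ := by
  refine HomologicalComplex.hom_ext _ _ fun p => ?_
  exact congrArg (fun z => NatTrans.app z (M.X p)) (mulTwist_one (𝒜 := 𝒜) j)

lemma mulCh_comp (M : CochainComplex (GrMod 𝒜) ℤ) {i i' i'' j k l : ℤ} (h : i' + j = k)
    (h' : i + k = l) (h'' : i'' + j = l) (a : 𝒜 i) (b : 𝒜 i') (c : 𝒜 i'')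
    (e : (c : A) = a * b) : mulCh M h b ≫ mulCh M h' a = mulCh M h'' c := by
  refine HomologicalComplex.hom_ext _ _ fun p => ?_
  exact congrArg (fun z => NatTrans.app z (M.X p)) (mulTwist_comp h h' h'' a b c e)

lemma mulCh_naturality {M N : CochainComplex (GrMod 𝒜) ℤ} (g : M ⟶ N) {i j k : ℤ}
    (h : i + j = k) (a : 𝒜 i) :
    mulCh M h a ≫ (twistCh k).map g = (twistCh j).map g ≫ mulCh N h a :=
  ((NatTrans.mapHomologicalComplex (mulTwist h a) (ComplexShape.up ℤ)).naturality g).symm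

/-- The complex `T(M, a) = holim [M ⟵ M(-m) ⟵ M(-2m) ⟵ ⋯]` for `a` homogeneous of
degree `m`, where the transition maps are given by multiplication by `a`. -/
def T (M : CochainComplex (GrMod 𝒜) ℤ) {m : ℤ} (a : 𝒜 m) : CochainComplex (GrMod 𝒜) ℤ :=
  holim (fun n : ℕ => (twistCh (-(n * m))).obj M) fun n =>
    mulCh M (show m + -(((n + 1 : ℕ) : ℤ) * m) = -(n * m) by push_cast; ring) a

section Hom

/-- Postcomposition of cochains with a morphism of complexes. -/
def postcomp (K : CochainComplex (GrMod 𝒜) ℤ) {L L' : CochainComplex (GrMod 𝒜) ℤ} (g : L ⟶ L')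
    (n : ℤ) : Cochain K L n →+ Cochain K L' n :=
  AddMonoidHom.mk' (fun z => z.comp (Cochain.ofHom g) (add_zero n))
    (fun _ _ => Cochain.add_comp _ _ _ _)

section

variable {K L L' L'' : CochainComplex (GrMod 𝒜) ℤ} {n : ℤ}

lemma postcomp_apply (g : L ⟶ L') (z : Cochain K L n) :
    postcomp K g n z = z.comp (Cochain.ofHom g) (add_zero n) := rfl

lemma postcomp_add (g g' : L ⟶ L') : postcomp K (g + g') n = postcomp K g n + postcomp K g' n := by
  ext z : 1
  simp [postcomp_apply]

lemma postcomp_id : postcomp K (𝟙 L) n = AddMonoidHom.id _ := by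
  ext z : 1
  simp [postcomp_apply]

lemma postcomp_comp (g : L ⟶ L') (g' : L' ⟶ L'') (z : Cochain K L n) :
    postcomp K (g ≫ g') n z = postcomp K g' n (postcomp K g n z) := by
  simp [postcomp_apply]

lemma δ_postcomp (g : L ⟶ L') (z : Cochain K L n) (n' : ℤ) :
    δ n n' (postcomp K g n z) = postcomp K g n' (δ n n' z) :=
  δ_comp_ofHom z g n'

end

/-- The graded module of `n`-cochains of the internal Hom complex: its component of degree `j`
consists of the families of maps `K^p ⟶ M^{p+n}` of modules that are homogeneous of
degree `j`, that is, of morphisms `K^p ⟶ M^{p+n}(j)` of graded modules. -/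
def ihomX (K M : CochainComplex (GrMod 𝒜) ℤ) (n : ℤ) : GrMod 𝒜 where
  obj j := Cochain K ((twistCh j).obj M) n
  smul h := AddMonoidHom.mk' (fun a => postcomp K (mulCh M h a) n)
    (fun a b => by rw [mulCh_add, postcomp_add])
  one_smul j z := by
    change postcomp K (mulCh M _ _) n z = z
    rw [mulCh_one, postcomp_id]
    rfl
  mul_smul h h' h'' a b c z e := by
    change postcomp K (mulCh M h'' c) n z =
      postcomp K (mulCh M h' a) n (postcomp K (mulCh M h b) n z)
    rw [← postcomp_comp, mulCh_comp M h h' h'' a b c e]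

/-- The internal Hom complex `Hom_A(K, M)` of graded modules, with differential
`z ↦ d ∘ z - (-1)^n z ∘ d` on `n`-cochains. -/
def ihomObj (K M : CochainComplex (GrMod 𝒜) ℤ) : CochainComplex (GrMod 𝒜) ℤ where
  X n := ihomX K M n
  d n n' := mkHom (fun j => (δ_hom ℤ K ((twistCh j).obj M) n n').toAddMonoidHom)
    (fun h a z => δ_postcomp (mulCh M h a) z n')
  shape n n' h := by
    ext j z
    exact δ_shape n n' h z
  d_comp_d' n n' n'' _ _ := by
    ext j z
    exact δ_δ n n' n'' z

/-- The morphism `Hom_A(K, M) ⟶ Hom_A(K, N)` induced by `M ⟶ N`. -/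
def ihomMap (K : CochainComplex (GrMod 𝒜) ℤ) {M N : CochainComplex (GrMod 𝒜) ℤ} (g : M ⟶ N) :
    ihomObj K M ⟶ ihomObj K N where
  f n := mkHom (M := ihomX K M n) (N := ihomX K N n) (fun j => postcomp K ((twistCh j).map g) n)
    (fun {i j k} h a (z : Cochain K ((twistCh j).obj M) n) => by
      change postcomp K ((twistCh k).map g) n (postcomp K (mulCh M h a) n z) =
        postcomp K (mulCh N h a) n (postcomp K ((twistCh j).map g) n z)
      rw [← postcomp_comp, ← postcomp_comp, mulCh_naturality])
  comm' n n' _ := by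
    ext j z
    exact δ_postcomp ((twistCh j).map g) z n'

/-- The functor `Hom_A(K, -)` on cochain complexes of graded modules. -/
def ihom (K : CochainComplex (GrMod 𝒜) ℤ) :
    CochainComplex (GrMod 𝒜) ℤ ⥤ CochainComplex (GrMod 𝒜) ℤ where
  obj M := ihomObj K M
  map g := ihomMap K g
  map_id M := by
    refine HomologicalComplex.hom_ext _ _ fun n => ?_
    ext j (z : Cochain K ((twistCh j).obj M) n)
    change postcomp K ((twistCh j).map (𝟙 M)) n z = z
    rw [CategoryTheory.Functor.map_id, postcomp_id]
    rfl
  map_comp {L M N} f g := by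
    refine HomologicalComplex.hom_ext _ _ fun n => ?_
    ext j (z : Cochain K ((twistCh j).obj L) n)
    change postcomp K ((twistCh j).map (f ≫ g)) n z =
      postcomp K ((twistCh j).map g) n (postcomp K ((twistCh j).map f) n z)
    rw [CategoryTheory.Functor.map_comp, postcomp_comp]

section Aug

variable {K : CochainComplex (GrMod 𝒜) ℤ}
  (π : K ⟶ (singleFunctor (GrMod 𝒜) 0).obj (self 𝒜)) (M : CochainComplex (GrMod 𝒜) ℤ)

/-- For `π : K ⟶ A` and `x ∈ M^n` homogeneous of degree `j`, the cochain `K ⟶ A ⟶ M` of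
cohomological degree `n`, where the last map sends `1` to `x`. -/
def augCochain (n j : ℤ) : (M.X n).obj j →+ Cochain K ((twistCh j).obj M) n :=
  AddMonoidHom.mk' (fun x => (Cochain.ofHom π).comp (Cochain.fromSingleMk
      (K := (twistCh j).obj M) (selfHom (M.X n) j x) (zero_add n)) (zero_add n))
    (fun x y => by
      rw [map_add]
      refine Eq.trans ?_ (Cochain.comp_add _ _ _ _)
      exact congrArg (fun z => (Cochain.ofHom π).comp z (zero_add n))
        (Cochain.fromSingleMk_add _ _ _))

lemma augCochain_apply (n j : ℤ) (x : (M.X n).obj j) :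
    augCochain π M n j x = (Cochain.ofHom π).comp (Cochain.fromSingleMk
      (K := (twistCh j).obj M) (selfHom (M.X n) j x) (zero_add n)) (zero_add n) := rfl

lemma augCochain_postcomp {N : CochainComplex (GrMod 𝒜) ℤ} {n j k : ℤ}
    (g : (twistCh j).obj M ⟶ (twistCh k).obj N) (x : (M.X n).obj j) (y : (N.X n).obj k)
    (e : selfHom (M.X n) j x ≫ g.f n = selfHom (N.X n) k y) :
    postcomp K g n (augCochain π M n j x) = augCochain π N n k y := by
  rw [postcomp_apply, augCochain_apply, augCochain_apply, ← e,
    Cochain.comp_assoc_of_first_is_zero_cochain]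
  exact congrArg (fun z => (Cochain.ofHom π).comp z (zero_add n))
    (Cochain.fromSingleMk_postcomp (K := (twistCh j).obj M) (selfHom (M.X n) j x)
      (zero_add n) g).symm

lemma δ_augCochain (n n' j : ℤ) (x : (M.X n).obj j) :
    δ n n' (augCochain π M n j x) = augCochain π M n' j (app (M.d n n') j x) := by
  rw [augCochain_apply, augCochain_apply, δ_ofHom_comp]
  refine congrArg (fun z => (Cochain.ofHom π).comp z (zero_add n')) ?_
  refine (Cochain.δ_fromSingleMk _ _ _ _ (zero_add n')).trans ?_
  exact congrArg (fun z => Cochain.fromSingleMk (K := (twistCh j).obj M) z (zero_add n'))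
    (selfHom_naturality (M.d n n') j x)

/-- The natural map `M ⟶ Hom_A(K, M)` induced by an augmentation `π : K ⟶ A`. -/
def augHom : 𝟭 (CochainComplex (GrMod 𝒜) ℤ) ⟶ ihom K where
  app M :=
    { f := fun n => mkHom (N := ihomX K M n) (fun j => augCochain π M n j)
        (fun h a x => (augCochain_postcomp π M (mulCh M h a) x _ (selfHom_smul h a x)).symm)
      comm' := fun n n' _ => by
        ext j x
        exact δ_augCochain π M n n' j x }
  naturality M N g := by
    refine HomologicalComplex.hom_ext _ _ fun n => ?_
    ext j x
    exact (augCochain_postcomp π M ((twistCh j).map g) x _ (selfHom_naturality (g.f n) j x)).symm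

end Aug

end Hom

section LocalHomology

variable {r : ℕ} {f : Fin r → A} {d : Fin r → ℤ} (hf : ∀ i, f i ∈ 𝒜 (d i))

/-- The local homology functor `LΛ_{(f_1, …, f_r)} = Hom_A(freeRΓ, -)` on cochain complexes. -/
def LΛ : CochainComplex (GrMod 𝒜) ℤ ⥤ CochainComplex (GrMod 𝒜) ℤ := ihom (freeRΓ hf)

/-- The natural map `M ⟶ LΛ_{(f_1, …, f_r)}(M)` induced by the projection `freeRΓ ⟶ A`. -/
def toLΛ : 𝟭 (CochainComplex (GrMod 𝒜) ℤ) ⟶ LΛ hf := augHom (freeRΓπ hf)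

variable [HasDerivedCategory.{w} (GrMod 𝒜)]

/-- The functor induced by the local homology functor on the derived category, provided that
the latter sends quasi-isomorphisms to isomorphisms in the derived category. -/
def derivedLΛ (h : (quasiIso (GrMod 𝒜) (ComplexShape.up ℤ)).IsInvertedBy
    (LΛ hf ⋙ DerivedCategory.Q)) : DerivedCategory (GrMod 𝒜) ⥤ DerivedCategory (GrMod 𝒜) :=
  Localization.lift (LΛ hf ⋙ DerivedCategory.Q) h DerivedCategory.Q

/-- The natural map `M ⟶ LΛ_I(M)` in the derived category, for a cochain complex `M`. -/
def toDerivedLΛ (h : (quasiIso (GrMod 𝒜) (ComplexShape.up ℤ)).IsInvertedBy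
    (LΛ hf ⋙ DerivedCategory.Q)) (M : CochainComplex (GrMod 𝒜) ℤ) :
    DerivedCategory.Q.obj M ⟶ (derivedLΛ hf h).obj (DerivedCategory.Q.obj M) :=
  DerivedCategory.Q.map ((toLΛ hf).app M) ≫
    (Localization.fac (LΛ hf ⋙ DerivedCategory.Q) h DerivedCategory.Q).inv.app M

/-- The objects of the derived category of graded modules that are derived complete with respect
to `I`: for every homogeneous `a ∈ I`, the complex `T(M, a)` has zero cohomology (for every complex
`M` representing the object). -/
def derivedComplete (I : HomogeneousIdeal 𝒜) : ObjectProperty (DerivedCategory (GrMod 𝒜)) :=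
  fun X => ∀ (m : ℤ) (a : 𝒜 m), (a : A) ∈ I.toIdeal →
    ∀ M : CochainComplex (GrMod 𝒜) ℤ, Nonempty (DerivedCategory.Q.obj M ≅ X) → (T M a).Acyclic

end LocalHomology

end GrMod

end

noncomputable section

/-! ### Differential modules: acyclicity and quasi-isomorphisms. -/

namespace DiffMod

variable {R X Y : Type*} [CommRing R] [AddCommGroup X] [Module R X] [AddCommGroup Y] [Module R Y]

/-! The problem is turned into linear algebra over the ungraded ring `A`. A complex `M` of graded
modules is replaced by the product `TotCh M` of all its bigraded components, an `A`-module with a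
differential `totD M`. Exactness is componentwise, so `M` is acyclic iff `Acyc (totD M)`, and a map
is a quasi-isomorphism iff `Qis` holds (`acyclic_iff_acyc`, `quasiIso_iff_qis`). The complex
`freeRΓ` is free on generators indexed by `CechIdx r`, with differential given by the matrix
`cechMat` (`isBasis_rgGen`, `map_d_rgGen`). In these coordinates its internal Hom into `M` is a
product of copies of `TotCh M` with a twisted differential `cechD` (`coord_bijective`,
`coord_totD`). Likewise `T M a` is acyclic iff the maps out of the telescope of `a` are
(`acyclic_T_iff`).

Twisted differentials are controlled by two forms of dévissage along a rank function: the diagonal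
blocks are copies of the coefficients (`acyc_cellD`), or they split into matched pairs
(`acyc_of_matching`). The following facts result.

Maps out of the Čech complex preserve quasi-isomorphisms (`qis_cellMap_cech`).

Completeness at `a` says that `id - a * shift` is bijective on sequences of cohomology classes. This
is a condition of Jacobson radical type, so the elements `a` satisfying it form an ideal
(`bijective_shiftMap_iff`), and generators suffice.

Local homology is complete (`acyc_locD_cechD`): the telescope of `f i` and the Čech complex may be
exchanged; `f i` is a homotopy equivalence on maps out of its own telescope; and when `f i` acts
invertibly, pairing `S` with `S ∪ {i}` contracts the Čech complex.

For complete coefficients the unit is a quasi-isomorphism (`qis_cechη`), because the part indexed by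
`S ≠ ∅` is filtered by maps out of the telescopes of the products `f_S`, which lie in `I`. Local
homology applied to the unit of `M` is, after an exchange of indices, the unit of the local homology
of `M`, hence a quasi-isomorphism (`qis_cellMap_cechη`).

A pointed endofunctor `η : 𝟭 ⟶ L` with values in `P`, invertible on `P` and inverted by `L`, is a
reflection onto `P` with unit `η` (`adjunctionOfPointed`). -/

/-- A differential `d` on a module is acyclic if its kernel is contained in its range. -/
def Acyc (d : X →ₗ[R] X) : Prop := ∀ x, d x = 0 → ∃ y, d y = x

/-- A linear map between differential modules whose mapping cone is acyclic. -/
def Qis (dX : X →ₗ[R] X) (dY : Y →ₗ[R] Y) (g : X →ₗ[R] Y) : Prop :=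
  ∀ x y, dX x = 0 → dY y = g x → ∃ p q, dX p = x ∧ g p + dY q = y

lemma Qis.of_bijective {dX : X →ₗ[R] X} {dY : Y →ₗ[R] Y} {g : X →ₗ[R] Y}
    (h : ∀ x, g (dX x) = dY (g x)) (hg : Function.Bijective g) : Qis dX dY g := by
  intro x y hx hy
  obtain ⟨p, rfl⟩ := hg.2 y
  exact ⟨p, 0, hg.1 (by rw [h, hy]), by simp⟩

lemma Qis.comp {Z : Type*} [AddCommGroup Z] [Module R Z] {dX : X →ₗ[R] X} {dY : Y →ₗ[R] Y}
    {dZ : Z →ₗ[R] Z} {g : X →ₗ[R] Y} {k : Y →ₗ[R] Z}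
    (hk' : ∀ x, k (dY x) = dZ (k x)) (hg' : ∀ x, g (dX x) = dY (g x))
    (hg : Qis dX dY g) (hk : Qis dY dZ k) : Qis dX dZ (k ∘ₗ g) := by
  intro x z hx hz
  obtain ⟨p, q, hp, hq⟩ := hk (g x) z (by rw [← hg', hx, map_zero]) hz
  obtain ⟨p', q', hp', hq'⟩ := hg x p hx hp
  refine ⟨p', k q' + q, hp', ?_⟩
  rw [← hq, ← hq', map_add, map_add, hk', LinearMap.comp_apply, add_assoc]

/-- The homotopy for `1 - b g` serves on both sides because `b` and `g` commute. If `d y = g x`,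
then `b y + h x` is a primitive of `x`. The error `y - g (b y + h x)` is a cocycle, hence equal to
`g b` of itself up to a boundary, and adding `b` of the error removes it. -/
lemma Qis.of_homotopyInverse {dX : X →ₗ[R] X} {g : X →ₗ[R] X} (b h : X →ₗ[R] X)
    (hg : ∀ x, g (dX x) = dX (g x)) (hb : ∀ x, b (dX x) = dX (b x))
    (hgb : ∀ x, g (b x) = b (g x))
    (hh : ∀ x, x - b (g x) = dX (h x) + h (dX x)) : Qis dX dX g := by
  intro x y hx hy
  have h1 : dX (b y + h x) = x := by
    have := hh x
    rw [hx, map_zero, add_zero] at this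
    rw [map_add, ← this, ← hb, hy]
    abel
  have h2 := hh (y - g (b y + h x))
  rw [map_sub dX, ← hg, h1, hy, sub_self, map_zero, add_zero] at h2
  refine ⟨b y + h x + b (y - g (b y + h x)), h (y - g (b y + h x)), ?_, ?_⟩
  · rw [map_add, h1, ← hb, map_sub dX, ← hg, h1, hy, sub_self, map_zero, add_zero]
  · rw [← h2, map_add g, hgb (y - _)]
    abel

/-! ### Twisted differentials on families. -/

section Cell

variable {J : Type*}

lemma linearCombination_add' (z w : J → X) (v : J →₀ R) :
    Finsupp.linearCombination R (z + w) v =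
      Finsupp.linearCombination R z v + Finsupp.linearCombination R w v := by
  simp [Finsupp.linearCombination_apply, Finsupp.sum, smul_add, Finset.sum_add_distrib]

lemma linearCombination_smul' (a : R) (z : J → X) (v : J →₀ R) :
    Finsupp.linearCombination R (a • z) v = a • Finsupp.linearCombination R z v := by
  simp [Finsupp.linearCombination_apply, Finsupp.sum, Finset.smul_sum, smul_comm a]

lemma linearCombination_congr' {z w : J → X} {v : J →₀ R} (h : ∀ t, v t ≠ 0 → z t = w t) :
    Finsupp.linearCombination R z v = Finsupp.linearCombination R w v := by
  rw [Finsupp.linearCombination_apply, Finsupp.linearCombination_apply]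
  exact Finset.sum_congr rfl fun t ht => by
    show _ • _ = _ • _
    rw [h t (Finsupp.mem_support_iff.1 ht)]

lemma linearCombination_linearCombination (z : J → X) (c : J → J →₀ R) (v : J →₀ R) :
    Finsupp.linearCombination R (fun t => Finsupp.linearCombination R z (c t)) v =
      Finsupp.linearCombination R z (Finsupp.linearCombination R c v) := by
  simp only [Finsupp.linearCombination_apply R (v := c), Finsupp.sum, map_sum, map_smul]
  rfl

lemma map_linearCombination (g : X →ₗ[R] Y) (z : J → X) (v : J →₀ R) :
    Finsupp.linearCombination R (fun t => g (z t)) v = g (Finsupp.linearCombination R z v) := by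
  simp [Finsupp.linearCombination_apply, Finsupp.sum]

lemma linearCombination_sub' (z w : J → X) (v : J →₀ R) :
    Finsupp.linearCombination R (fun t => z t - w t) v =
      Finsupp.linearCombination R z v - Finsupp.linearCombination R w v := by
  simp [Finsupp.linearCombination_apply, Finsupp.sum, smul_sub]

lemma linearCombination_intUnits_smul (u : ℤˣ) (z : J → X) (v : J →₀ R) :
    Finsupp.linearCombination R (fun t => u • z t) v =
      u • Finsupp.linearCombination R z v := by
  rcases Int.units_eq_one_or u with rfl | rfl
  · simp
  · simp [Finsupp.linearCombination_apply, Finsupp.sum]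

lemma map_intUnits_smul (g : X →ₗ[R] Y) (u : ℤˣ) (x : X) : g (u • x) = u • g x := by
  rcases Int.units_eq_one_or u with rfl | rfl <;> simp

lemma intUnits_smul_smul (u : ℤˣ) (x : X) : u • u • x = x := by
  rw [smul_smul, Int.units_mul_self, one_smul]

/-- The differential on `J → X` twisted by the signs `ε` and the (row-finite) matrix `c`: it
describes maps into `X` out of a complex with a basis `e s`, `s : J`, whose differential
is given by `c`. -/
def cellD (ε : J → ℤˣ) (c : J → J →₀ R) (d : X →ₗ[R] X) : (J → X) →ₗ[R] (J → X) where
  toFun z s := ε s • (d (z s) - Finsupp.linearCombination R z (c s))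
  map_add' z w := by
    ext s
    rw [linearCombination_add', Pi.add_apply, Pi.add_apply, map_add, ← smul_add]
    congr 1
    abel
  map_smul' a z := by
    ext s
    rw [linearCombination_smul', Pi.smul_apply, map_smul, RingHom.id_apply, Pi.smul_apply,
      smul_comm a (ε s), ← smul_sub]

variable {ε : J → ℤˣ} {c : J → J →₀ R} {d : X →ₗ[R] X}

lemma cellD_apply (z : J → X) (s : J) :
    cellD ε c d z s = ε s • (d (z s) - Finsupp.linearCombination R z (c s)) := rfl

/-- The conditions on the signs and on the matrix ensuring that the twisted differential
has square zero. -/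
structure IsCell (ε : J → ℤˣ) (c : J → J →₀ R) : Prop where
  sign : ∀ s t, c s t ≠ 0 → ε t = -ε s
  sq_zero : ∀ s, Finsupp.linearCombination R c (c s) = 0

/-- Signs change along nonzero entries, so the mixed terms in `d` and `c` cancel; the others vanish
because `d` and `c` square to zero. -/
lemma cellD_cellD (hc : IsCell ε c) (hd : ∀ x, d (d x) = 0) (z : J → X) :
    cellD ε c d (cellD ε c d z) = 0 := by
  ext s
  have h1 : Finsupp.linearCombination R (cellD ε c d z) (c s) =
      (- ε s) • d (Finsupp.linearCombination R z (c s)) := by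
    rw [linearCombination_congr' (w := fun t =>
      (-ε s) • (d (z t) - Finsupp.linearCombination R z (c t)))
      (fun t ht => by rw [cellD_apply, hc.sign s t ht]), linearCombination_intUnits_smul,
      linearCombination_sub', map_linearCombination, linearCombination_linearCombination,
      hc.sq_zero, map_zero, sub_zero]
  rw [cellD_apply, h1, cellD_apply, map_intUnits_smul, map_sub, hd, Pi.zero_apply]
  rcases Int.units_eq_one_or (ε s) with h | h <;> simp [h]

lemma cellD_congr {z w : J → X} {s : J} (hs : z s = w s) (h : ∀ t, c s t ≠ 0 → z t = w t) :
    cellD ε c d z s = cellD ε c d w s := by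
  rw [cellD_apply, cellD_apply, hs, linearCombination_congr' h]

lemma cellD_eq_zero {z : J → X} {s : J} (hs : z s = 0) (h : ∀ t, c s t ≠ 0 → z t = 0) :
    cellD ε c d z s = 0 := by
  rw [cellD_congr (w := 0) hs h, map_zero, Pi.zero_apply]

open Classical in
/-- Dévissage: if the blocks of a filtration of the index set are acyclic, then one can solve
`D w = z` in the part of the filtration described by `B`. -/
lemma exists_cellD_eq (hc : IsCell ε c) (hd : ∀ x, d (d x) = 0) (ρ : J → ℕ)
    (hρ : ∀ s t, c s t ≠ 0 → ρ t ≤ ρ s) (B : ℕ → Prop) (hB : ∀ u v, u ≤ v → B v → B u)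
    (hb : ∀ v, B v → ∀ z : J → X, (∀ s, ρ s < v → z s = 0) →
      (∀ s, ρ s = v → cellD ε c d z s = 0) → ∃ w : J → X, (∀ s, ρ s ≠ v → w s = 0) ∧
        ∀ s, ρ s = v → cellD ε c d w s = z s)
    (z : J → X) (hz : ∀ s, B (ρ s) → cellD ε c d z s = 0) :
    ∃ w : J → X, ∀ s, B (ρ s) → cellD ε c d w s = z s := by
  -- The block solver is extended by `0` to all `v` and `z`, so that `choose` yields a single
  -- function `φ`.
  have key : ∀ v (z : J → X), ∃ w : J → X, (∀ s, ρ s ≠ v → w s = 0) ∧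
      (B v → (∀ s, ρ s < v → z s = 0) → (∀ s, ρ s = v → cellD ε c d z s = 0) →
        ∀ s, ρ s = v → cellD ε c d w s = z s) := by
    intro v z
    by_cases h : B v ∧ (∀ s, ρ s < v → z s = 0) ∧ (∀ s, ρ s = v → cellD ε c d z s = 0)
    · obtain ⟨w, hw, hw'⟩ := hb v h.1 z h.2.1 h.2.2
      exact ⟨w, hw, fun _ _ _ => hw'⟩
    · exact ⟨0, fun _ _ => rfl, fun h1 h2 h3 => absurd ⟨h1, h2, h3⟩ h⟩
  choose φ hφ hφ' using key
  -- Successive approximation: step `v` adds, in rank `v` only, a solution for the remaining error.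
  let W : ℕ → (J → X) := fun n => Nat.rec 0 (fun v w => w + φ v (z - cellD ε c d w)) n
  have hW : ∀ v, W (v + 1) = W v + φ v (z - cellD ε c d (W v)) := fun _ => rfl
  -- Coordinate `s` changes only at step `ρ s`, so the infinite sum of corrections makes sense
  -- coordinatewise.
  have stab : ∀ s n, W (ρ s + 1 + n) s = W (ρ s + 1) s := by
    intro s n
    induction n with
    | zero => rfl
    | succ n ih =>
      rw [← add_assoc, hW, Pi.add_apply, hφ _ _ s (by lia), add_zero, ih]
  -- A correction in rank `v` does not disturb lower ranks, because the matrix never raises the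
  -- rank.
  have main : ∀ v s, ρ s < v → B (ρ s) → cellD ε c d (W v) s = z s := by
    intro v
    induction v with
    | zero => intro s hs; lia
    | succ v ih =>
      intro s hs hBs
      rw [hW, map_add, Pi.add_apply]
      rcases Nat.lt_succ_iff_lt_or_eq.1 hs with h | h
      · rw [ih s h hBs, cellD_eq_zero (hφ _ _ s h.ne) (fun t ht =>
          hφ _ _ t (lt_of_le_of_lt (hρ s t ht) h).ne), add_zero]
      · rw [hφ' v _ (h ▸ hBs) (fun t ht => ?_) (fun t ht => ?_) s h, Pi.sub_apply]
        · abel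
        · rw [Pi.sub_apply, ih t ht (hB _ _ (h ▸ ht.le) hBs), sub_self]
        · rw [map_sub, cellD_cellD hc hd, sub_zero, hz t (by rw [ht, ← h]; exact hBs)]
  -- The limit. The differential at `s` reads only indices of rank at most `ρ s`, all of them stable
  -- after step `ρ s`.
  refine ⟨fun s => W (ρ s + 1) s, fun s hs => ?_⟩
  rw [← main (ρ s + 1) s (Nat.lt_succ_self _) hs]
  refine cellD_congr rfl fun t ht => ?_
  obtain ⟨n, hn⟩ := Nat.exists_eq_add_of_le (hρ s t ht)
  show W (ρ t + 1) t = W (ρ s + 1) t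
  rw [hn, add_right_comm, stab]

/-- Since the matrix strictly lowers the rank, each block of the filtration carries only `d` up to
sign. -/
lemma acyc_cellD (hc : IsCell ε c) (hd : ∀ x, d (d x) = 0) (ρ : J → ℕ)
    (hρ : ∀ s t, c s t ≠ 0 → ρ t < ρ s) (h : Acyc d) : Acyc (cellD ε c d) := by
  intro z hz
  refine (exists_cellD_eq hc hd ρ (fun s t h => (hρ s t h).le) (fun _ => True)
    (fun _ _ _ _ => trivial) (fun v _ z hz hz' => ?_) z (fun s _ => congrFun hz s)).imp
    fun w hw => funext fun s => hw s trivial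
  · classical
    have : ∀ s, ∃ y, ρ s = v → d y = z s := by
      intro s
      by_cases hs : ρ s = v
      · have h1 := hz' s hs
        rw [cellD_apply, linearCombination_congr' (w := 0)
          (fun t ht => hz t (hs ▸ hρ s t ht))] at h1
        obtain ⟨y, hy⟩ := h (z s) (by
          rcases Int.units_eq_one_or (ε s) with e | e <;>
            simpa [e, Finsupp.linearCombination_apply] using h1)
        exact ⟨y, fun _ => hy⟩
      · exact ⟨0, fun h => absurd h hs⟩
    choose y hy using this
    refine ⟨fun s => if ρ s = v then ε s • y s else 0, fun s hs => if_neg hs, fun s hs => ?_⟩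
    have h0 : ∀ t, c s t ≠ 0 → (if ρ t = v then ε t • y t else 0) = (0 : J → X) t :=
      fun t ht => if_neg (hs ▸ (hρ s t ht).ne)
    rw [cellD_apply, linearCombination_congr' h0, if_pos hs, map_intUnits_smul, hy s hs]
    rw [show Finsupp.linearCombination R (0 : J → X) (c s) = 0 by
      simp, sub_zero, intUnits_smul_smul]

/-- Acyclicity from a matching of the index set, such that the matched entries of the matrix act
by quasi-isomorphisms. -/
lemma acyc_of_matching (hc : IsCell ε c) (hd : ∀ x, d (d x) = 0) (ρ : J → ℕ)
    (hρ : ∀ s t, c s t ≠ 0 → ρ t ≤ ρ s) (L : J → Prop) (μ : J → J) (hμ : ∀ s, μ (μ s) = s)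
    (hL : ∀ s, L (μ s) ↔ ¬ L s) (hμρ : ∀ s, ρ (μ s) = ρ s) (hε : ∀ s, ε (μ s) = - ε s)
    (hc' : ∀ s t, c s t ≠ 0 → ρ t = ρ s → L s ∧ t = μ s)
    (hq : ∀ s, L s → Qis d d (LinearMap.lsmul R X (c s (μ s)))) : Acyc (cellD ε c d) := by
  intro z hz
  refine (exists_cellD_eq hc hd ρ hρ (fun _ => True)
    (fun _ _ _ _ => trivial) (fun v _ z hz hz' => ?_) z (fun s _ => congrFun hz s)).imp
    fun w hw => funext fun s => hw s trivial
  · classical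
    -- Within a block only the matched entry contributes, so the block splits into pairs `s`, `μ s`
    -- carrying the cone of multiplication by `c s (μ s)`.
    have hlin : ∀ (z : J → X), (∀ s, ρ s < v → z s = 0) → ∀ s, ρ s = v →
        Finsupp.linearCombination R z (c s) = if L s then c s (μ s) • z (μ s) else 0 := by
      intro z hz s hs
      rw [Finsupp.linearCombination_apply, Finsupp.sum]
      split_ifs with h
      · refine Finset.sum_eq_single (μ s) (fun t ht h' => ?_) (fun h' => ?_)
        · rw [Finsupp.mem_support_iff] at ht
          rw [hz t (lt_of_le_of_ne (hs ▸ hρ s t ht) fun e => h' (hc' s t ht (e.trans hs.symm)).2),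
            smul_zero]
        · rw [Finsupp.notMem_support_iff] at h'
          rw [h', zero_smul]
      · refine Finset.sum_eq_zero fun t ht => ?_
        rw [Finsupp.mem_support_iff] at ht
        rw [hz t (lt_of_le_of_ne (hs ▸ hρ s t ht) fun e => h (hc' s t ht (e.trans hs.symm)).1),
            smul_zero]
    have hu : ∀ (u : ℤˣ) (x : X), u • x = 0 → x = 0 := fun u x h => by
      rw [← intUnits_smul_smul u x, h, smul_zero]
    have : ∀ s, ∃ p q, ρ s = v → L s → d p = z (μ s) ∧ c s (μ s) • p + d q = z s := by
      intro s
      by_cases hs : ρ s = v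
      · by_cases h : L s
        · have h1 := hz' s hs
          have h2 := hz' (μ s) ((hμρ s).trans hs)
          rw [cellD_apply, hlin z hz s hs, if_pos h] at h1
          rw [cellD_apply, hlin z hz _ ((hμρ s).trans hs), if_neg (fun h' => (hL s).1 h' h),
            sub_zero] at h2
          obtain ⟨p, q, h3, h4⟩ := hq s h (z (μ s)) (z s) (hu _ _ h2)
            (sub_eq_zero.1 (hu _ _ h1))
          exact ⟨p, q, fun _ _ => ⟨h3, h4⟩⟩
        · exact ⟨0, 0, fun _ h' => absurd h' h⟩
      · exact ⟨0, 0, fun h => absurd h hs⟩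
    choose p q hpq using this
    -- The lower index of a pair receives `q` and its partner `p`; since `ε (μ s) = -ε s`, the signs
    -- in `cellD` turn the difference into `c s (μ s) • p + d q`.
    let w : J → X := fun s => if ρ s = v then
      if L s then ε s • q s else ε s • p (μ s) else 0
    have hw0 : ∀ s, ρ s ≠ v → w s = 0 := fun s hs => if_neg hs
    refine ⟨w, hw0, fun s hs => ?_⟩
    rw [cellD_apply, hlin w (fun s hs => hw0 s hs.ne) s hs]
    by_cases h : L s
    · have h' : ¬ L (μ s) := fun h' => (hL s).1 h' h
      have e1 : w s = ε s • q s := by simp only [w, if_pos hs, if_pos h]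
      have e2 : w (μ s) = ε (μ s) • p s := by
        simp only [w, if_pos ((hμρ s).trans hs), if_neg h', hμ]
      rw [if_pos h, e1, e2, hε, map_intUnits_smul, ← (hpq s hs h).2]
      rcases Int.units_eq_one_or (ε s) with e | e <;> (simp [e]; try abel)
    · have e1 : w s = ε s • p (μ s) := by simp only [w, if_pos hs, if_neg h]
      have h3 := (hpq (μ s) ((hμρ s).trans hs) ((hL s).2 h)).1
      rw [if_neg h, e1, sub_zero, map_intUnits_smul, h3, hμ, intUnits_smul_smul]

/-- The map induced on families by a linear map. -/
def cellMap (J : Type*) (g : X →ₗ[R] Y) : (J → X) →ₗ[R] (J → Y) :=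
  LinearMap.pi fun s => g ∘ₗ LinearMap.proj s

lemma cellMap_apply (g : X →ₗ[R] Y) (z : J → X) (s : J) : cellMap J g z s = g (z s) := rfl

lemma cellMap_cellD {dY : Y →ₗ[R] Y} {g : X →ₗ[R] Y} (hg : ∀ x, g (d x) = dY (g x)) (z : J → X) :
    cellMap J g (cellD ε c d z) = cellD ε c dY (cellMap J g z) := by
  ext s
  rw [cellMap_apply, cellD_apply, cellD_apply, map_intUnits_smul, map_sub, hg, cellMap_apply,
    ← map_linearCombination]
  rfl

/-- The differential of the mapping cone. -/
def coneD (dX : X →ₗ[R] X) (dY : Y →ₗ[R] Y) (g : X →ₗ[R] Y) : (X × Y) →ₗ[R] (X × Y) :=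
  LinearMap.prod (-(dX ∘ₗ LinearMap.fst R X Y))
    (g ∘ₗ LinearMap.fst R X Y + dY ∘ₗ LinearMap.snd R X Y)

lemma coneD_apply (dX : X →ₗ[R] X) (dY : Y →ₗ[R] Y) (g : X →ₗ[R] Y) (x : X) (y : Y) :
    coneD dX dY g (x, y) = (-dX x, g x + dY y) := rfl

lemma qis_iff_acyc_coneD (dX : X →ₗ[R] X) (dY : Y →ₗ[R] Y) (g : X →ₗ[R] Y) :
    Qis dX dY g ↔ Acyc (coneD dX dY g) := by
  constructor
  · rintro h ⟨x, y⟩ hxy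
    simp only [coneD_apply, Prod.mk_eq_zero, neg_eq_zero] at hxy
    obtain ⟨p, q, rfl, hq⟩ := h x (-y) hxy.1 (by rw [map_neg, ← add_eq_zero_iff_neg_eq, add_comm, hxy.2])
    exact ⟨(-p, -q), by
      rw [coneD_apply, map_neg, map_neg, map_neg, neg_neg, ← neg_add, hq, neg_neg]⟩
  · intro h x y hx hy
    -- The pair `(-x, y)` is a cocycle of the cone exactly when `dX x = 0` and `dY y = g x`.
    obtain ⟨⟨p, q⟩, hpq⟩ := h (-x, y) (by
      rw [coneD_apply, map_neg, map_neg, hx, hy]; simp)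
    rw [coneD_apply, Prod.mk.injEq] at hpq
    exact ⟨p, q, neg_inj.1 hpq.1, hpq.2⟩

/-- Up to signs `ε` on the first component, the cone of the induced map is the twist of the cone of
`g`, to which `acyc_cellD` applies. -/
lemma qis_cellMap (hc : IsCell ε c) (ρ : J → ℕ) (hρ : ∀ s t, c s t ≠ 0 → ρ t < ρ s)
    {dY : Y →ₗ[R] Y} {g : X →ₗ[R] Y} (hd : ∀ x, d (d x) = 0) (hd' : ∀ x, dY (dY x) = 0)
    (hg : ∀ x, g (d x) = dY (g x))
    (h : Qis d dY g) : Qis (cellD ε c d) (cellD ε c dY) (cellMap J g) := by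
  have h1 : Acyc (cellD ε c (coneD d dY g)) := acyc_cellD hc (by
    rintro ⟨x, y⟩
    simp [coneD_apply, hd, hd', hg]) ρ hρ ((qis_iff_acyc_coneD _ _ _).1 h)
  have hcomp : ∀ (w : J → X × Y) s, cellD ε c (coneD d dY g) w s =
      (ε s • (-d (w s).1 - Finsupp.linearCombination R (fun t => (w t).1) (c s)),
        ε s • (g (w s).1 + dY (w s).2 - Finsupp.linearCombination R (fun t => (w t).2) (c s))) := by
    intro w s
    rw [cellD_apply]
    have e1 := map_linearCombination (LinearMap.fst R X Y) w (c s)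
    have e2 := map_linearCombination (LinearMap.snd R X Y) w (c s)
    refine Prod.ext ?_ ?_
    · exact congrArg (fun u => ε s • (-d (w s).1 - u)) e1.symm
    · exact congrArg (fun u => ε s • (g (w s).1 + dY (w s).2 - u)) e2.symm
  intro x y hx hy
  have hsgn : ∀ (f : J → X) s, Finsupp.linearCombination R (fun t => ε t • f t) (c s) =
      -(ε s • Finsupp.linearCombination R f (c s)) := by
    intro f s
    rw [linearCombination_congr' (w := fun t => (-ε s) • f t)
      (fun t ht => by rw [hc.sign s t ht]), linearCombination_intUnits_smul, Units.neg_smul]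
  -- The factor `ε s` reconciles the `-d` in the first component of `coneD` with the signs of
  -- `cellD`.
  obtain ⟨w, hw⟩ := h1 (fun s => (-(ε s • x s), y s)) (by
    ext s : 1
    have hx' := congrFun hx s
    have hy' := congrFun hy s
    rw [cellD_apply] at hx' hy'
    rw [cellMap_apply] at hy'
    rw [hcomp]
    have e : Finsupp.linearCombination R (fun t => -(ε t • x t)) (c s) =
        ε s • Finsupp.linearCombination R x (c s) := by
      refine (map_linearCombination (-LinearMap.id : X →ₗ[R] X) (fun t => ε t • x t) (c s)).trans ?_
      rw [hsgn]
      simp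
    refine Prod.ext ?_ ?_
    · show ε s • (-d (-(ε s • x s)) - Finsupp.linearCombination R (fun t => -(ε t • x t)) (c s)) = 0
      rw [e, map_neg, neg_neg, map_intUnits_smul, ← smul_sub]
      rw [hx', Pi.zero_apply, smul_zero]
    · show ε s • (g (-(ε s • x s)) + dY (y s) - Finsupp.linearCombination R (fun t => y t) (c s)) = 0
      rw [add_sub_assoc, smul_add, hy', map_neg, map_intUnits_smul, smul_neg, intUnits_smul_smul,
        neg_add_cancel])
  refine ⟨fun s => ε s • (w s).1, fun s => (w s).2, funext fun s => ?_, funext fun s => ?_⟩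
  · have := congrArg Prod.fst ((hcomp w s).symm.trans (congrFun hw s))
    replace this : ε s • (-d (w s).1 - Finsupp.linearCombination R (fun t => (w t).1) (c s)) =
      -(ε s • x s) := this
    rw [cellD_apply, hsgn, map_intUnits_smul, ← neg_inj, ← intUnits_smul_smul (ε s) (-x s),
      smul_neg, ← this, ← smul_neg]
    congr 1
    rw [smul_sub, smul_neg]
    abel
  · have := congrArg Prod.snd ((hcomp w s).symm.trans (congrFun hw s))
    replace this : ε s • (g (w s).1 + dY (w s).2 - Finsupp.linearCombination R (fun t => (w t).2) (c s))
      = y s := this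
    rw [Pi.add_apply, cellMap_apply, cellD_apply, ← this, map_intUnits_smul, ← smul_add]
    congr 1
    abel

/-! ### Exchanging two twistings. -/

section Swap

variable {J' : Type*} {ε' : J' → ℤˣ} {c' : J' → J' →₀ R}

/-- The Koszul sign. -/
def koszul (u v : ℤˣ) : ℤˣ := if u = -1 ∧ v = -1 then -1 else 1

lemma koszul_comm (u v : ℤˣ) : koszul u v = koszul v u := by
  simp only [koszul, and_comm]

lemma koszul_neg_left (u v : ℤˣ) : koszul (-u) v = v * koszul u v := by
  revert u v; decide

lemma koszul_one_left (v : ℤˣ) : koszul 1 v = 1 := by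
  revert v; decide

variable (X) in
/-- Exchanging the two indices of a family. -/
def cellSwap (R : Type*) [CommRing R] [Module R X] (ε : J → ℤˣ) (ε' : J' → ℤˣ) :
    (J → J' → X) →ₗ[R] (J' → J → X) where
  toFun z s' s := koszul (ε s) (ε' s') • z s s'
  map_add' z w := by ext; simp
  map_smul' a z := by ext; simp [smul_comm a]

lemma cellSwap_apply (z : J → J' → X) (s' : J') (s : J) :
    cellSwap X R ε ε' z s' s = koszul (ε s) (ε' s') • z s s' := rfl

lemma cellSwap_cellSwap (z : J → J' → X) :
    cellSwap X R ε' ε (cellSwap X R ε ε' z) = z := by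
  ext s s'
  rw [cellSwap_apply, cellSwap_apply, koszul_comm, intUnits_smul_smul]

lemma cellSwap_bijective : Function.Bijective (cellSwap X R ε ε') :=
  ⟨Function.LeftInverse.injective cellSwap_cellSwap,
    Function.RightInverse.surjective cellSwap_cellSwap⟩

lemma linearCombination_pi (z : J → J' → X) (v : J →₀ R) (s' : J') :
    Finsupp.linearCombination R z v s' = Finsupp.linearCombination R (fun t => z t s') v :=
  (map_linearCombination (LinearMap.proj s' : (J' → X) →ₗ[R] X) z v).symm

/-- Moving along an entry of `c'` multiplies the Koszul sign by `ε s`, and moving along an entry of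
`c` multiplies it by `ε' s'`; by these factors the two iterated differentials differ. -/
lemma cellSwap_cellD (hc : IsCell ε c) (hc' : IsCell ε' c') (z : J → J' → X) :
    cellSwap X R ε ε' (cellD ε c (cellD ε' c' d) z) =
      cellD ε' c' (cellD ε c d) (cellSwap X R ε ε' z) := by
  ext s' s
  rw [cellSwap_apply, cellD_apply, cellD_apply, Pi.smul_apply, Pi.smul_apply, Pi.sub_apply,
    Pi.sub_apply, cellD_apply, cellD_apply, linearCombination_pi, linearCombination_pi]
  have e1 : Finsupp.linearCombination R (fun t => cellSwap X R ε ε' z t s) (c' s') =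
      (ε s * koszul (ε s) (ε' s')) • Finsupp.linearCombination R (z s) (c' s') := by
    rw [← linearCombination_intUnits_smul]
    refine linearCombination_congr' fun t ht => ?_
    rw [cellSwap_apply, hc'.sign s' t ht, koszul_comm, koszul_neg_left, koszul_comm]
  have e2 : Finsupp.linearCombination R (cellSwap X R ε ε' z s') (c s) =
      (ε' s' * koszul (ε s) (ε' s')) • Finsupp.linearCombination R (fun t => z t s') (c s) := by
    rw [← linearCombination_intUnits_smul]
    refine linearCombination_congr' fun t ht => ?_
    rw [cellSwap_apply, hc.sign s t ht, koszul_neg_left]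
  rw [e1, e2, cellSwap_apply, map_intUnits_smul]
  generalize koszul (ε s) (ε' s') = θ
  rcases Int.units_eq_one_or (ε s) with h | h <;> rcases Int.units_eq_one_or (ε' s') with h' | h' <;>
    rcases Int.units_eq_one_or θ with h'' | h'' <;> simp [h, h', h''] <;> abel

lemma acyc_of_bijective {dX : X →ₗ[R] X} {dY : Y →ₗ[R] Y} {g : X →ₗ[R] Y}
    (h : ∀ x, g (dX x) = dY (g x)) (hg : Function.Bijective g) : Acyc dX ↔ Acyc dY := by
  constructor
  · intro hX y hy
    obtain ⟨x, rfl⟩ := hg.2 y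
    obtain ⟨w, rfl⟩ := hX x (hg.1 (by rw [h, hy, map_zero]))
    exact ⟨g w, (h w).symm⟩
  · intro hY x hx
    obtain ⟨w, hw⟩ := hY (g x) (by rw [← h, hx, map_zero])
    obtain ⟨w, rfl⟩ := hg.2 w
    exact ⟨w, hg.1 (by rw [h, hw])⟩

/-- For based complexes `P` and `Q` this reflects `Hom(P, Hom(Q, X)) ≅ Hom(Q, Hom(P, X))`. -/
lemma acyc_cellD_swap (hc : IsCell ε c) (hc' : IsCell ε' c') :
    Acyc (cellD ε c (cellD ε' c' d)) ↔ Acyc (cellD ε' c' (cellD ε c d)) :=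
  acyc_of_bijective (cellSwap_cellD hc hc') cellSwap_bijective

end Swap

end Cell

end DiffMod

namespace DiffMod

variable {R X Y : Type*} [CommRing R] [AddCommGroup X] [Module R X] [AddCommGroup Y] [Module R Y]

/-! ### Maps out of the telescope. -/

section Loc

/-- The signs for the basis of the telescope: `inr k` is in degree `0`, and `inl k` in
degree `-1`. -/
def locSign : ℕ ⊕ ℕ → ℤˣ := Sum.elim (fun _ => -1) (fun _ => 1)

/-- The matrix of the differential of the telescope. -/
def locMat (a : R) : ℕ ⊕ ℕ → (ℕ ⊕ ℕ) →₀ R :=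
  Sum.elim (fun k => Finsupp.single (.inr k) 1 - Finsupp.single (.inr (k + 1)) a) (fun _ => 0)

lemma isCell_loc (a : R) : IsCell locSign (locMat a) where
  sign := by
    rintro (k | k) (l | l) h
    · simp [locMat] at h
    · simp [locSign]
    · simp [locMat] at h
    · simp [locMat] at h
  sq_zero := by
    rintro (k | k)
    · simp [locMat]
    · simp [locMat]

/-- The differential of the complex of maps from the telescope of `a` to `X`. -/
def locD (a : R) (d : X →ₗ[R] X) : (ℕ ⊕ ℕ → X) →ₗ[R] (ℕ ⊕ ℕ → X) := cellD locSign (locMat a) d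

variable {d : X →ₗ[R] X} {a : R}

lemma locD_inr (z : ℕ ⊕ ℕ → X) (k : ℕ) : locD a d z (.inr k) = d (z (.inr k)) := by
  simp [locD, cellD_apply, locSign, locMat]

lemma locD_inl (z : ℕ ⊕ ℕ → X) (k : ℕ) :
    locD a d z (.inl k) = z (.inr k) - a • z (.inr (k + 1)) - d (z (.inl k)) := by
  simp [locD, cellD_apply, locSign, locMat]

lemma locD_locD (hd : ∀ x, d (d x) = 0) (z : ℕ ⊕ ℕ → X) : locD a d (locD a d z) = 0 :=
  cellD_cellD (isCell_loc a) hd z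

lemma loc_rank (s t : ℕ ⊕ ℕ) (h : locMat a s t ≠ 0) :
    Sum.elim (fun _ => 1) (fun _ => 0) t < (Sum.elim (fun _ => 1) (fun _ => 0) s : ℕ) := by
  rcases s with k | k <;> rcases t with l | l <;> simp [locMat] at h ⊢

/-- Multiplication by `a` is a homotopy equivalence on the maps from the telescope of `a`. -/
lemma qis_smul_locD (a : R) :
    Qis (locD a d) (locD a d) (LinearMap.lsmul R (ℕ ⊕ ℕ → X) a) := by
  -- The inverse `b` advances the position in the telescope by one; the homotopy `h` reads the `inl`
  -- entries at the places `inr`.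
  refine Qis.of_homotopyInverse
    (b := { toFun := fun z => Sum.elim (fun k => z (.inl (k + 1))) (fun k => z (.inr (k + 1)))
            map_add' := fun z w => by ext (k | k) <;> simp
            map_smul' := fun b z => by ext (k | k) <;> simp })
    (h := { toFun := fun z => Sum.elim 0 (fun k => z (.inl k))
            map_add' := fun z w => by ext (k | k) <;> simp
            map_smul' := fun b z => by ext (k | k) <;> simp })
    (fun z => by simp) (fun z => ?_) (fun z => ?_) (fun z => ?_)
  · ext (k | k) <;> simp [locD_inl, locD_inr]
  · ext (k | k) <;> simp
  · ext (k | k) <;> simp [locD_inl, locD_inr]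

/-- The cohomology of a differential module. -/
abbrev Coh (d : X →ₗ[R] X) (hd : ∀ x, d (d x) = 0) : Type _ :=
  LinearMap.ker d ⧸ LinearMap.range (d.codRestrict (LinearMap.ker d) hd)

/-! ### Completeness in terms of cohomology. -/

section Coh

variable (hd : ∀ x, d (d x) = 0)

/-- The class of a cocycle. -/
def Coh.mk (x : X) (hx : d x = 0) : Coh d hd := Submodule.Quotient.mk ⟨x, hx⟩

lemma Coh.mk_surjective (h : Coh d hd) : ∃ x hx, Coh.mk hd x hx = h := by
  obtain ⟨⟨x, hx⟩, rfl⟩ := Submodule.Quotient.mk_surjective _ h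
  exact ⟨x, hx, rfl⟩

lemma Coh.mk_eq_zero_iff (x : X) (hx : d x = 0) : Coh.mk hd x hx = 0 ↔ ∃ y, d y = x := by
  rw [Coh.mk, Submodule.Quotient.mk_eq_zero]
  simp only [LinearMap.mem_range, Subtype.ext_iff]
  exact Iff.rfl

lemma Coh.mk_sub_smul (x y : X) (hx : d x = 0) (hy : d y = 0) :
    Coh.mk hd x hx - a • Coh.mk hd y hy =
      Coh.mk hd (x - a • y) (by rw [map_sub, map_smul, hx, hy, smul_zero, sub_zero]) := rfl

lemma Coh.mk_eq_iff (x y : X) (hx : d x = 0) (hy : d y = 0) :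
    Coh.mk hd x hx = Coh.mk hd y hy ↔ ∃ w, d w = x - y := by
  rw [← sub_eq_zero, ← Coh.mk_eq_zero_iff hd (x - y) (by rw [map_sub, hx, hy, sub_zero])]
  rfl

/-- The endomorphism `id - a * shift` of sequences. -/
def shiftMap (a : R) (X : Type*) [AddCommGroup X] [Module R X] : (ℕ → X) →ₗ[R] (ℕ → X) where
  toFun y k := y k - a • y (k + 1)
  map_add' y z := by ext; simp; abel
  map_smul' b y := by ext; simp [smul_sub, smul_comm a]

lemma shiftMap_apply (y : ℕ → X) (k : ℕ) : shiftMap a X y k = y k - a • y (k + 1) := rfl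

/-- Completeness in terms of the cohomology. -/
lemma acyc_locD_iff : Acyc (locD a d) ↔ Function.Bijective (shiftMap a (Coh d hd)) := by
  constructor
  · refine fun h => ⟨(injective_iff_map_eq_zero _).2 fun y hy => ?_, fun x => ?_⟩
    · choose y' hy' e using fun k => Coh.mk_surjective hd (y k)
      have : ∀ k, ∃ w, d w = y' k - a • y' (k + 1) := fun k => by
        rw [← Coh.mk_eq_zero_iff hd _ (by rw [map_sub, map_smul, hy', hy', smul_zero, sub_zero]),
          ← Coh.mk_sub_smul hd _ _ (hy' k) (hy' (k + 1)), e, e]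
        exact congrFun hy k
      choose w hw using this
      -- The primitives `w` complete the representatives `y'` to a cocycle, and a primitive of it
      -- kills every class `y k`.
      obtain ⟨p, hp⟩ := h (Sum.elim w y') (by
        ext (k | k)
        · simp [locD_inl, hw]
        · simp [locD_inr, hy'])
      ext k
      rw [← e, Pi.zero_apply, Coh.mk_eq_zero_iff]
      exact ⟨p (.inr k), by rw [← locD_inr (a := a), hp]; rfl⟩
    · choose x' hx' e using fun k => Coh.mk_surjective hd (x k)
      -- A primitive of this cocycle has cocycles in its `inr` entries; they solve the equation up
      -- to the boundaries of its `inl` entries.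
      obtain ⟨p, hp⟩ := h (Sum.elim x' 0) (by
        ext (k | k)
        · simp [locD_inl, hx']
        · simp [locD_inr])
      have h1 : ∀ k, d (p (.inr k)) = 0 := fun k => by rw [← locD_inr (a := a), hp]; rfl
      refine ⟨fun k => Coh.mk hd (p (.inr k)) (h1 k), ?_⟩
      ext k
      rw [shiftMap_apply, Coh.mk_sub_smul, ← e, Coh.mk_eq_iff]
      refine ⟨p (.inl k), ?_⟩
      have := congrFun hp (.inl k)
      rw [locD_inl, Sum.elim_inl] at this
      rw [← this]
      abel
  · intro h z hz
    have h1 : ∀ k, d (z (.inr k)) = 0 := fun k => by rw [← locD_inr (a := a), hz]; rfl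
    have h2 : ∀ k, d (z (.inl k)) = z (.inr k) - a • z (.inr (k + 1)) := fun k => by
      have := congrFun hz (.inl k)
      rw [locD_inl, Pi.zero_apply, sub_eq_zero] at this
      exact this.symm
    have h3 : (fun k => Coh.mk hd _ (h1 k)) = 0 := h.1 (by
      rw [map_zero]
      ext k
      rw [shiftMap_apply, Coh.mk_sub_smul, Pi.zero_apply, Coh.mk_eq_zero_iff]
      exact ⟨_, h2 k⟩)
    have h4 : ∀ k, ∃ p, d p = z (.inr k) := fun k =>
      (Coh.mk_eq_zero_iff hd _ (h1 k)).1 (congrFun h3 k)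
    choose p hp using h4
    -- The primitives `p k` are determined only up to cocycles. The defect in the `inl` equation is
    -- a cocycle; surjectivity provides cocycles `y' k` absorbing its class, and `q k` is a
    -- primitive of what remains.
    have h5 : ∀ k, d (p k - a • p (k + 1) - z (.inl k)) = 0 := fun k => by
      rw [map_sub, map_sub, map_smul, hp, hp, h2, sub_self]
    obtain ⟨y, hy⟩ := h.2 (fun k => Coh.mk hd _ (h5 k))
    choose y' hy' e using fun k => Coh.mk_surjective hd (y k)
    have h6 : ∀ k, ∃ q, d q = p k - a • p (k + 1) - z (.inl k) - (y' k - a • y' (k + 1)) := by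
      intro k
      rw [← Coh.mk_eq_iff hd _ _ (h5 k)
        (by rw [map_sub, map_smul, hy', hy', smul_zero, sub_zero]),
        ← Coh.mk_sub_smul hd _ _ (hy' k) (hy' (k + 1)), e, e]
      exact (congrFun hy k).symm
    choose q hq using h6
    refine ⟨Sum.elim q (fun k => p k - y' k), ?_⟩
    ext (k | k)
    · rw [locD_inl, Sum.elim_inl, Sum.elim_inr, Sum.elim_inr, hq, smul_sub]
      abel
    · rw [locD_inr, Sum.elim_inr, map_sub, hp, hy', sub_zero]

end Coh

/-! ### An ideal of Jacobson radical type. -/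

section Jacobson

/-- The elements `a` such that `1 - a * ψ` is invertible for every endomorphism `ψ`. -/
def jacobsonOf (R H : Type*) [CommRing R] [AddCommGroup H] [Module R H] : Ideal R where
  carrier := {a | ∀ ψ : Module.End R H, IsUnit (1 - a • ψ)}
  zero_mem' ψ := by simp
  -- With `v = 1 - a ψ` one has `1 - (a + b) ψ = v (1 - b v⁻¹ ψ)`.
  add_mem' {a b} ha hb ψ := by
    obtain ⟨v, hv⟩ := ha ψ
    have h2 := v.isUnit.mul (hb (↑v⁻¹ * ψ))
    rwa [mul_sub, mul_one, mul_smul_comm, Units.mul_inv_cancel_left, hv, sub_sub, ← add_smul]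
      at h2
  smul_mem' b a ha ψ := by
    have := ha (b • ψ)
    rwa [smul_smul, mul_comm] at this

variable {H : Type*} [AddCommGroup H] [Module R H]

/-- If `y = a ψ y`, the sequence `ψ ^ k y` is killed by `id - a * shift`, hence is zero. Conversely,
solve `y k - a y (k + 1) = ψ ^ k x`; uniqueness forces `ψ (y k) = y (k + 1)`, so `y 0` is a preimage
of `x` under `1 - a ψ`. -/
lemma mem_jacobsonOf (h : Function.Bijective (shiftMap a H)) : a ∈ jacobsonOf R H := by
  intro ψ
  rw [Module.End.isUnit_iff]
  refine ⟨(injective_iff_map_eq_zero _).2 fun y hy => ?_, fun x => ?_⟩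
  · have h1 : (fun k => (ψ ^ k) y) = 0 := h.1 (by
      ext k
      have := congrArg (ψ ^ k) hy
      rw [map_zero] at this
      rw [shiftMap_apply, map_zero, Pi.zero_apply, ← this, pow_succ]
      simp)
    simpa using congrFun h1 0
  · obtain ⟨y, hy⟩ := h.2 fun k => (ψ ^ k) x
    have h1 : (fun k => ψ (y k)) = fun k => y (k + 1) := h.1 (by
      ext k
      have e1 := congrArg ψ (congrFun hy k)
      have e2 := congrFun hy (k + 1)
      rw [shiftMap_apply] at e1 e2 ⊢
      rw [shiftMap_apply, e2, pow_succ', Module.End.mul_apply, ← e1, map_sub, map_smul])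
    refine ⟨y 0, ?_⟩
    have e := congrFun hy 0
    rw [shiftMap_apply, ← congrFun h1 0] at e
    simpa using e

/-- On `ℕ → H` the shift is itself an endomorphism, so membership in the ideal gives bijectivity
back; in the other direction bijectivity passes from `H` to `ℕ → H` coordinatewise. Completeness
thereby becomes membership in an ideal. -/
lemma bijective_shiftMap_iff :
    Function.Bijective (shiftMap a H) ↔ a ∈ jacobsonOf R (ℕ → H) := by
  constructor
  · intro h
    refine mem_jacobsonOf ⟨(injective_iff_map_eq_zero _).2 fun y hy => ?_, fun x => ?_⟩
    · ext k l
      have : (fun k => y k l) = 0 := h.1 (by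
        rw [map_zero]
        ext k
        exact congrFun (congrFun hy k) l)
      exact congrFun this k
    · choose y hy using fun l => h.2 fun k => x k l
      exact ⟨fun k l => y l k, by
        ext k l
        exact congrFun (hy l) k⟩
  · intro h
    have := h { toFun := fun y k => y (k + 1), map_add' := fun _ _ => rfl,
                map_smul' := fun _ _ => rfl }
    rw [Module.End.isUnit_iff] at this
    exact this

end Jacobson

/-- The condition is membership in an ideal depending only on the cohomology, so it may be tested on
generators. -/
lemma acyc_locD_of_mem_span (hd : ∀ x, d (d x) = 0) {s : Set R} (h : ∀ b ∈ s, Acyc (locD b d))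
    (ha : a ∈ Ideal.span s) : Acyc (locD a d) := by
  rw [acyc_locD_iff hd, bijective_shiftMap_iff]
  revert ha a
  change Ideal.span s ≤ _
  rw [Ideal.span_le]
  intro b hb
  exact bijective_shiftMap_iff.1 ((acyc_locD_iff hd).1 (h b hb))

lemma Qis.acyc_iff {dY : Y →ₗ[R] Y} {g : X →ₗ[R] Y}
    (hg : ∀ x, g (d x) = dY (g x)) (h : Qis d dY g) : Acyc d ↔ Acyc dY := by
  constructor
  · intro hX y hy
    obtain ⟨p, q, hp, hq⟩ := h 0 y (map_zero _) (by rw [hy, map_zero])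
    obtain ⟨r, rfl⟩ := hX p hp
    exact ⟨g r + q, by rw [map_add, ← hg, hq]⟩
  · intro hY x hx
    obtain ⟨y, hy⟩ := hY (g x) (by rw [← hg, hx, map_zero])
    obtain ⟨p, -, hp, -⟩ := h x y hx hy
    exact ⟨p, hp⟩

/-- Maps out of a telescope preserve quasi-isomorphisms, so completeness is invariant under them. -/
lemma acyc_locD_of_qis {dY : Y →ₗ[R] Y} {g : X →ₗ[R] Y} (hd : ∀ x, d (d x) = 0)
    (hd' : ∀ x, dY (dY x) = 0) (hg : ∀ x, g (d x) = dY (g x)) (h : Qis d dY g) :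
    Acyc (locD a d) ↔ Acyc (locD a dY) :=
  Qis.acyc_iff (cellMap_cellD hg)
    (qis_cellMap (isCell_loc a) _ loc_rank hd hd' hg h)

end Loc

end DiffMod

namespace DiffMod

variable {R X Y : Type*} [CommRing R] [AddCommGroup X] [Module R X] [AddCommGroup Y] [Module R Y]

/-! ### Maps out of the Čech complex. -/

section Cech

variable {r : ℕ}

variable (r) in
/-- The index set for the basis of the Čech complex: for `S ≠ ∅` the basis of a telescope, and
for `S = ∅` a single element. -/
abbrev CechIdx : Type := {s : Finset (Fin r) × (ℕ ⊕ ℕ) // s.1 = ∅ → s.2 = .inr 0}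

namespace CechIdx

/-- The index of a basis element of the telescope attached to a nonempty set `S`. -/
def ofNonempty (S : Finset (Fin r)) (hS : S ≠ ∅) (t : ℕ ⊕ ℕ) : CechIdx r :=
  ⟨(S, t), fun h => absurd h hS⟩

/-- The index of the basis element attached to the empty set. -/
def empty : CechIdx r := ⟨(∅, .inr 0), fun _ => rfl⟩

/-- Adding an element to the set. -/
def ins (s : CechIdx r) (i : Fin r) : CechIdx r :=
  ofNonempty (insert i s.1.1) (Finset.insert_ne_empty _ _) s.1.2

lemma ins_ins (s : CechIdx r) (i j : Fin r) : (s.ins i).ins j = (s.ins j).ins i :=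
  Subtype.ext (Prod.ext (Finset.insert_comm j i s.1.1) rfl)

/-- The position in the telescope. -/
def pos (s : CechIdx r) : ℕ := Sum.elim id id s.1.2

lemma eq_empty_or (s : CechIdx r) : s = empty ∨ ∃ S hS t, s = ofNonempty S hS t := by
  obtain ⟨⟨S, t⟩, h⟩ := s
  by_cases hS : S = ∅
  · left
    have := h hS
    dsimp only at this
    subst hS this
    rfl
  · exact Or.inr ⟨S, hS, t, rfl⟩

end CechIdx

/-- The signs for the basis of the Čech complex. -/
def cechSign (s : CechIdx r) : ℤˣ := (-1) ^ s.1.1.card * locSign s.1.2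

variable (f : Fin r → R)

/-- The part of the differential of the Čech complex coming from the telescopes. -/
def cechLocMat : CechIdx r → CechIdx r →₀ R
  | ⟨(S, .inl k), h⟩ =>
    have hS : S ≠ ∅ := fun e => nomatch h e
    ((-1) ^ S.card : R) • (Finsupp.single (.ofNonempty S hS (.inr k)) 1 -
      Finsupp.single (.ofNonempty S hS (.inr (k + 1))) (∏ i ∈ S, f i))
  | ⟨(_, .inr _), _⟩ => 0

/-- The part of the differential of the Čech complex coming from the transition maps. -/
def cechUpMat (s : CechIdx r) : CechIdx r →₀ R :=
  ∑ i ∈ s.1.1ᶜ, Finsupp.single (s.ins i) ((cubeSign (insert i s.1.1) i : R) * f i ^ s.pos)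

/-- The matrix of the differential of the Čech complex. -/
def cechMat (s : CechIdx r) : CechIdx r →₀ R := cechLocMat f s + cechUpMat f s

lemma cechLocMat_inl (S : Finset (Fin r)) (hS : S ≠ ∅) (k : ℕ) :
    cechLocMat f (.ofNonempty S hS (.inl k)) =
      ((-1) ^ S.card : R) • (Finsupp.single (.ofNonempty S hS (.inr k)) 1 -
      Finsupp.single (.ofNonempty S hS (.inr (k + 1))) (∏ i ∈ S, f i)) := rfl

lemma cechLocMat_inr (s : CechIdx r) (k : ℕ) (h : s.1.2 = .inr k) : cechLocMat f s = 0 := by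
  obtain ⟨⟨S, t⟩, h'⟩ := s
  dsimp only at h
  subst h
  rfl

/-- The sign and rank conditions only involve the support of the matrix: an entry stays in one
telescope or enlarges the set by one element. -/
lemma cechMat_ne_zero {s t : CechIdx r} (h : cechMat f s t ≠ 0) :
    (∃ S hS k, s = .ofNonempty S hS (.inl k) ∧ (t = .ofNonempty S hS (.inr k) ∨
      t = .ofNonempty S hS (.inr (k + 1)))) ∨ ∃ i, i ∉ s.1.1 ∧ t = s.ins i := by
  by_cases h1 : cechLocMat f s t = 0
  · rw [cechMat, Finsupp.add_apply, h1, zero_add, cechUpMat, Finsupp.finsetSum_apply] at h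
    obtain ⟨i, hi, h⟩ := Finset.exists_ne_zero_of_sum_ne_zero h
    exact Or.inr ⟨i, Finset.mem_compl.1 hi, (Finsupp.single_apply_ne_zero.1 h).1⟩
  · left
    obtain ⟨⟨S, k | k⟩, h'⟩ := s
    · have hS : S ≠ ∅ := fun e => nomatch h' e
      refine ⟨S, hS, k, rfl, ?_⟩
      by_contra! h2
      refine h1 ((congrArg (fun z => z t) (cechLocMat_inl f S hS k)).trans ?_)
      rw [Finsupp.smul_apply, Finsupp.sub_apply, Finsupp.single_eq_of_ne h2.1,
        Finsupp.single_eq_of_ne h2.2, sub_zero, smul_zero]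
    · exact absurd rfl h1

lemma linearCombination_cechUpMat {V : Type*} [AddCommGroup V] [Module R V] (z : CechIdx r → V)
    (s : CechIdx r) : Finsupp.linearCombination R z (cechUpMat f s) =
      ∑ i ∈ s.1.1ᶜ, ((cubeSign (insert i s.1.1) i : R) * f i ^ s.pos) • z (s.ins i) := by
  rw [cechUpMat, map_sum]
  exact Finset.sum_congr rfl fun i _ => Finsupp.linearCombination_single _ _ _

/-- Inserting `i` then `j` cancels against inserting `j` then `i`, by `cubeSign_swap`. -/
lemma cechUpMat_cechUpMat (s : CechIdx r) :
    Finsupp.linearCombination R (cechUpMat f) (cechUpMat f s) = 0 := by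
  rw [linearCombination_cechUpMat]
  simp only [cechUpMat, Finset.smul_sum]
  rw [Finset.sum_sigma']
  refine Finset.sum_involution (fun x _ => ⟨x.2, x.1⟩) ?_ ?_ ?_ ?_
  · rintro ⟨i, j⟩ hx
    simp only [Finset.mem_sigma, Finset.mem_compl] at hx
    obtain ⟨hi, hj⟩ := hx
    replace hj : j ∉ insert i s.1.1 := hj
    rw [Finset.mem_insert, not_or] at hj
    rw [CechIdx.ins_ins s i j, Finsupp.smul_single, Finsupp.smul_single, ← Finsupp.single_add]
    refine Finsupp.single_eq_zero.2 ?_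
    have hs : ∀ a b : Fin r, a ∉ s.1.1 → b ∉ s.1.1 → a < b →
        cubeSign (insert a s.1.1) a * cubeSign (insert b (insert a s.1.1)) b =
          -(cubeSign (insert b s.1.1) b * cubeSign (insert a (insert b s.1.1)) a) := by
      intro a b ha hb hab
      have := cubeSign_swap (insert a (insert b s.1.1)) (Finset.mem_insert_self _ _) hab
      rw [Finset.erase_insert (by simp [ha, hab.ne]), Finset.insert_comm a b,
        Finset.erase_insert (by simp [hb, hab.ne'])] at this
      rw [mul_comm, Finset.insert_comm a b, mul_comm (cubeSign (insert b s.1.1) b), this, neg_neg]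
    have hs' : (cubeSign (insert i s.1.1) i : R) * cubeSign (insert j (insert i s.1.1)) j =
          -(cubeSign (insert j s.1.1) j * cubeSign (insert i (insert j s.1.1)) i) := by
      rcases lt_or_gt_of_ne hj.1 with h | h
      · have := hs j i hj.2 hi h
        rw [eq_comm, neg_eq_iff_eq_neg] at this
        exact_mod_cast congrArg (fun n : ℤ => (n : R)) this
      · exact_mod_cast congrArg (fun n : ℤ => (n : R)) (hs i j hi hj.2 h)
    change (cubeSign (insert i s.1.1) i : R) * f i ^ s.pos *
      (cubeSign (insert j (insert i s.1.1)) j * f j ^ s.pos) +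
      (cubeSign (insert j s.1.1) j : R) * f j ^ s.pos *
      (cubeSign (insert i (insert j s.1.1)) i * f i ^ s.pos) = 0
    linear_combination (f i ^ s.pos * f j ^ s.pos) * hs'
  · rintro ⟨i, j⟩ hx _ h
    simp only [Finset.mem_sigma, Finset.mem_compl] at hx
    simp only [Sigma.mk.injEq] at h
    exact hx.2 (by rw [h.1]; exact Finset.mem_insert_self _ _)
  · rintro ⟨i, j⟩ hx
    simp only [Finset.mem_sigma, Finset.mem_compl] at hx ⊢
    obtain ⟨hi, hj⟩ := hx
    replace hj : j ∉ insert i s.1.1 := hj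
    rw [Finset.mem_insert, not_or] at hj
    refine ⟨hj.2, fun h => ?_⟩
    replace h : i ∈ insert j s.1.1 := h
    rw [Finset.mem_insert] at h
    exact h.elim (fun h => hj.1 h.symm) hi
  · rintro ⟨i, j⟩ _
    rfl

lemma linearCombination_add_fun {V : Type*} [AddCommGroup V] [Module R V] {J : Type*}
    (z w : J → V) (v : J →₀ R) : Finsupp.linearCombination R (fun t => z t + w t) v =
      Finsupp.linearCombination R z v + Finsupp.linearCombination R w v :=
  linearCombination_add' z w v

/-- The telescope part squares to zero because `inr` rows vanish, the transition part by the
previous cancellation. The mixed terms cancel because `|S|` grows by one and `f_S * f i ^ (k + 1) =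
f i ^ k * f_{S ∪ {i}}`. -/
lemma isCell_cech : IsCell (cechSign (r := r)) (cechMat f) where
  sign s t h := by
    rcases cechMat_ne_zero f h with ⟨S, hS, k, rfl, rfl | rfl⟩ | ⟨i, hi, rfl⟩
    · simp [cechSign, CechIdx.ofNonempty, locSign]
    · simp [cechSign, CechIdx.ofNonempty, locSign]
    · simp [cechSign, CechIdx.ofNonempty, CechIdx.ins, Finset.card_insert_of_notMem hi, pow_succ]
  sq_zero s := by
    have e : cechMat f = fun s => cechLocMat f s + cechUpMat f s := rfl
    rw [e, linearCombination_add_fun, map_add, map_add, cechUpMat_cechUpMat, add_zero]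
    obtain ⟨⟨S, k | k⟩, h'⟩ := s
    · have hS : S ≠ ∅ := fun e => nomatch h' e
      change Finsupp.linearCombination R (cechLocMat f) (cechLocMat f (.ofNonempty S hS (.inl k))) +
        Finsupp.linearCombination R (cechLocMat f) (cechUpMat f (.ofNonempty S hS (.inl k))) +
        Finsupp.linearCombination R (cechUpMat f) (cechLocMat f (.ofNonempty S hS (.inl k))) = 0
      rw [linearCombination_cechUpMat, cechLocMat_inl, map_smul, map_smul, map_sub, map_sub]
      simp only [Finsupp.linearCombination_single, cechLocMat_inr f (.ofNonempty S hS _) _ rfl,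
        smul_zero, sub_zero, zero_add, one_smul]
      have e2 : ∀ t, cechUpMat f (.ofNonempty S hS t) = ∑ i ∈ Sᶜ,
          Finsupp.single (CechIdx.ins (.ofNonempty S hS t) i) ((cubeSign (insert i S) i : R) *
            f i ^ Sum.elim id id t) := fun _ => rfl
      rw [e2, e2, Finset.smul_sum, ← Finset.sum_sub_distrib, Finset.smul_sum]
      change (∑ i ∈ Sᶜ, _) + _ = 0
      rw [← Finset.sum_add_distrib]
      refine Finset.sum_eq_zero fun i hi => ?_
      rw [Finset.mem_compl] at hi
      replace hi : i ∉ S := hi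
      have e1 : cechLocMat f (CechIdx.ins (.ofNonempty S hS (.inl k)) i) =
        ((-1) ^ (insert i S).card : R) •
          (Finsupp.single (CechIdx.ins (.ofNonempty S hS (.inr k)) i) 1 -
          Finsupp.single (CechIdx.ins (.ofNonempty S hS (.inr (k + 1))) i)
            (∏ i ∈ insert i S, f i)) := rfl
      rw [e1, Finset.card_insert_of_notMem hi, Finset.prod_insert hi]
      simp only [Finsupp.smul_single, smul_sub, smul_eq_mul, CechIdx.pos, CechIdx.ofNonempty,
        Sum.elim_inl, Sum.elim_inr, id]
      rw [sub_add_sub_comm, ← Finsupp.single_add, ← Finsupp.single_add, sub_eq_zero]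
      refine Eq.trans (Finsupp.single_eq_zero.2 ?_) (Finsupp.single_eq_zero.2 ?_).symm
      · ring
      · ring
    · rw [cechLocMat_inr f _ k rfl, map_zero, map_zero, zero_add, add_zero,
        linearCombination_cechUpMat]
      refine Finset.sum_eq_zero fun i hi => ?_
      rw [cechLocMat_inr f _ k rfl, smul_zero]

/-- The differential of the complex of maps from the Čech complex to `X`. -/
def cechD (d : X →ₗ[R] X) : (CechIdx r → X) →ₗ[R] (CechIdx r → X) := cellD cechSign (cechMat f) d

variable {d : X →ₗ[R] X}

lemma cechD_cechD (hd : ∀ x, d (d x) = 0) (z : CechIdx r → X) : cechD f d (cechD f d z) = 0 :=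
  cellD_cellD (isCell_cech f) hd z

lemma card_ins {s : CechIdx r} {i : Fin r} (hi : i ∉ s.1.1) :
    (s.ins i).1.1.card = s.1.1.card + 1 := Finset.card_insert_of_notMem hi

lemma card_le (s : CechIdx r) : s.1.1.card ≤ r := by
  simpa using s.1.1.card_le_univ

/-- A strictly decreasing rank function for the matrix of the Čech complex. -/
def cechRank (s : CechIdx r) : ℕ := 2 * (r - s.1.1.card) + Sum.elim (fun _ => 1) (fun _ => 0) s.1.2

lemma cechRank_lt {s t : CechIdx r} (h : cechMat f s t ≠ 0) : cechRank t < cechRank s := by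
  rcases cechMat_ne_zero f h with ⟨S, hS, k, rfl, rfl | rfl⟩ | ⟨i, hi, rfl⟩
  · simp [cechRank, CechIdx.ofNonempty]
  · simp [cechRank, CechIdx.ofNonempty]
  · have h1 := card_ins hi
    have h2 := card_le (s.ins i)
    have h3 : (s.ins i).1.2 = s.1.2 := rfl
    simp only [cechRank, h3]
    lia

/-- This is the coordinate form of the fact that local homology preserves quasi-isomorphisms. -/
lemma qis_cellMap_cech {dY : Y →ₗ[R] Y} {g : X →ₗ[R] Y} (hd : ∀ x, d (d x) = 0)
    (hd' : ∀ x, dY (dY x) = 0) (hg : ∀ x, g (d x) = dY (g x)) (h : Qis d dY g) :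
    Qis (cechD f d) (cechD f dY) (cellMap (CechIdx r) g) :=
  qis_cellMap (isCell_cech f) cechRank (fun _ _ => cechRank_lt f) hd hd' hg h

/-- Together with `cechD_inl`: on a family vanishing on all larger sets, the rows of `S` in `cechD`
are those of `locD` for `f_S`, up to rescaling by `(-1) ^ |S|`. -/
lemma cechD_inr (z : CechIdx r → X) (S : Finset (Fin r)) (hS : S ≠ ∅) (k : ℕ)
    (hz : ∀ i ∉ S, z (CechIdx.ins (.ofNonempty S hS (.inr k)) i) = 0) :
    cechD f d z (.ofNonempty S hS (.inr k)) =
      ((-1) ^ S.card : ℤˣ) • d (z (.ofNonempty S hS (.inr k))) := by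
  rw [cechD, cellD_apply, cechMat, cechLocMat_inr f _ k rfl, zero_add,
    linearCombination_cechUpMat, Finset.sum_eq_zero fun i hi => ?_, sub_zero]
  · simp [cechSign, CechIdx.ofNonempty, locSign]
  · rw [hz i (Finset.mem_compl.1 hi), smul_zero]

lemma cechD_inl (z : CechIdx r → X) (S : Finset (Fin r)) (hS : S ≠ ∅) (k : ℕ)
    (hz : ∀ i ∉ S, z (CechIdx.ins (.ofNonempty S hS (.inl k)) i) = 0) :
    cechD f d z (.ofNonempty S hS (.inl k)) = z (.ofNonempty S hS (.inr k)) -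
      (∏ i ∈ S, f i) • z (.ofNonempty S hS (.inr (k + 1))) -
      ((-1) ^ S.card : ℤˣ) • d (z (.ofNonempty S hS (.inl k))) := by
  rw [cechD, cellD_apply, cechMat, map_add, cechLocMat_inl,
    linearCombination_cechUpMat, Finset.sum_eq_zero fun i hi => ?_, add_zero]
  · rw [map_smul, map_sub, Finsupp.linearCombination_single, Finsupp.linearCombination_single]
    simp only [cechSign, CechIdx.ofNonempty, locSign, Sum.elim_inl]
    rcases neg_one_pow_eq_or ℤˣ S.card with h | h <;>
      rcases Nat.even_or_odd S.card with h' | h' <;>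
      simp [h'.neg_one_pow] at h ⊢
    all_goals try abel
  · rw [hz i (Finset.mem_compl.1 hi), smul_zero]

lemma cechD_empty (z : CechIdx r → X) (hz : ∀ i, z (CechIdx.ins .empty i) = 0) :
    cechD f d z .empty = d (z .empty) := by
  rw [cechD, cellD_apply, cechMat, cechLocMat_inr f _ 0 rfl, zero_add,
    linearCombination_cechUpMat, Finset.sum_eq_zero fun i hi => ?_, sub_zero]
  · simp [cechSign, CechIdx.empty, locSign]
  · rw [hz i, smul_zero]

variable (R r X) in
open Classical in
/-- The inclusion of the component indexed by the empty set. -/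
def cechη : X →ₗ[R] (CechIdx r → X) := LinearMap.single R (fun _ => X) .empty

lemma cechη_empty (x : X) : cechη R X r x .empty = x := by
  simp [cechη]

lemma cechη_of_ne (x : X) {s : CechIdx r} (hs : s ≠ .empty) : cechη R X r x s = 0 := by
  simp [cechη, hs]

lemma ins_ne_empty (s : CechIdx r) (i : Fin r) : s.ins i ≠ .empty := fun h =>
  Finset.insert_ne_empty i s.1.1 (congrArg (fun s : CechIdx r => s.1.1) h)

lemma ofNonempty_ne_empty (S : Finset (Fin r)) (hS : S ≠ ∅) (t : ℕ ⊕ ℕ) :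
    CechIdx.ofNonempty S hS t ≠ .empty := fun h =>
  hS (congrArg (fun s : CechIdx r => s.1.1) h)

lemma cechη_d (x : X) : cechη R X r (d x) = cechD f d (cechη R X r x) := by
  ext s
  rcases s.eq_empty_or with rfl | ⟨S, hS, t, rfl⟩
  · rw [cechη_empty, cechD_empty, cechη_empty]
    exact fun i => cechη_of_ne _ (ins_ne_empty _ _)
  · rw [cechη_of_ne _ (ofNonempty_ne_empty _ _ _)]
    rcases t with k | k
    · rw [cechD_inl, cechη_of_ne _ (ofNonempty_ne_empty _ _ _),
        cechη_of_ne _ (ofNonempty_ne_empty _ _ _), cechη_of_ne _ (ofNonempty_ne_empty _ _ _)]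
      · simp
      · exact fun i _ => cechη_of_ne _ (ins_ne_empty _ _)
    · rw [cechD_inr, cechη_of_ne _ (ofNonempty_ne_empty _ _ _)]
      · simp
      · exact fun i _ => cechη_of_ne _ (ins_ne_empty _ _)

/-- Off the index `∅`, the families are filtered by the size of `S`, with blocks the maps out of the
telescopes of the `f_S`. These are acyclic, so the component at `∅` carries all the cohomology. -/
lemma qis_cechη (hd : ∀ x, d (d x) = 0)
    (h : ∀ S : Finset (Fin r), S ≠ ∅ → Acyc (locD (∏ i ∈ S, f i) d)) :
    Qis d (cechD f d) (cechη R X r) := by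
  classical
  intro x z hx hz
  have hρ : ∀ s t : CechIdx r, cechMat f s t ≠ 0 → r - t.1.1.card ≤ r - s.1.1.card := by
    intro s t h
    rcases cechMat_ne_zero f h with ⟨S, hS, k, rfl, rfl | rfl⟩ | ⟨i, hi, rfl⟩
    · exact le_rfl
    · exact le_rfl
    · have h1 := card_ins hi
      lia
  have hB : ∀ s : CechIdx r, s ≠ .empty → r - s.1.1.card < r := by
    intro s hs
    rcases s.eq_empty_or with rfl | ⟨S, hS, t, rfl⟩
    · exact absurd rfl hs
    · have h1 := card_le (.ofNonempty S hS t)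
      have h2 : 0 < (CechIdx.ofNonempty S hS t).1.1.card :=
        Finset.card_pos.2 (Finset.nonempty_iff_ne_empty.2 hS)
      lia
  have hB' : ∀ s : CechIdx r, r - s.1.1.card < r → s ≠ .empty := by
    rintro s hs rfl
    simp [CechIdx.empty] at hs
  -- The condition `r - |S| < r` excludes exactly `S = ∅`, so `z - cechD f d w` is supported at `∅`.
  have key : ∃ w : CechIdx r → X, ∀ s : CechIdx r, r - s.1.1.card < r → cechD f d w s = z s := by
    refine exists_cellD_eq (isCell_cech f) hd (fun s => r - s.1.1.card) hρ (fun v => v < r)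
      (fun u v huv hv => lt_of_le_of_lt huv hv) (fun v hv w hw hw' => ?_) z (fun s hs => ?_)
    · have hw0 : ∀ (S : Finset (Fin r)) (hS : S ≠ ∅) (t : ℕ ⊕ ℕ), r - S.card = v → ∀ i ∉ S,
          w (CechIdx.ins (.ofNonempty S hS t) i) = 0 := by
        intro S hS t e i hi
        refine hw _ ?_
        have h1 : (CechIdx.ins (.ofNonempty S hS t) i).1.1.card = S.card + 1 := card_ins hi
        have h2 := card_le (CechIdx.ins (.ofNonempty S hS t) i)
        lia
      have : ∀ S : Finset (Fin r), ∃ p : ℕ ⊕ ℕ → X, ∀ hS : S ≠ ∅, r - S.card = v →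
          locD (∏ i ∈ S, f i) d p = Sum.elim (fun k => ((-1) ^ S.card : ℤˣ) •
            w (.ofNonempty S hS (.inl k))) (fun k => w (.ofNonempty S hS (.inr k))) := by
        intro S
        by_cases hS : S ≠ ∅ ∧ r - S.card = v
        · obtain ⟨p, hp⟩ := h S hS.1 (Sum.elim (fun k => ((-1) ^ S.card : ℤˣ) •
            w (.ofNonempty S hS.1 (.inl k))) (fun k => w (.ofNonempty S hS.1 (.inr k)))) (by
            ext (k | k)
            · have e := hw' (.ofNonempty S hS.1 (.inl k)) hS.2
              replace e : cechD f d w (.ofNonempty S hS.1 (.inl k)) = 0 := e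
              rw [cechD_inl f w S hS.1 k (hw0 S hS.1 _ hS.2)] at e
              rw [locD_inl, Sum.elim_inr, Sum.elim_inr, Sum.elim_inl, map_intUnits_smul, e,
                Pi.zero_apply]
            · have e := hw' (.ofNonempty S hS.1 (.inr k)) hS.2
              replace e : cechD f d w (.ofNonempty S hS.1 (.inr k)) = 0 := e
              rw [cechD_inr f w S hS.1 k (hw0 S hS.1 _ hS.2)] at e
              rw [locD_inr, Sum.elim_inr, Pi.zero_apply, ← intUnits_smul_smul ((-1) ^ S.card) (d _),
                e, smul_zero])
          exact ⟨p, fun _ _ => hp⟩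
        · exact ⟨0, fun h1 h2 => absurd ⟨h1, h2⟩ hS⟩
      choose p hp using this
      -- The sign on the `inr` entries converts a solution for `locD` into one for the block of
      -- `cechD`.
      let y : CechIdx r → X := fun s => if r - s.1.1.card = v then
        Sum.elim (fun k => p s.1.1 (.inl k)) (fun k => ((-1) ^ s.1.1.card : ℤˣ) • p s.1.1 (.inr k)) s.1.2
        else 0
      have hy : ∀ s : CechIdx r, r - s.1.1.card ≠ v → y s = 0 := fun s hs => if_neg hs
      refine ⟨y, hy, fun s hs => ?_⟩
      change cechD f d y s = w s
      rcases s.eq_empty_or with rfl | ⟨S, hS, t, rfl⟩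
      · exact absurd rfl (hB' _ (lt_of_eq_of_lt hs hv))
      · replace hs : r - S.card = v := hs
        have hy0 : ∀ i ∉ S, y (CechIdx.ins (.ofNonempty S hS t) i) = 0 := by
          intro i hi
          refine hy _ ?_
          have h1 : (CechIdx.ins (.ofNonempty S hS t) i).1.1.card = S.card + 1 := card_ins hi
          have h2 := card_le (CechIdx.ins (.ofNonempty S hS t) i)
          lia
        have hyl : ∀ k, y (.ofNonempty S hS (.inl k)) = p S (.inl k) := fun k => if_pos hs
        have hyr : ∀ k, y (.ofNonempty S hS (.inr k)) = ((-1) ^ S.card : ℤˣ) • p S (.inr k) :=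
          fun k => if_pos hs
        rcases t with k | k
        · have e := congrFun (hp S hS hs) (.inl k)
          rw [locD_inl, Sum.elim_inl] at e
          rw [cechD_inl f y S hS k hy0, hyl, hyr, hyr,
            ← intUnits_smul_smul ((-1) ^ S.card) (w _), ← e, smul_sub, smul_sub,
            smul_comm ((-1) ^ S.card : ℤˣ)]
        · have e := congrFun (hp S hS hs) (.inr k)
          rw [locD_inr, Sum.elim_inr] at e
          rw [cechD_inr f y S hS k hy0, hyr, map_intUnits_smul, e, intUnits_smul_smul]
    · exact (congrFun hz s).trans (cechη_of_ne x (hB' s hs))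
  obtain ⟨w, hw⟩ := key
  have h1 : z = cechη R X r (z .empty - cechD f d w .empty) + cechD f d w := by
    ext s
    by_cases hs : s = .empty
    · subst hs
      rw [Pi.add_apply, cechη_empty, sub_add_cancel]
    · rw [Pi.add_apply, cechη_of_ne _ hs, zero_add, hw s (hB s hs)]
  refine ⟨z .empty - cechD f d w .empty, w, ?_, h1.symm⟩
  have h2 : cechη R X r (d (z .empty - cechD f d w .empty)) = cechη R X r x := by
    rw [cechη_d f, ← hz]
    conv_rhs => rw [h1, map_add, cechD_cechD f hd, add_zero]
  simpa [cechη_empty] using congrFun h2 .empty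

end Cech

end DiffMod

namespace DiffMod

variable {R X Y : Type*} [CommRing R] [AddCommGroup X] [Module R X] [AddCommGroup Y] [Module R Y]

/-! ### Contraction of the Čech complex when `f i` acts invertibly. -/

section Matching

variable {r : ℕ} (i : Fin r)

/-- The matching on pairs used for a ring element `f i` acting invertibly. -/
def matchPair (s : Finset (Fin r) × (ℕ ⊕ ℕ)) : Finset (Fin r) × (ℕ ⊕ ℕ) :=
  if s.1 = ∅ then ({i}, .inr 0)
  -- The telescope of `{i}` is contracted through its entries `f i` rather than its entries `±1`:
  -- `inl k` goes with `inr (k + 1)`, which leaves `inr 0` for `∅`.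
  else if s.1 = {i} then
    match s.2 with
    | .inl k => ({i}, .inr (k + 1))
    | .inr 0 => (∅, .inr 0)
    | .inr (k + 1) => ({i}, .inl k)
  else if i ∈ s.1 then (s.1.erase i, s.2) else (insert i s.1, s.2)

/-- The lower elements of the matching. -/
def matchLower (s : CechIdx r) : Prop :=
  if s.1.1 = ∅ then True
  else if s.1.1 = {i} then s.1.2.isLeft = true
  else i ∉ s.1.1

/-- The rank for the matching. -/
def matchRank (s : Finset (Fin r) × (ℕ ⊕ ℕ)) : ℕ :=
  -- The sets `∅` and `{i}` are placed above all others. Along the telescope of `{i}` the rank grows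
  -- with the position, so that `inl k → inr (k + 1)` preserves it while `inl k → inr k` lowers it.
  if s.1 = ∅ then 2 * r + 1
  else if s.1 = {i} then 2 * r + 1 + Sum.elim (fun k => k + 1) id s.2
  else 2 * (r - (s.1.erase i).card) + Sum.elim (fun _ => 1) (fun _ => 0) s.2

/-- The matching. -/
def matchIdx (s : CechIdx r) : CechIdx r :=
  ⟨matchPair i s.1, by
    obtain ⟨⟨S, t⟩, h⟩ := s
    intro h'
    by_cases h1 : S = ∅
    · simp [matchPair, h1] at h'
    · by_cases h2 : S = {i}
      · rcases t with k | k | k <;> simp [matchPair, h2] at h' ⊢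
      · by_cases h3 : i ∈ S
        · simp only [matchPair, if_neg h1, if_neg h2, if_pos h3] at h'
          rcases Finset.erase_eq_empty_iff _ _ |>.1 h' with h | h
          · exact absurd h h1
          · exact absurd h h2
        · simp [matchPair, h1, h2, h3] at h'⟩

/-- The four kinds of indices with respect to an element `i`. -/
lemma idx_cases {P : CechIdx r → Prop} (h0 : P .empty)
    (hi : ∀ t, P (.ofNonempty {i} (Finset.singleton_ne_empty i) t))
    (hS : ∀ S hS t, i ∉ S → P (.ofNonempty S hS t))
    (hS' : ∀ S, S ≠ ∅ → ∀ t, i ∉ S →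
      P (.ofNonempty (insert i S) (Finset.insert_ne_empty _ _) t)) (s : CechIdx r) : P s := by
  rcases s.eq_empty_or with rfl | ⟨S, hne, t, rfl⟩
  · exact h0
  · by_cases h : i ∈ S
    · by_cases h' : S = {i}
      · subst h'
        exact hi t
      · have h1 : S.erase i ≠ ∅ := fun e => by
          rcases Finset.erase_eq_empty_iff _ _ |>.1 e with h | h
          · exact hne h
          · exact h' h
        have := hS' (S.erase i) h1 t (Finset.notMem_erase i S)
        simpa only [Finset.insert_erase h] using this
    · exact hS S hne t h

section

variable {i} {S : Finset (Fin r)} (hS : S ≠ ∅) (hi : i ∉ S) (t : ℕ ⊕ ℕ)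

include hi

lemma ne_singleton_of_notMem : S ≠ {i} := fun h => hi (h ▸ Finset.mem_singleton_self i)

include hS in
lemma insert_ne_singleton : insert i S ≠ {i} := fun h => hS (by
  rw [← Finset.erase_insert hi, h]
  simp)

lemma matchIdx_of_notMem :
    matchIdx i (.ofNonempty S hS t) = .ofNonempty (insert i S) (Finset.insert_ne_empty _ _) t :=
  Subtype.ext (by
    simp [matchIdx, matchPair, CechIdx.ofNonempty, hS, ne_singleton_of_notMem hi, hi])

lemma matchIdx_insert :
    matchIdx i (.ofNonempty (insert i S) (Finset.insert_ne_empty _ _) t) = .ofNonempty S hS t :=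
  Subtype.ext (by
    simp [matchIdx, matchPair, CechIdx.ofNonempty, insert_ne_singleton hS hi, hi])

lemma matchLower_of_notMem : matchLower i (.ofNonempty S hS t) := by
  simp [matchLower, CechIdx.ofNonempty, hS, ne_singleton_of_notMem hi, hi]

include hS in
lemma not_matchLower_insert :
    ¬ matchLower i (.ofNonempty (insert i S) (Finset.insert_ne_empty _ _) t) := by
  simp [matchLower, CechIdx.ofNonempty, insert_ne_singleton hS hi]

include hS in
lemma matchRank_of_notMem : matchRank i (S, t) =
    2 * (r - S.card) + Sum.elim (fun _ => 1) (fun _ => 0) t := by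
  simp [matchRank, hS, ne_singleton_of_notMem hi, hi]

include hS in
lemma matchRank_insert : matchRank i (insert i S, t) =
    2 * (r - S.card) + Sum.elim (fun _ => 1) (fun _ => 0) t := by
  simp [matchRank, insert_ne_singleton hS hi, hi]

end

lemma matchIdx_empty :
    matchIdx i .empty = .ofNonempty {i} (Finset.singleton_ne_empty i) (.inr 0) := rfl

lemma matchIdx_singleton_inl (k : ℕ) :
    matchIdx i (.ofNonempty {i} (Finset.singleton_ne_empty i) (.inl k)) =
      .ofNonempty {i} (Finset.singleton_ne_empty i) (.inr (k + 1)) :=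
  Subtype.ext (by simp [matchIdx, matchPair, CechIdx.ofNonempty])

lemma matchIdx_singleton_inr_zero :
    matchIdx i (.ofNonempty {i} (Finset.singleton_ne_empty i) (.inr 0)) = .empty :=
  Subtype.ext (by simp [matchIdx, matchPair, CechIdx.ofNonempty, CechIdx.empty])

lemma matchIdx_singleton_inr_succ (k : ℕ) :
    matchIdx i (.ofNonempty {i} (Finset.singleton_ne_empty i) (.inr (k + 1))) =
      .ofNonempty {i} (Finset.singleton_ne_empty i) (.inl k) :=
  Subtype.ext (by simp [matchIdx, matchPair, CechIdx.ofNonempty])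

lemma matchLower_empty : matchLower i .empty := by simp [matchLower, CechIdx.empty]

lemma matchLower_singleton (t : ℕ ⊕ ℕ) :
    matchLower i (.ofNonempty {i} (Finset.singleton_ne_empty i) t) ↔ t.isLeft = true := by
  simp [matchLower, CechIdx.ofNonempty]

lemma matchRank_empty (t : ℕ ⊕ ℕ) : matchRank i (∅, t) = 2 * r + 1 := by simp [matchRank]

lemma matchRank_singleton (t : ℕ ⊕ ℕ) :
    matchRank i ({i}, t) = 2 * r + 1 + Sum.elim (fun k => k + 1) id t := by simp [matchRank]

lemma matchIdx_matchIdx (s : CechIdx r) : matchIdx i (matchIdx i s) = s := by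
  induction s using idx_cases i with
  | h0 => rw [matchIdx_empty, matchIdx_singleton_inr_zero]
  | hi t =>
    rcases t with k | k | k
    · rw [matchIdx_singleton_inl, matchIdx_singleton_inr_succ]
    · rw [matchIdx_singleton_inr_zero, matchIdx_empty]
    · rw [matchIdx_singleton_inr_succ, matchIdx_singleton_inl]
  | hS S hS t hi => rw [matchIdx_of_notMem hS hi, matchIdx_insert hS hi]
  | hS' S hS t hi => rw [matchIdx_insert hS hi, matchIdx_of_notMem hS hi]

lemma matchLower_matchIdx (s : CechIdx r) :
    matchLower i (matchIdx i s) ↔ ¬ matchLower i s := by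
  induction s using idx_cases i with
  | h0 => simp [matchIdx_empty, matchLower_singleton, matchLower_empty]
  | hi t =>
    rcases t with k | k | k
    · simp [matchIdx_singleton_inl, matchLower_singleton]
    · simp [matchIdx_singleton_inr_zero, matchLower_singleton, matchLower_empty]
    · simp [matchIdx_singleton_inr_succ, matchLower_singleton]
  | hS S hS t hi =>
    simp [matchIdx_of_notMem hS hi, matchLower_of_notMem hS hi, not_matchLower_insert hS hi]
  | hS' S hS t hi =>
    simp [matchIdx_insert hS hi, matchLower_of_notMem hS hi, not_matchLower_insert hS hi]

lemma matchRank_matchIdx (s : CechIdx r) :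
    matchRank i (matchIdx i s).1 = matchRank i s.1 := by
  induction s using idx_cases i with
  | h0 => rw [matchIdx_empty]; simp [CechIdx.ofNonempty, CechIdx.empty, matchRank]
  | hi t =>
    rcases t with k | k | k
    · rw [matchIdx_singleton_inl]; simp [CechIdx.ofNonempty, matchRank]
    · rw [matchIdx_singleton_inr_zero]; simp [CechIdx.ofNonempty, CechIdx.empty, matchRank]
    · rw [matchIdx_singleton_inr_succ]; simp [CechIdx.ofNonempty, matchRank]
  | hS S hS t hi =>
    rw [matchIdx_of_notMem hS hi]
    exact (matchRank_insert hS hi t).trans (matchRank_of_notMem hS hi t).symm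
  | hS' S hS t hi =>
    rw [matchIdx_insert hS hi]
    exact (matchRank_of_notMem hS hi t).trans (matchRank_insert hS hi t).symm

lemma cechSign_matchIdx (s : CechIdx r) : cechSign (matchIdx i s) = - cechSign s := by
  induction s using idx_cases i with
  | h0 => rw [matchIdx_empty]; simp [CechIdx.ofNonempty, CechIdx.empty, cechSign, locSign]
  | hi t =>
    rcases t with k | k | k
    · rw [matchIdx_singleton_inl]; simp [CechIdx.ofNonempty, cechSign, locSign]
    · rw [matchIdx_singleton_inr_zero]; simp [CechIdx.ofNonempty, CechIdx.empty, cechSign, locSign]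
    · rw [matchIdx_singleton_inr_succ]; simp [CechIdx.ofNonempty, cechSign, locSign]
  | hS S hS t hi =>
    rw [matchIdx_of_notMem hS hi]; simp [CechIdx.ofNonempty, cechSign,
      Finset.card_insert_of_notMem hi, pow_succ]
  | hS' S hS t hi =>
    rw [matchIdx_insert hS hi]; simp [CechIdx.ofNonempty, cechSign,
      Finset.card_insert_of_notMem hi, pow_succ]

variable (f : Fin r → R)

lemma card_le' (S : Finset (Fin r)) : S.card ≤ r := by simpa using S.card_le_univ

lemma matchRank_lt_of_ne_singleton {S : Finset (Fin r)} (hS : S ≠ ∅) (h : S ≠ {i})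
    (t : ℕ ⊕ ℕ) : matchRank i (S, t) < 2 * r + 1 := by
  have h1 : 0 < (S.erase i).card := Finset.card_pos.2 (Finset.nonempty_iff_ne_empty.2 fun e => by
    rcases Finset.erase_eq_empty_iff _ _ |>.1 e with h' | h'
    · exact hS h'
    · exact h h')
  have h2 := card_le' (S.erase i)
  simp only [matchRank, if_neg hS, if_neg h]
  rcases t with k | k <;> simp only [Sum.elim_inl, Sum.elim_inr] <;> lia

/-- The nonzero entries of the matrix do not increase the rank, and preserve it only for
matched indices. -/
lemma matchRank_of_cechMat {s t : CechIdx r} (h : cechMat f s t ≠ 0) :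
    matchRank i t.1 < matchRank i s.1 ∨
      (matchRank i t.1 = matchRank i s.1 ∧ matchLower i s ∧ t = matchIdx i s) := by
  rcases cechMat_ne_zero f h with ⟨S, hS, k, rfl, h'⟩ | ⟨j, hj, rfl⟩
  · by_cases hSi : S = {i}
    · subst hSi
      rcases h' with rfl | rfl
      · left
        simp [CechIdx.ofNonempty, matchRank]
      · right
        refine ⟨?_, (matchLower_singleton i _).2 rfl, (matchIdx_singleton_inl i k).symm⟩
        simp [CechIdx.ofNonempty, matchRank]
    · left
      rcases h' with rfl | rfl <;> simp [CechIdx.ofNonempty, matchRank, hS, hSi]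
  · rcases s.eq_empty_or with rfl | ⟨S, hS, t, rfl⟩
    · by_cases hij : j = i
      · subst hij
        right
        refine ⟨?_, matchLower_empty j, rfl⟩
        simp [CechIdx.ofNonempty, matchRank, CechIdx.empty, CechIdx.ins]
      · left
        refine lt_of_lt_of_eq (matchRank_lt_of_ne_singleton i (Finset.insert_ne_empty _ _) ?_ _)
          (matchRank_empty i _).symm
        rw [CechIdx.empty, Finset.insert_empty]
        simpa using hij
    · replace hj : j ∉ S := hj
      by_cases hij : j = i
      · subst hij
        right
        refine ⟨?_, matchLower_of_notMem hS hj t, (matchIdx_of_notMem hS hj t).symm⟩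
        exact (matchRank_insert hS hj t).trans (matchRank_of_notMem hS hj t).symm
      · left
        have hne : insert j S ≠ {i} := fun e => hij (Finset.mem_singleton.1
          (e ▸ Finset.mem_insert_self j S))
        have h1 : matchRank i (insert j S, t) < 2 * r + 1 :=
          matchRank_lt_of_ne_singleton i (Finset.insert_ne_empty _ _) hne t
        by_cases hSi : S = {i}
        · subst hSi
          refine lt_of_lt_of_le h1 ?_
          change _ ≤ matchRank i ({i}, t)
          rw [matchRank_singleton]
          lia
        · change matchRank i (insert j S, t) < matchRank i (S, t)
          have h2 : ((insert j S).erase i).card = (S.erase i).card + 1 := by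
            rw [Finset.erase_insert_of_ne hij]
            exact Finset.card_insert_of_notMem (fun h => hj (Finset.mem_of_mem_erase h))
          have h3 := card_le' ((insert j S).erase i)
          simp only [matchRank, if_neg hS, if_neg hSi, if_neg hne,
            if_neg (Finset.insert_ne_empty j S), h2]
          lia

variable {d : X →ₗ[R] X}

lemma Qis.one : Qis d d (LinearMap.lsmul R X 1) := by
  intro x y hx hy
  exact ⟨y, 0, by simpa using hy, by simp⟩

lemma Qis.mul {a b : R} (ha : Qis d d (LinearMap.lsmul R X a))
    (hb : Qis d d (LinearMap.lsmul R X b)) : Qis d d (LinearMap.lsmul R X (a * b)) := by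
  have := hb.comp (k := LinearMap.lsmul R X a) (by simp) (by simp) ha
  intro x y hx hy
  obtain ⟨p, q, hp, hq⟩ := this x y hx (by
    rw [hy]
    exact mul_smul a b x)
  exact ⟨p, q, hp, by
    rw [← hq]
    exact congrArg (· + d q) (mul_smul a b p)⟩

lemma Qis.pow {a : R} (ha : Qis d d (LinearMap.lsmul R X a)) (n : ℕ) :
    Qis d d (LinearMap.lsmul R X (a ^ n)) := by
  induction n with
  | zero => simpa using Qis.one
  | succ n ih => rw [pow_succ]; exact ih.mul ha

lemma Qis.neg_one : Qis d d (LinearMap.lsmul R X (-1)) := by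
  intro x y hx hy
  exact ⟨-y, 0, by simpa using congrArg (fun v => -v) hy, by simp⟩

lemma Qis.cubeSign (S : Finset (Fin r)) (j : Fin r) :
    Qis d d (LinearMap.lsmul R X (cubeSign S j : R)) := by
  rw [_root_.cubeSign]
  push_cast
  exact Qis.neg_one.pow _

lemma cechMat_ins (s : CechIdx r) (hi : i ∉ s.1.1) :
    cechMat f s (s.ins i) = (_root_.cubeSign (insert i s.1.1) i : R) * f i ^ s.pos := by
  have h1 : cechLocMat f s (s.ins i) = 0 := by
    obtain ⟨⟨S, k | k⟩, h'⟩ := s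
    · have hS : S ≠ ∅ := fun e => nomatch h' e
      have h2 : ∀ t, CechIdx.ins ⟨(S, .inl k), h'⟩ i ≠ .ofNonempty S hS t := fun t e => by
        refine hi ?_
        have := congrArg (fun s : CechIdx r => s.1.1) e
        replace this : insert i S = S := this
        exact Finset.insert_eq_self.1 this
      refine (congrArg (fun z => z (CechIdx.ins ⟨(S, .inl k), h'⟩ i))
        (cechLocMat_inl f S hS k)).trans ?_
      rw [Finsupp.smul_apply, Finsupp.sub_apply, Finsupp.single_eq_of_ne (h2 _),
        Finsupp.single_eq_of_ne (h2 _), sub_zero, smul_zero]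
    · rfl
  rw [cechMat, Finsupp.add_apply, h1, zero_add, cechUpMat, Finsupp.finsetSum_apply,
    Finset.sum_eq_single i]
  · exact Finsupp.single_eq_same
  · intro j hj hji
    refine Finsupp.single_eq_of_ne fun e => hji ?_
    have := congrArg (fun s : CechIdx r => s.1.1) e
    replace this : insert i s.1.1 = insert j s.1.1 := this
    have h2 : j ∈ insert i s.1.1 := this ▸ Finset.mem_insert_self j _
    exact (Finset.mem_insert.1 h2).resolve_right (Finset.mem_compl.1 hj)
  · intro h'
    exact absurd (Finset.mem_compl.2 hi) h'

lemma cechMat_singleton (k : ℕ) :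
    cechMat f (.ofNonempty {i} (Finset.singleton_ne_empty i) (.inl k))
      (.ofNonempty {i} (Finset.singleton_ne_empty i) (.inr (k + 1))) = f i := by
  have h1 : cechUpMat f (.ofNonempty {i} (Finset.singleton_ne_empty i) (.inl k))
      (.ofNonempty {i} (Finset.singleton_ne_empty i) (.inr (k + 1))) = 0 := by
    rw [cechUpMat, Finsupp.finsetSum_apply]
    refine Finset.sum_eq_zero fun j hj => Finsupp.single_eq_of_ne fun e => ?_
    have := congrArg (fun s : CechIdx r => s.1.2) e
    exact nomatch this
  rw [cechMat, Finsupp.add_apply, h1, add_zero, cechLocMat_inl, Finsupp.smul_apply,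
    Finsupp.sub_apply, Finsupp.single_eq_same, Finsupp.single_eq_of_ne]
  · simp
  · intro e
    have := congrArg (fun s : CechIdx r => s.1.2) e
    exact absurd (Sum.inr_injective this) (Nat.succ_ne_self k)

/-- Every matched entry is `f i` or, up to sign, a power of `f i`, so it acts by a quasi-isomorphism
and the matching contracts the complex. -/
lemma acyc_cechD (hd : ∀ x, d (d x) = 0) (hi : Qis d d (LinearMap.lsmul R X (f i))) :
    Acyc (cechD f d) := by
  refine acyc_of_matching (isCell_cech f) hd (fun s => matchRank i s.1) (fun s t h => ?_)
    (matchLower i) (matchIdx i) (matchIdx_matchIdx i) (matchLower_matchIdx i)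
    (matchRank_matchIdx i) (cechSign_matchIdx i) (fun s t h h' => ?_) (fun s hs => ?_)
  · rcases matchRank_of_cechMat i f h with h | h
    · exact h.le
    · exact h.1.le
  · rcases matchRank_of_cechMat i f h with h | h
    · exact absurd h' h.ne
    · exact h.2
  · induction s using idx_cases i with
    | h0 =>
      have e := cechMat_ins i f .empty (Finset.notMem_empty i)
      replace e : cechMat f .empty (matchIdx i .empty) = _ := e
      rw [e]
      exact (Qis.cubeSign _ _).mul (hi.pow _)
    | hi t =>
      rcases t with k | k
      · rw [matchIdx_singleton_inl, cechMat_singleton]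
        exact hi
      · exact absurd ((matchLower_singleton i _).1 hs) (by simp)
    | hS S hS t hiS =>
      have e := cechMat_ins i f (.ofNonempty S hS t) hiS
      rw [matchIdx_of_notMem hS hiS]
      refine Eq.mpr (congrArg (fun z => Qis d d (LinearMap.lsmul R X z)) e) ?_
      exact (Qis.cubeSign _ _).mul (hi.pow _)
    | hS' S hS t hiS => exact absurd hs (not_matchLower_insert hS hiS t)

/-- The complex of maps from the Čech complex is complete. -/
lemma acyc_locD_cechD (hd : ∀ x, d (d x) = 0) {a : R} (ha : a ∈ Ideal.span (Set.range f)) :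
    Acyc (locD a (cechD f d)) := by
  -- Only the generators `f i` need to be tested. After exchanging the two sets of indices, the
  -- coefficients are maps out of the telescope of `f i`, on which `f i` acts by a homotopy
  -- equivalence.
  refine acyc_locD_of_mem_span (cechD_cechD f hd · |>.trans rfl) ?_ ha
  rintro _ ⟨i, rfl⟩
  refine (acyc_cellD_swap (isCell_loc _) (isCell_cech f)).2 ?_
  exact acyc_cechD i f (locD_locD hd · |>.trans rfl) (qis_smul_locD (f i))

/-- Exchanging the two Čech indices carries the unit with coefficients in the families `CechIdx r →
X` to the map induced by the unit of `X`. The former is a quasi-isomorphism because those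
coefficients are complete at each `f_S`. -/
lemma qis_cellMap_cechη (hd : ∀ x, d (d x) = 0) :
    Qis (cechD f d) (cechD f (cechD f d)) (cellMap (CechIdx r) (cechη R X r)) := by
  have h1 : Qis (cechD f d) (cechD f (cechD f d)) (cechη R (CechIdx r → X) r) := by
    refine qis_cechη f (cechD_cechD f hd · |>.trans rfl) fun S hS => ?_
    obtain ⟨i, hi⟩ := Finset.nonempty_iff_ne_empty.2 hS
    refine acyc_locD_cechD f hd ?_
    rw [← Finset.mul_prod_erase S f hi]
    exact Ideal.mul_mem_right _ _ (Ideal.subset_span ⟨i, rfl⟩)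
  have h2 : ∀ z : CechIdx r → X, cellSwap X R cechSign cechSign (cechη R (CechIdx r → X) r z) =
      cellMap (CechIdx r) (cechη R X r) z := by
    intro z
    ext s s'
    rw [cellSwap_apply, cellMap_apply]
    by_cases h : s' = .empty
    · subst h
      -- The index `∅` is even, so no Koszul sign appears at the only place where `cechη` is
      -- nonzero.
      have : cechSign (.empty : CechIdx r) = 1 := by simp [cechSign, CechIdx.empty, locSign]
      rw [cechη_empty, cechη_empty, this, koszul_one_left, one_smul]
    · rw [cechη_of_ne _ h, cechη_of_ne _ h, Pi.zero_apply, smul_zero]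
  have h3 := Qis.comp (k := cellSwap X R cechSign cechSign)
    (dZ := cechD f (cechD f d)) (cellSwap_cellD (isCell_cech f) (isCell_cech f))
    (cechη_d f) h1
    (Qis.of_bijective (cellSwap_cellD (isCell_cech f) (isCell_cech f)) cellSwap_bijective)
  exact (LinearMap.ext h2 : cellSwap X R cechSign cechSign ∘ₗ cechη R (CechIdx r → X) r = _) ▸ h3

end Matching

end DiffMod

namespace GrMod

variable {A : Type u} [CommRing A] {𝒜 : ℤ → AddSubgroup A} [GradedRing 𝒜]

/-! ### Graded modules as modules over the ungraded ring. -/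

section Transport

/-- Transport between components of equal degrees. -/
def tr (N : GrMod 𝒜) {a b : ℤ} (h : a = b) : N.obj a →+ N.obj b := by
  subst h
  exact AddMonoidHom.id _

lemma app_tr {N N' : GrMod 𝒜} (f : N ⟶ N') {a b : ℤ} (h : a = b) (x : N.obj a) :
    app f b (N.tr h x) = N'.tr h (app f a x) := by
  subst h
  rfl

lemma smul_tr (N : GrMod 𝒜) {i j j' k : ℤ} (h : j' = j) (h' : i + j = k) (a : 𝒜 i)
    (x : N.obj j') : N.smul h' a (N.tr h x) = N.smul (h ▸ h') a x := by
  subst h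
  rfl

lemma tr_smul (N : GrMod 𝒜) {i j k k' : ℤ} (h : k = k') (h' : i + j = k) (a : 𝒜 i)
    (x : N.obj j) : N.tr h (N.smul h' a x) = N.smul (h'.trans h) a x := by
  subst h
  rfl

end Transport

/-- The product of the components of a graded module. -/
def Tot (N : GrMod 𝒜) : Type u := ∀ j, N.obj j

instance (N : GrMod 𝒜) : AddCommGroup N.Tot := inferInstanceAs (AddCommGroup (∀ j, N.obj j))

lemma Tot.ext {N : GrMod 𝒜} {x y : N.Tot} (h : ∀ j, x j = y j) : x = y := funext h

/-- The action of homogeneous elements on the product of the components. -/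
def smulTot (N : GrMod 𝒜) (i : ℤ) : 𝒜 i →+ AddMonoid.End N.Tot :=
  AddMonoidHom.mk' (fun a => AddMonoidHom.mk'
      (fun x k => N.smul (show i + (k - i) = k by lia) a (x (k - i)))
      (fun x y => funext fun k => map_add (N.smul _ a) _ _))
    (fun a b => AddMonoidHom.ext fun x => funext fun k =>
      DFunLike.congr_fun (map_add (N.smul (show i + (k - i) = k by lia)) a b) _)

lemma smulTot_apply (N : GrMod 𝒜) {i j k : ℤ} (h : i + j = k) (a : 𝒜 i) (x : N.Tot) :
    N.smulTot i a x k = N.smul h a (x j) := by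
  obtain rfl : j = k - i := by lia
  rfl

lemma smulTot_one (N : GrMod 𝒜) : N.smulTot 0 (GradedMonoid.GOne.one (A := fun i => 𝒜 i)) = 1 :=
  AddMonoidHom.ext fun x => Tot.ext fun k =>
    (N.smulTot_apply (zero_add k) _ x).trans (N.one_smul k (x k))

lemma smulTot_mul (N : GrMod 𝒜) {i i' : ℤ} (a : 𝒜 i) (b : 𝒜 i') :
    N.smulTot (i + i') (GradedMonoid.GMul.mul (A := fun i => 𝒜 i) a b) = N.smulTot i a * N.smulTot i' b :=
  AddMonoidHom.ext fun x => Tot.ext fun k => by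
    refine (N.smulTot_apply (show i + i' + (k - i - i') = k by lia) _ x).trans ?_
    refine Eq.trans ?_ (N.smulTot_apply (show i + (k - i) = k by lia) a _).symm
    refine Eq.trans ?_ (congrArg (N.smul _ a)
      (N.smulTot_apply (show i' + (k - i - i') = k - i by lia) b x).symm)
    exact N.mul_smul _ _ _ a b _ _ rfl

/-- The action of the ring on the product of the components. -/
def actionHom (N : GrMod 𝒜) : A →+* AddMonoid.End N.Tot :=
  (DirectSum.toSemiring N.smulTot N.smulTot_one N.smulTot_mul).comp
    (DirectSum.decomposeRingEquiv 𝒜).toRingHom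

instance (N : GrMod 𝒜) : Module A N.Tot := Module.compHom N.Tot N.actionHom

/-- The formula determines the action, since homogeneous elements generate `A` additively. -/
lemma Tot.smul_apply (N : GrMod 𝒜) {i j k : ℤ} (h : i + j = k) (a : 𝒜 i) (x : N.Tot) :
    ((a : A) • x) k = N.smul h a (x j) := by
  have : N.actionHom (a : A) = N.smulTot i a := by
    change DirectSum.toSemiring N.smulTot N.smulTot_one N.smulTot_mul
      (DirectSum.decompose 𝒜 (a : A)) = _
    rw [DirectSum.decompose_coe]
    exact DirectSum.toSemiring_of _ _ _ _ _
  exact (congrArg (fun φ : AddMonoid.End N.Tot => φ x k) this).trans (N.smulTot_apply h a x)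

/-- An additive map commuting with homogeneous elements is linear. -/
def linearOfHomogeneous {V W : Type*} [AddCommGroup V] [Module A V] [AddCommGroup W] [Module A W]
    (𝒜 : ℤ → AddSubgroup A) [GradedRing 𝒜]
    (φ : V →+ W) (h : ∀ (i : ℤ) (a : 𝒜 i) v, φ ((a : A) • v) = (a : A) • φ v) : V →ₗ[A] W where
  toFun := φ
  map_add' := φ.map_add
  map_smul' a v := by
    change φ (a • v) = a • φ v
    induction a using DirectSum.Decomposition.inductionOn 𝒜 with
    | zero => simp
    | homogeneous a => exact h _ a v
    | add a b ha hb => rw [add_smul, add_smul, map_add, ha, hb]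

/-- The linear map induced on the products of the components. -/
def Tot.map {N N' : GrMod 𝒜} (f : N ⟶ N') : N.Tot →ₗ[A] N'.Tot :=
  linearOfHomogeneous 𝒜 (AddMonoidHom.mk' (fun x j => app f j (x j))
    (fun x y => Tot.ext fun j => map_add (app f j) _ _)) (fun i a x => Tot.ext fun k => by
      refine Eq.trans ?_ (Tot.smul_apply N' (show i + (k - i) = k by lia) a _).symm
      refine (congrArg (app f k) (Tot.smul_apply N (show i + (k - i) = k by lia) a x)).trans ?_
      exact app_smul f _ a _)

/-- The product of all the components of a cochain complex of graded modules. -/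
abbrev TotCh (M : CochainComplex (GrMod 𝒜) ℤ) : Type u := ∀ n, (M.X n).Tot

/-- Construct an element from its components. -/
def TotCh.mk {M : CochainComplex (GrMod 𝒜) ℤ} (f : ∀ n j, (M.X n).obj j) : TotCh M := f

lemma TotCh.mk_apply {M : CochainComplex (GrMod 𝒜) ℤ} (f : ∀ n j, (M.X n).obj j) (n j : ℤ) :
    TotCh.mk f n j = f n j := rfl

/-- The differential on the product of all the components. -/
def totD (M : CochainComplex (GrMod 𝒜) ℤ) : TotCh M →ₗ[A] TotCh M :=
  LinearMap.pi fun n => Tot.map (M.d (n - 1) n) ∘ₗ LinearMap.proj (n - 1)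

lemma totD_apply (M : CochainComplex (GrMod 𝒜) ℤ) {m n : ℤ} (h : m + 1 = n) (x : TotCh M) (j : ℤ) :
    totD M x n j = app (M.d m n) j (x m j) := by
  obtain rfl : m = n - 1 := by lia
  rfl

lemma d_d_apply (M : CochainComplex (GrMod 𝒜) ℤ) (l m n j : ℤ) (x : (M.X l).obj j) :
    app (M.d m n) j (app (M.d l m) j x) = 0 := by
  rw [← app_comp, M.d_comp_d]
  rfl

lemma totD_totD (M : CochainComplex (GrMod 𝒜) ℤ) (x : TotCh M) : totD M (totD M x) = 0 := by
  funext n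
  refine Tot.ext fun j => ?_
  rw [totD_apply M (show n - 1 + 1 = n by lia), totD_apply M (show n - 1 - 1 + 1 = n - 1 by lia),
    d_d_apply]
  rfl

/-- The map induced by a morphism of complexes on the products of the components. -/
def totMap {M N : CochainComplex (GrMod 𝒜) ℤ} (g : M ⟶ N) : TotCh M →ₗ[A] TotCh N :=
  LinearMap.pi fun n => Tot.map (g.f n) ∘ₗ LinearMap.proj n

lemma totMap_apply {M N : CochainComplex (GrMod 𝒜) ℤ} (g : M ⟶ N) (x : TotCh M) (n j : ℤ) :
    totMap g x n j = app (g.f n) j (x n j) := rfl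

lemma totMap_totD {M N : CochainComplex (GrMod 𝒜) ℤ} (g : M ⟶ N) (x : TotCh M) :
    totMap g (totD M x) = totD N (totMap g x) := by
  funext n
  refine Tot.ext fun j => ?_
  rw [totMap_apply, totD_apply M (show n - 1 + 1 = n by lia),
    totD_apply N (show n - 1 + 1 = n by lia), totMap_apply, ← app_comp, ← app_comp, g.comm]

lemma TotCh.ext {M : CochainComplex (GrMod 𝒜) ℤ} {x y : TotCh M} (h : ∀ n j, x n j = y n j) :
    x = y := funext fun n => Tot.ext (h n)

/-! ### Exactness in components. -/

section Exactness

/-- The abstract kernel and cokernel may be compared with the degreewise ones `ker` and `coker`. -/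
lemma exact_iff (S : ShortComplex (GrMod 𝒜)) :
    S.Exact ↔ ∀ j (x : S.X₂.obj j), app S.g j x = 0 → ∃ y, app S.f j y = x := by
  rw [S.exact_iff_kernel_ι_comp_cokernel_π_zero]
  constructor
  · intro h j x hx
    have h1 : kerι S.g ≫ cokerπ S.f = 0 := by
      rw [← kernel.lift_ι S.g (kerι S.g) (kerι_comp _),
        ← cokernel.π_desc S.f (cokerπ S.f) (comp_cokerπ _), Category.assoc,
        reassoc_of% h, zero_comp, comp_zero]
    exact (QuotientAddGroup.eq_zero_iff _).1
      (DFunLike.congr_fun (congrFun (congrArg app h1) j) ⟨x, hx⟩)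
  · intro h
    ext j x
    obtain ⟨y, hy⟩ := h j (app (kernel.ι S.g) j x) (by
      rw [← app_comp, kernel.condition]
      rfl)
    rw [app_comp, ← hy, ← app_comp, cokernel.condition]
    rfl

lemma acyclic_iff (M : CochainComplex (GrMod 𝒜) ℤ) :
    M.Acyclic ↔ ∀ l n m, l + 1 = n → n + 1 = m → ∀ j (x : (M.X n).obj j), app (M.d n m) j x = 0 →
      ∃ y, app (M.d l n) j y = x := by
  have key : M.Acyclic ↔ ∀ n j (x : (M.X n).obj j), app (M.d n (n + 1)) j x = 0 →
      ∃ y, app (M.d (n - 1) n) j y = x := by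
    refine forall_congr' fun n => ?_
    rw [M.exactAt_iff' (n - 1) n (n + 1) (by simp) (by simp), exact_iff]
    rfl
  rw [key]
  constructor
  · rintro h l n m hl rfl
    obtain rfl : l = n - 1 := by lia
    exact h n
  · intro h n
    exact h (n - 1) n (n + 1) (by lia) rfl

open Classical in
/-- The element with a single nonzero component. -/
def totSingle (M : CochainComplex (GrMod 𝒜) ℤ) (n j : ℤ) (x : (M.X n).obj j) : TotCh M :=
  fun n' j' => if h : n = n' ∧ j = j' then (by
    obtain ⟨rfl, rfl⟩ := h
    exact x) else 0

lemma totSingle_self (M : CochainComplex (GrMod 𝒜) ℤ) (n j : ℤ) (x : (M.X n).obj j) :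
    totSingle M n j x n j = x := by
  delta totSingle
  exact dif_pos (c := n = n ∧ j = j) ⟨rfl, rfl⟩

lemma totSingle_of_ne (M : CochainComplex (GrMod 𝒜) ℤ) (n j : ℤ) (x : (M.X n).obj j)
    {n' j' : ℤ} (h : ¬ (n = n' ∧ j = j')) : totSingle M n j x n' j' = 0 := by
  delta totSingle
  exact dif_neg h

/-- In a product over all bidegrees primitives can be chosen independently; conversely, a cocycle in
one bidegree is extended by zero. -/
lemma acyclic_iff_acyc (M : CochainComplex (GrMod 𝒜) ℤ) :
    M.Acyclic ↔ DiffMod.Acyc (totD M) := by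
  rw [acyclic_iff]
  constructor
  · intro h x hx
    choose y hy using fun n j => h n (n + 1) (n + 1 + 1) rfl rfl j (x (n + 1) j) (by
      rw [← totD_apply M rfl, hx]
      rfl)
    refine ⟨TotCh.mk y, TotCh.ext fun n j => ?_⟩
    obtain ⟨l, rfl⟩ : ∃ l, n = l + 1 := ⟨n - 1, by lia⟩
    rw [totD_apply M rfl]
    exact hy l j
  · intro h l n m hl hm j x hx
    obtain ⟨y, hy⟩ := h (totSingle M n j x) (TotCh.ext fun n' j' => by
      rw [totD_apply M (show n' - 1 + 1 = n' by lia)]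
      by_cases e : n = n' - 1 ∧ j = j'
      · obtain ⟨rfl, rfl⟩ := e
        obtain rfl : n' = m := by lia
        rw [totSingle_self, hx]
        rfl
      · rw [totSingle_of_ne M n j x e, map_zero]
        rfl)
    refine ⟨y l j, ?_⟩
    rw [← totD_apply M hl, hy, totSingle_self]

end Exactness

end GrMod

-- In the homotopy category quasi-isomorphisms are the maps whose cone lies in the triangulated
-- subcategory of acyclic complexes, and the mapping cone completes `φ` to a distinguished triangle.
open CochainComplex in
lemma CochainComplex.quasiIso_iff_acyclic_mappingCone {C : Type*} [Category C] [Abelian C]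
    {K L : CochainComplex C ℤ} (φ : K ⟶ L) :
    HomologicalComplex.quasiIso C (ComplexShape.up ℤ) φ ↔ (mappingCone φ).Acyclic := by
  rw [← HomotopyCategory.quotient_map_mem_quasiIso_iff,
    HomotopyCategory.quasiIso_eq_trW_subcategoryAcyclic,
    ← HomotopyCategory.quotient_obj_mem_subcategoryAcyclic_iff_acyclic]
  exact (HomotopyCategory.subcategoryAcyclic C).trW_iff_of_distinguished _
    (HomotopyCategory.mappingCone_triangleh_distinguished φ)

namespace GrMod

variable {A : Type u} [CommRing A] {𝒜 : ℤ → AddSubgroup A} [GradedRing 𝒜]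

lemma app_add_apply {M N : GrMod 𝒜} (f g : M ⟶ N) (j : ℤ) (x : M.obj j) :
    app (f + g) j x = app f j x + app g j x := rfl

lemma app_zero_apply {M N : GrMod 𝒜} (j : ℤ) (x : M.obj j) : app (0 : M ⟶ N) j x = 0 := rfl

/-- The additive map `f ↦ app f j x`. -/
def appHom (M N : GrMod 𝒜) (j : ℤ) (x : M.obj j) : (M ⟶ N) →+ N.obj j :=
  AddMonoidHom.mk' (fun f => app f j x) (fun _ _ => rfl)

lemma app_intUnits_smul {M N : GrMod 𝒜} (e : ℤˣ) (f : M ⟶ N) (j : ℤ) (x : M.obj j) :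
    app (e • f) j x = e • app f j x := by
  rcases Int.units_eq_one_or e with rfl | rfl <;> simp [Units.neg_smul]

lemma app_zsmul {M N : GrMod 𝒜} (e : ℤ) (f : M ⟶ N) (j : ℤ) (x : M.obj j) :
    app (e • f) j x = e • app f j x :=
  map_zsmul (appHom M N j x) e f

lemma app_sum {M N : GrMod 𝒜} {ι : Type*} (s : Finset ι) (f : ι → (M ⟶ N)) (j : ℤ)
    (x : M.obj j) : app (∑ i ∈ s, f i) j x = ∑ i ∈ s, app (f i) j x :=
  map_sum (appHom M N j x) f s

/-- The components of a product of graded modules. -/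
lemma bijective_of_isLimit {ι : Type} {X : ι → GrMod 𝒜} {c : Fan X} (hc : IsLimit c) (j : ℤ) :
    Function.Bijective (fun (x : c.pt.obj j) (i : ι) => app (c.proj i) j x) := by
  let π : ∀ i, prod X ⟶ X i := fun t => mkHom (fun j => Pi.evalAddMonoidHom _ t) (fun _ _ _ => rfl)
  let φ : prod X ⟶ c.pt := Fan.IsLimit.lift hc π
  let ψ : c.pt ⟶ prod X := mkHom (fun j => AddMonoidHom.mk'
      (fun x t => app (c.proj t) j x) (fun x y => funext fun t => map_add (app (c.proj t) j) x y))
    (fun h a x => funext fun t => app_smul (c.proj t) h a x)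
  have h1 : ψ ≫ φ = 𝟙 _ := by
    refine Fan.IsLimit.hom_ext hc _ _ fun i => ?_
    rw [Category.assoc, Category.id_comp]
    exact congrArg (fun z => ψ ≫ z) (Fan.IsLimit.fac hc π i)
  refine Function.bijective_iff_has_inverse.2 ⟨fun x => app φ j x, fun x => ?_, fun x => ?_⟩
  · exact DFunLike.congr_fun (congrFun (congrArg app h1) j) x
  · funext i
    exact DFunLike.congr_fun (congrFun (congrArg app (Fan.IsLimit.fac hc π i)) j) x

/-- The shift reindexes the terms and multiplies the differential by a global sign. This passes from
the cone to the cocone. -/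
lemma acyclic_shift_iff (M : CochainComplex (GrMod 𝒜) ℤ) (s : ℤ) :
    (M⟦s⟧).Acyclic ↔ M.Acyclic := by
  rw [acyclic_iff, acyclic_iff]
  have hd : ∀ n m j (x : (M.X (n + s)).obj j), app ((M⟦s⟧).d n m) j x =
      s.negOnePow • app (M.d (n + s) (m + s)) j x := fun n m j x => by
    rw [← app_intUnits_smul]
    rfl
  have hu : ∀ {G : Type u} [AddCommGroup G] (x : G), s.negOnePow • s.negOnePow • x = x :=
    fun x => by rw [smul_smul, Int.units_mul_self, _root_.one_smul]
  have hs : ∀ {G H : Type u} [AddCommGroup G] [AddCommGroup H] (g : G →+ H) (x : G),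
      g (s.negOnePow • x) = s.negOnePow • g x := fun g x => by
    rcases Int.units_eq_one_or s.negOnePow with e | e <;> simp [e, Units.neg_smul]
  constructor
  · intro h l n m hl hm j x hx
    obtain ⟨l, rfl⟩ : ∃ l', l = l' + s := ⟨l - s, by lia⟩
    obtain ⟨n, rfl⟩ : ∃ l', n = l' + s := ⟨n - s, by lia⟩
    obtain ⟨m, rfl⟩ : ∃ l', m = l' + s := ⟨m - s, by lia⟩
    obtain ⟨y, hy⟩ := h l n m (by lia) (by lia) j x
      ((hd n m j x).trans (by rw [hx]; exact _root_.smul_zero (M := ℤˣ) (A := (M.X (m + s)).obj j) _))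
    exact ⟨s.negOnePow • y, (hs _ _).trans ((hd l n j y).symm.trans hy)⟩
  · intro h l n m hl hm j x hx
    obtain ⟨y, hy⟩ := h (l + s) (n + s) (m + s) (by lia) (by lia) j x
      ((hu _).symm.trans ((congrArg (s.negOnePow • ·) ((hd n m j x).symm.trans hx)).trans
        (_root_.smul_zero (M := ℤˣ) (A := (M.X (m + s)).obj j) _)))
    refine ⟨s.negOnePow • y, (hd l n j _).trans ((congrArg (s.negOnePow • ·) (hs _ y)).trans
      ((hu _).trans hy))⟩

/-! ### Mapping cones in components. -/

section Cone

open CochainComplex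

variable {K L : CochainComplex (GrMod 𝒜) ℤ} (φ : K ⟶ L)

/-- The components of an element of the mapping cone. -/
def totCone : TotCh (mappingCone φ) →ₗ[A] TotCh K × TotCh L :=
  LinearMap.prod
    (LinearMap.pi fun n => Tot.map ((mappingCone.fst φ).1.v (n - 1) n (by lia)) ∘ₗ
      LinearMap.proj (n - 1))
    (LinearMap.pi fun n => Tot.map ((mappingCone.snd φ).v n n (add_zero n)) ∘ₗ LinearMap.proj n)

lemma totCone_fst (x : TotCh (mappingCone φ)) {m n : ℤ} (h : m + 1 = n) (j : ℤ) :
    (totCone φ x).1 n j = app ((mappingCone.fst φ).1.v m n h) j (x m j) := by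
  obtain rfl : m = n - 1 := by lia
  rfl

lemma totCone_snd (x : TotCh (mappingCone φ)) (n j : ℤ) :
    (totCone φ x).2 n j = app ((mappingCone.snd φ).v n n (add_zero n)) j (x n j) := rfl

lemma app_cone_eq {i j : ℤ} (h : i + 1 = j) (t : ℤ) (x : ((mappingCone φ).X i).obj t) :
    app ((mappingCone.inl φ).v j i (by lia)) t (app ((mappingCone.fst φ).1.v i j h) t x) +
      app ((mappingCone.inr φ).f i) t (app ((mappingCone.snd φ).v i i (add_zero i)) t x) = x :=
  congrArg (fun z => app z t x) (mappingCone.id_X φ i j h)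

lemma app_cone_d_fst {i j k : ℤ} (h : i + 1 = j) (h' : j + 1 = k) (t : ℤ)
    (x : ((mappingCone φ).X i).obj t) :
    app ((mappingCone.fst φ).1.v j k h') t (app ((mappingCone φ).d i j) t x) =
      -app (K.d j k) t (app ((mappingCone.fst φ).1.v i j h) t x) :=
  congrArg (fun z => app z t x) (mappingCone.d_fst_v φ i j k h h')

lemma app_cone_d_snd {i j : ℤ} (h : i + 1 = j) (t : ℤ) (x : ((mappingCone φ).X i).obj t) :
    app ((mappingCone.snd φ).v j j (add_zero j)) t (app ((mappingCone φ).d i j) t x) =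
      app (φ.f j) t (app ((mappingCone.fst φ).1.v i j h) t x) +
        app (L.d i j) t (app ((mappingCone.snd φ).v i i (add_zero i)) t x) :=
  congrArg (fun z => app z t x) (mappingCone.d_snd_v φ i j h)

lemma bijective_totCone : Function.Bijective (totCone φ) := by
  constructor
  · refine (injective_iff_map_eq_zero _).2 fun x hx => TotCh.ext fun n j => ?_
    have e1 : app ((mappingCone.fst φ).1.v n (n + 1) rfl) j (x n j) = 0 :=
      (totCone_fst φ x (rfl : n + 1 = n + 1) j).symm.trans
        (congrArg (fun z => z.1 (n + 1) j) hx)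
    have e2 : app ((mappingCone.snd φ).v n n (add_zero n)) j (x n j) = 0 :=
      (totCone_snd φ x n j).symm.trans (congrArg (fun z => z.2 n j) hx)
    rw [← app_cone_eq φ (rfl : n + 1 = n + 1) j (x n j), e1, e2, map_zero, map_zero, add_zero]
    rfl
  · rintro ⟨x, y⟩
    refine ⟨TotCh.mk fun n j => app ((mappingCone.inl φ).v (n + 1) n (by lia)) j (x (n + 1) j) +
      app ((mappingCone.inr φ).f n) j (y n j), Prod.ext (TotCh.ext fun n j => ?_)
      (TotCh.ext fun n j => ?_)⟩
    · obtain ⟨n, rfl⟩ : ∃ m, n = m + 1 := ⟨n - 1, by lia⟩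
      rw [totCone_fst φ _ rfl, TotCh.mk_apply, map_add, ← app_comp, ← app_comp,
        mappingCone.inl_v_fst_v, mappingCone.inr_f_fst_v, app_id, app_zero_apply, add_zero]
    · rw [totCone_snd, TotCh.mk_apply, map_add, ← app_comp, ← app_comp,
        mappingCone.inl_v_snd_v, mappingCone.inr_f_snd_v, app_id, app_zero_apply, zero_add]

lemma totCone_totD (x : TotCh (mappingCone φ)) :
    totCone φ (totD _ x) = DiffMod.coneD (totD K) (totD L) (totMap φ) (totCone φ x) := by
  refine Prod.ext (TotCh.ext fun n j => ?_) (TotCh.ext fun n j => ?_)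
  · rw [totCone_fst φ _ (show n - 1 + 1 = n by lia),
      totD_apply _ (show n - 1 - 1 + 1 = n - 1 by lia), app_cone_d_fst φ (by lia) (by lia),
      ← totCone_fst, ← totD_apply K (show n - 1 + 1 = n by lia)]
    rfl
  · rw [totCone_snd, totD_apply _ (show n - 1 + 1 = n by lia), app_cone_d_snd φ (by lia),
      ← totCone_fst, ← totCone_snd, ← totD_apply L (show n - 1 + 1 = n by lia), ← totMap_apply]
    rfl

lemma acyclic_mappingCone_iff : (mappingCone φ).Acyclic ↔
    DiffMod.Qis (totD K) (totD L) (totMap φ) := by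
  rw [acyclic_iff_acyc, DiffMod.qis_iff_acyc_coneD]
  exact DiffMod.acyc_of_bijective (totCone_totD φ) (bijective_totCone φ)

/-- This transfers all questions on quasi-isomorphisms of complexes to differential modules. -/
lemma quasiIso_iff_qis : HomologicalComplex.quasiIso (GrMod 𝒜) (ComplexShape.up ℤ) φ ↔
    DiffMod.Qis (totD K) (totD L) (totMap φ) := by
  rw [quasiIso_iff_acyclic_mappingCone, acyclic_mappingCone_iff]

lemma acyclic_mappingCocone_iff : (mappingCocone φ).Acyclic ↔
    DiffMod.Qis (totD K) (totD L) (totMap φ) := by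
  rw [← acyclic_mappingCone_iff]
  exact acyclic_shift_iff _ _

end Cone

end GrMod

/-! ### The complex `T M a` as maps out of the telescope. -/

namespace DiffMod

/-- Scalars play no role in `Qis`, so the comparison maps need only be additive and the two base
rings may differ. -/
lemma qis_iff_of_bijective {R S : Type*} [CommRing R] [CommRing S] {X Y X' Y' : Type*}
    [AddCommGroup X] [AddCommGroup Y] [AddCommGroup X'] [AddCommGroup Y'] [Module R X] [Module R Y]
    [Module S X'] [Module S Y'] {dX : X →ₗ[R] X} {dY : Y →ₗ[R] Y} {g : X →ₗ[R] Y}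
    {dX' : X' →ₗ[S] X'} {dY' : Y' →ₗ[S] Y'} {g' : X' →ₗ[S] Y'} {e : X →+ X'} {e' : Y →+ Y'}
    (he : Function.Bijective e) (he' : Function.Bijective e') (hX : ∀ x, e (dX x) = dX' (e x))
    (hY : ∀ y, e' (dY y) = dY' (e' y)) (hg : ∀ x, e' (g x) = g' (e x)) :
    Qis dX dY g ↔ Qis dX' dY' g' := by
  constructor
  · intro h x y hx hy
    obtain ⟨x, rfl⟩ := he.2 x
    obtain ⟨y, rfl⟩ := he'.2 y
    obtain ⟨p, q, hp, hq⟩ := h x y (he.1 (by rw [hX, hx, map_zero])) (he'.1 (by rw [hY, hg, hy]))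
    exact ⟨e p, e' q, by rw [← hX, hp], by rw [← hg, ← hY, ← map_add, hq]⟩
  · intro h x y hx hy
    obtain ⟨p, q, hp, hq⟩ := h (e x) (e' y) (by rw [← hX, hx, map_zero]) (by rw [← hY, ← hg, hy])
    obtain ⟨p, rfl⟩ := he.2 p
    obtain ⟨q, rfl⟩ := he'.2 q
    exact ⟨p, q, he.1 (by rw [hX, hp]), he'.1 (by rw [map_add, hg, hY, hq])⟩

/-- Up to the sign of the `inl` entries, `locD` is the differential of the cocone of `id - a *
shift`. -/
lemma qis_shiftMap_iff {R : Type*} [CommRing R] {X : Type*} [AddCommGroup X] [Module R X]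
    (d : X →ₗ[R] X) (a : R) :
    Qis (LinearMap.pi fun k : ℕ => d ∘ₗ LinearMap.proj k)
      (LinearMap.pi fun k : ℕ => d ∘ₗ LinearMap.proj k) (shiftMap a X) ↔ Acyc (locD a d) := by
  constructor
  · intro h z hz
    obtain ⟨p, q, hp, hq⟩ := h (fun k => z (.inr k)) (fun k => z (.inl k))
      (funext fun k => (locD_inr z k).symm.trans (congrFun hz _))
      (funext fun k => (sub_eq_zero.1 ((locD_inl z k).symm.trans (congrFun hz _))).symm)
    refine ⟨Sum.elim (-q) p, funext ?_⟩
    rintro (k | k)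
    · rw [locD_inl]
      refine Eq.trans ?_ (congrFun hq k)
      simp [shiftMap]
    · rw [locD_inr]
      exact congrFun hp k
  · intro h x y hx hy
    obtain ⟨z, hz⟩ := h (Sum.elim y x) (by
      funext t
      rcases t with k | k
      · rw [locD_inl]
        exact sub_eq_zero.2 (congrFun hy k).symm
      · rw [locD_inr]
        exact congrFun hx k)
    refine ⟨fun k => z (.inr k), fun k => -z (.inl k), funext fun k => ?_, funext fun k => ?_⟩
    · exact (locD_inr z k).symm.trans (congrFun hz _)
    · refine Eq.trans ?_ ((locD_inl z k).symm.trans (congrFun hz _))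
      simp [shiftMap, sub_eq_add_neg]

end DiffMod

namespace GrMod

variable {A : Type u} [CommRing A] {𝒜 : ℤ → AddSubgroup A} [GradedRing 𝒜]
  (M : CochainComplex (GrMod 𝒜) ℤ) {m : ℤ} (a : 𝒜 m)

/-- The components of an element of the product of the twists `M(-km)`. -/
def twistProd (m : ℤ) : TotCh (∏ᶜ fun k : ℕ => (twistCh (-(k * m))).obj M) →+ (ℕ → TotCh M) :=
  AddMonoidHom.mk' (fun w k => TotCh.mk fun n j => (M.X n).tr (show -(k * m) + (j + k * m) = j by ring)
      (app ((Pi.π (fun k : ℕ => (twistCh (-(k * m))).obj M) k).f n) (j + k * m) (w n (j + k * m))))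
    (fun w w' => funext fun k => TotCh.ext fun n j => by
      refine Eq.trans ?_ (map_add ((M.X n).tr _) _ _)
      exact congrArg ((M.X n).tr _) (map_add (app (N := ((twistCh (-(k * m))).obj M).X n) _ _) _ _))

lemma twistProd_apply (w : TotCh (∏ᶜ fun k : ℕ => (twistCh (-(k * m))).obj M)) (k : ℕ) (n : ℤ)
    {j' j : ℤ} (h : -(k * m) + j' = j) :
    twistProd M m w k n j = (M.X n).tr h
      (app ((Pi.π (fun k : ℕ => (twistCh (-(k * m))).obj M) k).f n) j' (w n j')) := by
  obtain rfl : j' = j + k * m := by lia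
  rfl

lemma bijective_twistProd : Function.Bijective (twistProd M m) := by
  -- Products of complexes are computed termwise, and those of graded modules degreewise.
  have hb : ∀ n j, Function.Bijective
      (fun (x : ((∏ᶜ fun k : ℕ => (twistCh (-(k * m))).obj M).X n).obj j) (k : ℕ) =>
      app ((Pi.π (fun k : ℕ => (twistCh (-(k * m))).obj M) k).f n) j x) := fun n j =>
    bijective_of_isLimit (isLimitFanMkObjOfIsLimit
      (HomologicalComplex.eval (GrMod 𝒜) (ComplexShape.up ℤ) n) _ _
      (productIsProduct (fun k : ℕ => (twistCh (-(k * m))).obj M))) j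
  constructor
  · refine fun w w' hw => TotCh.ext fun n j => (hb n j).1 (funext fun k => ?_)
    have := congrArg (fun z : ℕ → TotCh M => z k n (-(k * m) + j)) hw
    simp only [twistProd_apply M _ k n rfl] at this
    exact this
  · intro z
    choose w hw using fun n j => (hb n j).2 fun k => z k n (-(k * m) + j)
    refine ⟨TotCh.mk w, funext fun k => TotCh.ext fun n j => ?_⟩
    rw [twistProd_apply M _ k n (show -(k * m) + (j + k * m) = j by ring)]
    have e : ∀ j' (h : -(k * m) + j' = j), (M.X n).tr h (z k n (-(k * m) + j')) = z k n j := by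
      rintro j' rfl
      rfl
    exact (congrArg ((M.X n).tr _) (congrFun (hw n (j + k * m)) k)).trans (e _ _)

lemma app_f_d {K L : CochainComplex (GrMod 𝒜) ℤ} (g : K ⟶ L) (n n' j : ℤ) (x : (K.X n).obj j) :
    app (g.f n') j (app (K.d n n') j x) = app (L.d n n') j (app (g.f n) j x) :=
  (congrArg (fun z => app z j x) (g.comm n n')).symm

lemma twistProd_totD (w : TotCh (∏ᶜ fun k : ℕ => (twistCh (-(k * m))).obj M)) (k : ℕ) :
    twistProd M m (totD _ w) k = totD M (twistProd M m w k) := by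
  refine TotCh.ext fun n j => ?_
  have h : -(k * m) + (j + k * m) = j := by ring
  rw [twistProd_apply M _ k n h, totD_apply _ (show n - 1 + 1 = n by lia),
    totD_apply _ (show n - 1 + 1 = n by lia), twistProd_apply M _ k _ h, app_f_d]
  exact (app_tr (M.d (n - 1) n) h _).symm

lemma app_holimMap (k : ℕ) (n j : ℤ)
    (x : ((∏ᶜ fun k : ℕ => (twistCh (-(k * m))).obj M).X n).obj j)
    (h : ∀ k : ℕ, m + -(((k + 1 : ℕ) : ℤ) * m) = -(k * m)) :
    app ((Pi.π (fun k : ℕ => (twistCh (-(k * m))).obj M) k).f n) j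
      (app ((holimMap (fun k : ℕ => (twistCh (-(k * m))).obj M) fun k => mulCh M (h k) a).f n) j x) =
    app ((Pi.π (fun k : ℕ => (twistCh (-(k * m))).obj M) k).f n) j x -
      app ((mulCh M (h k) a).f n) j
        (app ((Pi.π (fun k : ℕ => (twistCh (-(k * m))).obj M) (k + 1)).f n) j x) := by
  have e : holimMap (fun k : ℕ => (twistCh (-(k * m))).obj M) (fun k => mulCh M (h k) a) ≫
      Pi.π (fun k : ℕ => (twistCh (-(k * m))).obj M) k =
      Pi.π (fun k : ℕ => (twistCh (-(k * m))).obj M) k -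
        Pi.π (fun k : ℕ => (twistCh (-(k * m))).obj M) (k + 1) ≫ mulCh M (h k) a :=
    Pi.lift_π _ _
  exact congrArg (fun z => app (HomologicalComplex.Hom.f z n) j x) e

lemma twistProd_holimMap (w : TotCh (∏ᶜ fun k : ℕ => (twistCh (-(k * m))).obj M)) (k : ℕ)
    (h : ∀ k : ℕ, m + -(((k + 1 : ℕ) : ℤ) * m) = -(k * m)) :
    twistProd M m (totMap (holimMap (fun k : ℕ => (twistCh (-(k * m))).obj M)
      fun k => mulCh M (h k) a) w) k = twistProd M m w k - (a : A) • twistProd M m w (k + 1) := by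
  refine TotCh.ext fun n j => ?_
  have e : -(k * m) + (j + k * m) = j := by ring
  rw [twistProd_apply M _ k n e, totMap_apply, app_holimMap]
  refine (((M.X n).tr e).map_sub _ _).trans ?_
  refine congrArg₂ (· - ·) (twistProd_apply M w k n e).symm ?_
  refine Eq.trans ?_ (Tot.smul_apply (M.X n) (show m + (j - m) = j by lia) a _).symm
  rw [twistProd_apply M w (k + 1) n (show -(((k + 1 : ℕ) : ℤ) * m) + (j + k * m) = j - m by
    push_cast; ring)]
  exact (tr_smul (M.X n) _ _ _ _).trans (smul_tr (M.X n) _ _ _ _).symm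

/-- Once the factors `M(-km)` are untwisted by `twistProd`, the map defining the homotopy limit
becomes `id - a * shift` on sequences in `TotCh M`. -/
lemma acyclic_T_iff : (T M a).Acyclic ↔ DiffMod.Acyc (DiffMod.locD (a : A) (totD M)) := by
  rw [← DiffMod.qis_shiftMap_iff]
  exact (acyclic_mappingCocone_iff _).trans (DiffMod.qis_iff_of_bijective
    (bijective_twistProd M (m := m)) (bijective_twistProd M (m := m))
    (fun w => funext fun k => twistProd_totD M w k) (fun w => funext fun k => twistProd_totD M w k)
    (fun w => funext fun k => twistProd_holimMap M a w k _))

end GrMod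

/-! ### Inclusions of the factors of a cubical complex. -/

section Cube

variable {C : Type*} [Category C] [Preadditive C] [HasFiniteProducts C] {r : ℕ}
  (F : Finset (Fin r) ⥤ C)

/-- The inclusion of a factor in `cubeX F p`. -/
def cubeInc (p : ℤ) (S : Finset (Fin r)) : F.obj S ⟶ cubeX F p :=
  Pi.lift fun T => if e : S = T.1 then eqToHom (congrArg F.obj e) else 0

lemma cubeInc_π_self (p : ℤ) (S : Finset (Fin r)) (h : (S.card : ℤ) = p) :
    cubeInc F p S ≫ cubeπ F p S = 𝟙 _ := by
  simp [cubeInc, cubeπ, h]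

lemma cubeInc_π_of_ne (p : ℤ) {S T : Finset (Fin r)} (h : S ≠ T) :
    cubeInc F p S ≫ cubeπ F p T = 0 := by
  by_cases hT : (T.card : ℤ) = p
  · simp [cubeInc, cubeπ, hT, h]
  · simp [cubeπ, hT]

lemma cubeX_hom_ext {p : ℤ} {Z : C} {f g : Z ⟶ cubeX F p}
    (h : ∀ U : Finset (Fin r), (U.card : ℤ) = p → f ≫ cubeπ F p U = g ≫ cubeπ F p U) : f = g :=
  Pi.hom_ext _ _ fun ⟨U, hU⟩ => by
    have := h U hU
    rwa [cubeπ, dif_pos hU] at this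

lemma sum_cubeπ_cubeInc (p : ℤ) : ∑ S, cubeπ F p S ≫ cubeInc F p S = 𝟙 _ := by
  refine cubeX_hom_ext F fun U hU => ?_
  rw [Preadditive.sum_comp, Finset.sum_eq_single U, Category.assoc, cubeInc_π_self F p U hU,
    Category.comp_id, Category.id_comp]
  · intro S _ hS
    rw [Category.assoc, cubeInc_π_of_ne F p hS, comp_zero]
  · simp

/-- The Čech differential is defined by its components into each factor; the products being finite,
it can be read out of each factor instead, which yields the rows of its matrix. -/
lemma cubeInc_cubeD {p q : ℤ} (h : p + 1 = q) (S : Finset (Fin r)) (hS : (S.card : ℤ) = p) :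
    cubeInc F p S ≫ cubeD F p q = ∑ i ∈ Sᶜ, cubeSign (insert i S) i •
      (F.map (homOfLE (Finset.subset_insert i S)) ≫ cubeInc F q (insert i S)) := by
  refine cubeX_hom_ext F fun U hU => ?_
  rw [Category.assoc, cubeD_π F p q h U hU, Preadditive.comp_sum, Preadditive.sum_comp]
  by_cases hi : ∃ i ∈ Sᶜ, insert i S = U
  · obtain ⟨i, hi, rfl⟩ := hi
    have hi' : i ∉ S := Finset.mem_compl.1 hi
    rw [Finset.sum_eq_single i, Finset.sum_eq_single i]
    · rw [Preadditive.zsmul_comp, Preadditive.comp_zsmul, Category.assoc, cubeInc_π_self F q _ hU,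
        Category.comp_id]
      have ht : ∀ (V : Finset (Fin r)) (hV : S = V) (hVU : V ⊆ insert i S),
          cubeInc F p S ≫ cubeπ F p V ≫ F.map (homOfLE hVU) =
            F.map (homOfLE (Finset.subset_insert i S)) := by
        rintro V rfl hV
        rw [← Category.assoc, cubeInc_π_self F p S hS, Category.id_comp]
      rw [ht _ (Finset.erase_insert hi').symm]
    · intro j hj hji
      rw [Preadditive.zsmul_comp, Category.assoc, cubeInc_π_of_ne, comp_zero, smul_zero]
      intro e
      have := e ▸ Finset.mem_insert_self j S
      exact (Finset.mem_insert.1 this).elim hji (Finset.mem_compl.1 hj)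
    · exact fun h => absurd hi h
    · intro j hj hji
      rw [Preadditive.comp_zsmul, ← Category.assoc, cubeInc_π_of_ne, zero_comp, smul_zero]
      intro e
      have : j ∈ S := (Finset.mem_insert.1 hj).resolve_left hji
      rw [e] at this
      exact (Finset.notMem_erase j _) this
    · simp
  · push Not at hi
    rw [Finset.sum_eq_zero, Finset.sum_eq_zero]
    · intro j hj
      rw [Preadditive.zsmul_comp, Category.assoc, cubeInc_π_of_ne F q (hi j hj), comp_zero,
        smul_zero]
    · intro j hj
      rw [Preadditive.comp_zsmul, ← Category.assoc, cubeInc_π_of_ne, zero_comp, smul_zero]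
      intro e
      refine hi j ?_ ?_
      · rw [Finset.mem_compl, e]
        exact Finset.notMem_erase j U
      · rw [e, Finset.insert_erase hj]

end Cube

namespace CochainComplex.mappingCone

variable {C : Type*} [Category C] [Preadditive C] [HasBinaryBiproducts C]
  {K₁ L₁ K₂ L₂ : CochainComplex C ℤ} (φ₁ : K₁ ⟶ L₁) (φ₂ : K₂ ⟶ L₂) (a : K₁ ⟶ K₂) (b : L₁ ⟶ L₂)
  (comm : φ₁ ≫ b = a ≫ φ₂)

lemma inl_v_map (p q : ℤ) (h : p + (-1) = q) :
    (inl φ₁).v p q h ≫ (map φ₁ φ₂ a b comm).f q = a.f p ≫ (inl φ₂).v p q h := by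
  simp [map]

lemma inr_f_map (p : ℤ) :
    (inr φ₁).f p ≫ (map φ₁ φ₂ a b comm).f p = b.f p ≫ (inr φ₂).f p := by
  simp [map]

end CochainComplex.mappingCone

/-! ### Free graded modules and the generators of `loc a`. -/

namespace GrMod

variable {A : Type u} [CommRing A] {𝒜 : ℤ → AddSubgroup A} [GradedRing 𝒜]

lemma smul_one_eq (P : GrMod 𝒜) {i j : ℤ} (h : i + j = j) (a : 𝒜 i) (ha : (a : A) = 1)
    (x : P.obj j) : P.smul h a x = x := by
  obtain rfl : i = 0 := by lia
  obtain rfl : a = ⟨1, SetLike.GradedOne.one_mem⟩ := Subtype.ext ha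
  exact P.one_smul j x

/-- The generator of `A(n)`. -/
def twistGen {n t : ℤ} (h : n + t = 0) : ((twist n).obj (self 𝒜)).obj t :=
  (⟨1, h ▸ SetLike.GradedOne.one_mem⟩ : 𝒜 (n + t))

/-- The module `A(n)` is free on one generator, of degree `-n`. -/
lemma twistGen_hom_ext {n t : ℤ} (h : n + t = 0) {P : GrMod 𝒜}
    {g g' : (twist n).obj (self 𝒜) ⟶ P} (e : app g t (twistGen h) = app g' t (twistGen h)) :
    g = g' := by
  ext j (x : 𝒜 (n + j))
  have hx : x = ((twist n).obj (self 𝒜)).smul (show n + j + t = j by lia) x (twistGen h) :=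
    Subtype.ext (mul_one (x : A)).symm
  rw [hx, app_smul, app_smul, e]

/-- The morphism `A(n) ⟶ P` sending the generator to `y`. -/
def twistDesc {n t : ℤ} (h : n + t = 0) {P : GrMod 𝒜} (y : P.obj t) :
    (twist n).obj (self 𝒜) ⟶ P :=
  mkHom (fun j => AddMonoidHom.mk' (fun x : 𝒜 (n + j) => P.smul (show n + j + t = j by lia) x y)
      (fun a b => DFunLike.congr_fun (map_add (P.smul (show n + j + t = j by lia)) a b) y))
    (fun _ a b => P.mul_smul _ _ _ a b _ y rfl)

lemma twistDesc_gen {n t : ℤ} (h : n + t = 0) {P : GrMod 𝒜} (y : P.obj t) :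
    app (twistDesc h y) t (twistGen h) = y :=
  P.smul_one_eq _ _ rfl y

/-- A family of homogeneous elements of a sequence of graded modules is a basis. -/
def IsBasis (K : ℤ → GrMod 𝒜) {J : Type*} {p t : J → ℤ} (e : ∀ s, (K (p s)).obj (t s)) : Prop :=
  ∀ (N : ℤ → GrMod 𝒜) (y : ∀ s, (N (p s)).obj (t s)),
    ∃! g : ∀ n, K n ⟶ N n, ∀ s, app (g (p s)) (t s) (e s) = y s

section Loc

open CochainComplex

variable {m : ℤ} (a : 𝒜 m)

/-- The cohomological degree of a generator of `loc a`. -/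
def locDeg : ℕ ⊕ ℕ → ℤ := Sum.elim (fun _ => -1) (fun _ => 0)

/-- The position of a generator of `loc a` in the sequence. -/
def locPos : ℕ ⊕ ℕ → ℕ := Sum.elim id id

/-- The term of degree `0` of a complex concentrated in degree `0`. -/
def singleIso (Y : GrMod 𝒜) : Y ≅ ((singleFunctor (GrMod 𝒜) 0).obj Y).X 0 :=
  (HomologicalComplex.singleObjXSelf (ComplexShape.up ℤ) 0 Y).symm

lemma singleIso_hom_naturality {Y Y' : GrMod 𝒜} (g : Y ⟶ Y') :
    (singleIso Y).hom ≫ ((singleFunctor (GrMod 𝒜) 0).map g).f 0 = g ≫ (singleIso Y').hom := by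
  refine (congrArg (fun z => (singleIso Y).hom ≫ z)
    (HomologicalComplex.single_map_f_self (ComplexShape.up ℤ) 0 g)).trans ?_
  exact Iso.inv_hom_id_assoc _ _

/-- The generator of the `k`-th summand. -/
def sigmaGen (m : ℤ) (k : ℕ) {t : ℤ} (h : k * m + t = 0) : ((∐ locX 𝒜 m).X 0).obj t :=
  app ((Sigma.ι (locX 𝒜 m) k).f 0) t
    (app (singleIso ((twist (k * m)).obj (self 𝒜))).hom t (twistGen h))

lemma sigma_hom_ext {n : ℤ} {P : GrMod 𝒜} {f g : (∐ locX 𝒜 m).X n ⟶ P}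
    (h : ∀ k, (Sigma.ι (locX 𝒜 m) k).f n ≫ f = (Sigma.ι (locX 𝒜 m) k).f n ≫ g) : f = g :=
  Cofan.IsColimit.hom_ext (isColimitCofanMkObjOfIsColimit
      (HomologicalComplex.eval (GrMod 𝒜) (ComplexShape.up ℤ) n) _ _
      (coproductIsCoproduct (locX 𝒜 m))) _ _ h

lemma sigma_hom_ext_of_ne {n : ℤ} (hn : n ≠ 0) {P : GrMod 𝒜} (f g : (∐ locX 𝒜 m).X n ⟶ P) :
    f = g := by
  refine sigma_hom_ext fun k => ?_
  exact (HomologicalComplex.isZero_single_obj_X (ComplexShape.up ℤ) 0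
    ((twist (k * m)).obj (self 𝒜)) n hn).eq_of_src _ _

lemma sigma_hom_ext_gen {P : GrMod 𝒜} {f g : (∐ locX 𝒜 m).X 0 ⟶ P}
    (h : ∀ k t (ht : (k : ℕ) * m + t = 0), app f t (sigmaGen m k ht) = app g t (sigmaGen m k ht)) :
    f = g := by
  refine sigma_hom_ext fun k => ?_
  rw [← cancel_epi (singleIso ((twist (k * m)).obj (self 𝒜))).hom]
  exact twistGen_hom_ext (add_neg_cancel (k * m)) (h k _ (add_neg_cancel (k * m)))

lemma exists_sigma_desc {P : GrMod 𝒜} (y : ∀ k : ℕ, P.obj (-(k * m))) :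
    ∃ f : (∐ locX 𝒜 m).X 0 ⟶ P, ∀ k : ℕ, app f _ (sigmaGen m k (add_neg_cancel (k * m))) = y k := by
  let hc := isColimitCofanMkObjOfIsColimit
      (HomologicalComplex.eval (GrMod 𝒜) (ComplexShape.up ℤ) 0) _ _
      (coproductIsCoproduct (locX 𝒜 m))
  let φ : ∀ k, (locX 𝒜 m k).X 0 ⟶ P := fun k =>
    (singleIso ((twist (k * m)).obj (self 𝒜))).inv ≫ twistDesc (add_neg_cancel (k * m)) (y k)
  refine ⟨Cofan.IsColimit.desc hc φ, fun k => ?_⟩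
  have e : (singleIso ((twist (k * m)).obj (self 𝒜))).hom ≫ (Sigma.ι (locX 𝒜 m) k).f 0 ≫
      Cofan.IsColimit.desc hc φ = twistDesc (add_neg_cancel (k * m)) (y k) := by
    have e' : (Sigma.ι (locX 𝒜 m) k).f 0 ≫ Cofan.IsColimit.desc hc φ = φ k :=
      Cofan.IsColimit.fac hc φ k
    rw [e', Iso.hom_inv_id_assoc]
  exact (congrArg (fun z => app z _ (twistGen (add_neg_cancel (k * m)))) e).trans
    (twistDesc_gen _ _)

/-- The inclusion of the coproduct in degree `-1`. -/
def locInl : (∐ locX 𝒜 m).X 0 ⟶ (loc a).X (-1) :=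
  (mappingCone.inl (hocolimMap (locX 𝒜 m) (locStep a))).v 0 (-1) rfl

/-- The inclusion of the coproduct in degree `0`. -/
def locInr : (∐ locX 𝒜 m).X 0 ⟶ (loc a).X 0 :=
  (mappingCone.inr (hocolimMap (locX 𝒜 m) (locStep a))).f 0

/-- The generators of `loc a` in degree `-1`. -/
def locGenL (k : ℕ) : ((loc a).X (-1)).obj (-(k * m)) :=
  app (locInl a) _ (sigmaGen m k (add_neg_cancel (k * m)))

/-- The generators of `loc a` in degree `0`. -/
def locGenR (k : ℕ) : ((loc a).X 0).obj (-(k * m)) :=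
  app (locInr a) _ (sigmaGen m k (add_neg_cancel (k * m)))

/-- The generators of `loc a`. -/
def locGen : ∀ s : ℕ ⊕ ℕ, ((loc a).X (locDeg s)).obj (-(locPos s * m))
  | .inl k => locGenL a k
  | .inr k => locGenR a k

/-- The cone has two copies of the coproduct of the `A(km)`, in degrees `-1` and `0`, and each
summand is free on one generator. -/
lemma isBasis_locGen : IsBasis (fun n => (loc a).X n) (locGen a) := by
  intro N y
  obtain ⟨α, hα⟩ := exists_sigma_desc (m := m) (P := N (-1)) fun k => y (.inl k)
  obtain ⟨β, hβ⟩ := exists_sigma_desc (m := m) (P := N 0) fun k => y (.inr k)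
  let φ := hocolimMap (locX 𝒜 m) (locStep a)
  -- In the remaining degrees `loc a` has no generators, and the zero map is forced.
  let g : ∀ n, (loc a).X n ⟶ N n := fun n =>
    if h : n = -1 then (by
      subst h
      exact (mappingCone.fst φ).1.v (-1) 0 rfl ≫ α)
    else if h : n = 0 then (by
      subst h
      exact (mappingCone.snd φ).v 0 0 rfl ≫ β)
    else 0
  have hg1 : g (-1) = (mappingCone.fst φ).1.v (-1) 0 rfl ≫ α := dif_pos rfl
  have hg0 : g 0 = (mappingCone.snd φ).v 0 0 rfl ≫ β := (dif_neg (by lia)).trans (dif_pos rfl)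
  have hg : ∀ s, app (g (locDeg s)) _ (locGen a s) = y s := by
    rintro (k | k)
    · refine Eq.trans ?_ (hα k)
      have : (mappingCone.inl φ).v 0 (-1) rfl ≫ g (-1) = α := by
        rw [hg1, ← Category.assoc, mappingCone.inl_v_fst_v, Category.id_comp]
      exact congrArg (fun z => app z _ (sigmaGen m k (add_neg_cancel (k * m)))) this
    · refine Eq.trans ?_ (hβ k)
      have : (mappingCone.inr φ).f 0 ≫ g 0 = β := by
        rw [hg0, ← Category.assoc, mappingCone.inr_f_snd_v, Category.id_comp]
      exact congrArg (fun z => app z _ (sigmaGen m k (add_neg_cancel (k * m)))) this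
  refine ⟨g, hg, fun g' hg' => funext fun n => ?_⟩
  refine mappingCone.ext_from φ (n + 1) n rfl ?_ ?_
  · by_cases hn : n = -1
    · subst hn
      refine sigma_hom_ext_gen fun k t ht => ?_
      obtain rfl : t = -(k * m) := by lia
      exact (hg' (.inl k)).trans (hg (.inl k)).symm
    · exact sigma_hom_ext_of_ne (by lia) _ _
  · by_cases hn : n = 0
    · subst hn
      refine sigma_hom_ext_gen fun k t ht => ?_
      obtain rfl : t = -(k * m) := by lia
      exact (hg' (.inr k)).trans (hg (.inr k)).symm
    · exact sigma_hom_ext_of_ne hn _ _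

lemma app_locStep (k : ℕ) {t t' : ℤ} (h : k * m + t = 0) (h' : ((k + 1 : ℕ) : ℤ) * m + t' = 0)
    (ht : m + t' = t) : app ((locStep a k).f 0) t (app (singleIso _).hom t (twistGen h)) =
      ((locX 𝒜 m (k + 1)).X 0).smul ht a (app (singleIso _).hom t' (twistGen h')) := by
  rw [← app_smul, ← app_comp, singleIso_hom_naturality, app_comp]
  exact congrArg (app (singleIso ((twist (((k + 1 : ℕ) : ℤ) * m)).obj (self 𝒜))).hom t)
    (Subtype.ext rfl)

lemma app_hocolimMap_sigmaGen (k : ℕ) {t t' : ℤ} (h : k * m + t = 0)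
    (h' : ((k + 1 : ℕ) : ℤ) * m + t' = 0) (ht : m + t' = t) :
    app ((hocolimMap (locX 𝒜 m) (locStep a)).f 0) t (sigmaGen m k h) =
      sigmaGen m k h - ((∐ locX 𝒜 m).X 0).smul ht a (sigmaGen m (k + 1) h') := by
  have e : Sigma.ι (locX 𝒜 m) k ≫ hocolimMap (locX 𝒜 m) (locStep a) =
      Sigma.ι (locX 𝒜 m) k - locStep a k ≫ Sigma.ι (locX 𝒜 m) (k + 1) := Sigma.ι_desc _ _
  have e' := congrArg (fun z => app (HomologicalComplex.Hom.f z 0) t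
    (app (singleIso ((twist (k * m)).obj (self 𝒜))).hom t (twistGen h))) e
  refine e'.trans (congrArg (fun z => sigmaGen m k h - z) ?_)
  refine (congrArg (app ((Sigma.ι (locX 𝒜 m) (k + 1)).f 0) t) (app_locStep a k h h' ht)).trans ?_
  exact app_smul _ _ _ _

lemma locInr_d (n : ℤ) : locInr a ≫ (loc a).d 0 n = 0 := by
  refine (mappingCone.inr_f_d (hocolimMap (locX 𝒜 m) (locStep a)) 0 n).trans ?_
  by_cases hn : n = 0
  · subst hn
    rw [(∐ locX 𝒜 m).shape 0 0 (by simp)]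
    exact zero_comp
  · rw [sigma_hom_ext_of_ne hn ((mappingCone.inr (hocolimMap (locX 𝒜 m) (locStep a))).f n) 0]
    exact comp_zero

lemma locInl_d : locInl a ≫ (loc a).d (-1) 0 =
    (hocolimMap (locX 𝒜 m) (locStep a)).f 0 ≫ locInr a := by
  refine (mappingCone.inl_v_d (hocolimMap (locX 𝒜 m) (locStep a)) 0 (-1) 1 rfl rfl).trans ?_
  rw [sigma_hom_ext_of_ne one_ne_zero
    ((mappingCone.inl (hocolimMap (locX 𝒜 m) (locStep a))).v 1 0 rfl) 0, comp_zero]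
  exact sub_zero _

lemma d_locGenR (k : ℕ) (n : ℤ) : app ((loc a).d 0 n) _ (locGenR a k) = 0 :=
  congrArg (fun z => app z _ (sigmaGen m k (add_neg_cancel (k * m)))) (locInr_d a n)

/-- This is the source of the `inl` rows of `locMat` and `cechLocMat`. -/
lemma d_locGenL (k : ℕ) (h : m + -(((k + 1 : ℕ) : ℤ) * m) = -(k * m)) :
    app ((loc a).d (-1) 0) _ (locGenL a k) =
      locGenR a k - ((loc a).X 0).smul h a (locGenR a (k + 1)) := by
  refine (congrArg (fun z => app z _ (sigmaGen m k (add_neg_cancel (k * m)))) (locInl_d a)).trans ?_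
  refine (congrArg (app (locInr a) _) (app_hocolimMap_sigmaGen a k
    (add_neg_cancel (k * m)) (add_neg_cancel (((k + 1 : ℕ) : ℤ) * m)) h)).trans ?_
  refine (map_sub (app (locInr a) _) _ _).trans ?_
  exact congrArg (fun z => locGenR a k - z) (app_smul (locInr a) _ _ _)

lemma app_locMapAux {k m m' : ℤ} (h : k + m = m') (c : 𝒜 k) (i : ℕ) {t t' : ℤ}
    (ht : i * m + t = 0) (ht' : i * m' + t' = 0) (h' : i * k + t' = t) :
    app ((locMapAux h c i).f 0) t (app (singleIso _).hom t (twistGen ht)) =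
      ((locX 𝒜 m' i).X 0).smul h' (hpow c i) (app (singleIso _).hom t' (twistGen ht')) := by
  rw [← app_smul, ← app_comp, singleIso_hom_naturality, app_comp]
  exact congrArg (app (singleIso ((twist (i * m')).obj (self 𝒜))).hom t) (Subtype.ext rfl)

lemma app_sigmaMap_sigmaGen {k m m' : ℤ} (h : k + m = m') (c : 𝒜 k) (i : ℕ)
    (h' : i * k + -(i * m') = -(i * m)) :
    app ((Limits.Sigma.map (locMapAux h c)).f 0) _ (sigmaGen m i (add_neg_cancel (i * m))) =
      ((∐ locX 𝒜 m').X 0).smul h' (hpow c i) (sigmaGen m' i (add_neg_cancel (i * m'))) := by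
  have e1 : Sigma.ι (locX 𝒜 m) i ≫ Limits.Sigma.map (locMapAux h c) =
    locMapAux h c i ≫ Sigma.ι (locX 𝒜 m') i := by simp
  refine (congrArg (fun z => app (HomologicalComplex.Hom.f z 0) _
    (app (singleIso ((twist (i * m)).obj (self 𝒜))).hom _
      (twistGen (add_neg_cancel (i * m))))) e1).trans ?_
  refine Eq.trans ?_ (app_smul ((Sigma.ι (locX 𝒜 m') i).f 0) h' (hpow c i) _)
  refine congrArg (app ((Sigma.ι (locX 𝒜 m') i).f 0) _) ?_
  exact (app_locMapAux h c i _ (add_neg_cancel (i * m')) h').trans (app_smul (singleIso ((twist (i * m')).obj (self 𝒜))).hom _ _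
    (twistGen (add_neg_cancel (i * m')))).symm

lemma locInl_locMap {k m m' : ℤ} (h : k + m = m') (c : 𝒜 k) (a : 𝒜 m) (b : 𝒜 m')
    (e : (b : A) = c * a) : locInl a ≫ (locMap h c a b e).f (-1) =
      (Limits.Sigma.map (locMapAux h c)).f 0 ≫ locInl b := by
  exact mappingCone.inl_v_map _ _ _ _ (hocolimMap_comm _ (locMapAux_comm h c a b e)) 0 (-1) rfl

lemma locInr_locMap {k m m' : ℤ} (h : k + m = m') (c : 𝒜 k) (a : 𝒜 m) (b : 𝒜 m')
    (e : (b : A) = c * a) : locInr a ≫ (locMap h c a b e).f 0 =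
      (Limits.Sigma.map (locMapAux h c)).f 0 ≫ locInr b := by
  exact mappingCone.inr_f_map _ _ _ _ (hocolimMap_comm _ (locMapAux_comm h c a b e)) 0

/-- The transition map is `c ^ n` on the `n`-th term; this is the origin of the powers `f i ^ s.pos`
in `cechUpMat`. -/
lemma app_locMap_locGen {k m m' : ℤ} (h : k + m = m') (c : 𝒜 k) (a : 𝒜 m) (b : 𝒜 m')
    (e : (b : A) = c * a) (s : ℕ ⊕ ℕ) (h' : locPos s * k + -(locPos s * m') = -(locPos s * m)) :
    app ((locMap h c a b e).f (locDeg s)) _ (locGen a s) =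
      ((loc b).X (locDeg s)).smul h' (hpow c (locPos s)) (locGen b s) := by
  rcases s with i | i
  · refine (congrArg (fun z => app z _ (sigmaGen m i (add_neg_cancel (i * m))))
      (locInl_locMap h c a b e)).trans ?_
    exact (congrArg (app (locInl b) _) (app_sigmaMap_sigmaGen h c i h')).trans
      (app_smul (locInl b) _ _ _)
  · refine (congrArg (fun z => app z _ (sigmaGen m i (add_neg_cancel (i * m))))
      (locInr_locMap h c a b e)).trans ?_
    exact (congrArg (app (locInr b) _) (app_sigmaMap_sigmaGen h c i h')).trans
      (app_smul (locInr b) _ _ _)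

/-- The degrees `t` and `i` stay variable because `-(0 * m)` is not syntactically `0`. -/
lemma app_locι {t i : ℤ} (h : i + -(((0 : ℕ) : ℤ) * m) = t) (x : 𝒜 t) (hx : (x : A) = 1) (c : 𝒜 i)
    (hc : (c : A) = 1) : app ((locι a).f 0) t (app (singleIso (self 𝒜)).hom t x) =
      ((loc a).X 0).smul h c (locGenR a 0) := by
  have e1 : (singleIso (self 𝒜)).hom ≫ (locι a).f 0 = toTwistZero (self 𝒜) (by simp) ≫
      (singleIso ((twist (((0 : ℕ) : ℤ) * m)).obj (self 𝒜))).hom ≫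
        (Sigma.ι (locX 𝒜 m) 0).f 0 ≫ locInr a := by
    have := singleIso_hom_naturality
      (toTwistZero (self 𝒜) (show ((0 : ℕ) : ℤ) * m = 0 by simp))
    exact (congrArg (fun z => z ≫ (Sigma.ι (locX 𝒜 m) 0).f 0 ≫ locInr a) this).trans
      (Category.assoc _ _ _)
  refine (congrArg (fun z => app z t x) e1).trans ?_
  refine Eq.trans ?_ (app_smul (locInr a) h c _)
  refine congrArg (app (locInr a) t) ?_
  refine Eq.trans ?_ (app_smul ((Sigma.ι (locX 𝒜 m) 0).f 0) h c _)
  refine congrArg (app ((Sigma.ι (locX 𝒜 m) 0).f 0) t) ?_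
  refine Eq.trans ?_ (app_smul (singleIso ((twist (((0 : ℕ) : ℤ) * m)).obj (self 𝒜))).hom h c _)
  refine congrArg (app (singleIso ((twist (((0 : ℕ) : ℤ) * m)).obj (self 𝒜))).hom t) ?_
  refine Subtype.ext ?_
  change (1 : A) * x = c * 1
  rw [hx, hc]

end Loc

end GrMod

namespace GrMod

variable {A : Type u} [CommRing A] {𝒜 : ℤ → AddSubgroup A} [GradedRing 𝒜]

lemma smul_congr (P : GrMod 𝒜) {i i' j k : ℤ} (h : i + j = k) (h' : i' + j = k) {c : 𝒜 i}
    {c' : 𝒜 i'} (e : (c : A) = c') (x : P.obj j) : P.smul h c x = P.smul h' c' x := by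
  obtain rfl : i = i' := by lia
  obtain rfl : c = c' := Subtype.ext e
  rfl

/-! ### Generators of the vertices of the Čech cube. -/

section Cech

open CochainComplex

variable {r : ℕ} {f : Fin r → A} {d : Fin r → ℤ} (hf : ∀ i, f i ∈ 𝒜 (d i))

lemma app_eqToHom_symm {K L : CochainComplex (GrMod 𝒜) ℤ} (h : K = L) (n j : ℤ) (x : (L.X n).obj j) :
    app ((eqToHom h).f n) j (app ((eqToHom h.symm).f n) j x) = x := by
  subst h
  rfl

/-- The generators of degree `0` of `cechObj hf S`. -/
def cechGenR (S : Finset (Fin r)) (k : ℕ) : ((cechObj hf S).X 0).obj (-(k * ∑ i ∈ S, d i)) :=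
  if h : S = ∅ then app ((eqToHom (cechObj_empty hf h).symm).f 0) _
    (app (singleIso (self 𝒜)).hom _ (⟨1, by
      subst h
      simpa using SetLike.GradedOne.one_mem⟩ : 𝒜 (-(k * ∑ i ∈ S, d i))))
  else app ((eqToHom (cechObj_of_ne hf h).symm).f 0) _ (locGenR (famProd hf S) k)

/-- The generators of degree `-1` of `cechObj hf S`. -/
def cechGenL (S : Finset (Fin r)) (k : ℕ) : ((cechObj hf S).X (-1)).obj (-(k * ∑ i ∈ S, d i)) :=
  -- A dummy value: `CechIdx` admits only `inr 0` over the empty set.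
  if h : S = ∅ then 0
  else app ((eqToHom (cechObj_of_ne hf h).symm).f (-1)) _ (locGenL (famProd hf S) k)

/-- The generators of `cechObj hf S`. -/
def cechGen (S : Finset (Fin r)) :
    ∀ s : ℕ ⊕ ℕ, ((cechObj hf S).X (locDeg s)).obj (-(locPos s * ∑ i ∈ S, d i))
  | .inl k => cechGenL hf S k
  | .inr k => cechGenR hf S k

lemma cechGen_of_ne {S : Finset (Fin r)} (h : S ≠ ∅) (s : ℕ ⊕ ℕ) : cechGen hf S s =
    app ((eqToHom (cechObj_of_ne hf h).symm).f (locDeg s)) _ (locGen (famProd hf S) s) := by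
  rcases s with k | k
  · exact dif_neg h
  · exact dif_neg h

lemma isBasis_of_eq {K L : CochainComplex (GrMod 𝒜) ℤ} (h : K = L) {J : Type*} {p t : J → ℤ}
    {e : ∀ s, (K.X (p s)).obj (t s)} (he : IsBasis (fun n => K.X n) e) :
    IsBasis (fun n => L.X n) (fun s => app ((eqToHom h).f (p s)) (t s) (e s)) := by
  subst h
  exact he

/-- The module `A` is free on `1`, here given as an element of `𝒜 t` with `t = 0` only
propositionally, since for `S = ∅` the degree appears as a multiple of an empty sum. -/
lemma existsUnique_single (N : ℤ → GrMod 𝒜) {t : ℤ} (ht : t = 0) (x : 𝒜 t) (hx : (x : A) = 1)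
    (y : (N 0).obj t) : ∃! g : ∀ n, ((singleFunctor (GrMod 𝒜) 0).obj (self 𝒜)).X n ⟶ N n,
      app (g 0) t (app (singleIso (self 𝒜)).hom t x) = y := by
  let φ : self 𝒜 ⟶ N 0 :=
    mkHom (fun j => AddMonoidHom.mk' (fun b : 𝒜 j => (N 0).smul (show j + t = j by lia) b y)
      (fun b b' => DFunLike.congr_fun (map_add ((N 0).smul (show j + t = j by lia)) b b') y))
    (fun _ b b' => (N 0).mul_smul _ _ _ b b' _ y rfl)
  let g : ∀ n, ((singleFunctor (GrMod 𝒜) 0).obj (self 𝒜)).X n ⟶ N n := fun n =>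
    if h : n = 0 then (by
      subst h
      exact (singleIso (self 𝒜)).inv ≫ φ)
    else 0
  have hg0 : g 0 = (singleIso (self 𝒜)).inv ≫ φ := dif_pos rfl
  have hg : app (g 0) t (app (singleIso (self 𝒜)).hom t x) = y := by
    refine Eq.trans ?_ ((N 0).smul_one_eq (show t + t = t by lia) x hx y)
    rw [hg0]
    exact congrArg (fun z => app z t x) (Iso.hom_inv_id_assoc (singleIso (self 𝒜)) φ)
  refine ⟨g, hg, fun g' hg' => funext fun n => ?_⟩
  by_cases hn : n = 0
  · subst hn
    rw [← cancel_epi (singleIso (self 𝒜)).hom]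
    ext j (b : 𝒜 j)
    have hb : b = (self 𝒜).smul (show j + t = j by lia) b x :=
      Subtype.ext ((mul_one (b : A)).symm.trans (congrArg (fun z => (b : A) * z) hx.symm))
    rw [hb]
    refine (app_smul ((singleIso (self 𝒜)).hom ≫ g' 0) _ b x).trans (Eq.trans ?_
      (app_smul ((singleIso (self 𝒜)).hom ≫ g 0) _ b x).symm)
    exact congrArg _ (hg'.trans hg.symm)
  · exact (HomologicalComplex.isZero_single_obj_X (ComplexShape.up ℤ) 0
      (self 𝒜) n hn).eq_of_src _ _

lemma isBasis_cechGen (S : Finset (Fin r)) : IsBasis (fun n => (cechObj hf S).X n)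
    (fun s : {s : ℕ ⊕ ℕ // S = ∅ → s = .inr 0} => cechGen hf S s.1) := by
  intro N y
  by_cases h : S = ∅
  · have e2 : cechGen hf S (.inr 0) = _ := dif_pos h
    obtain ⟨g, hg, hg'⟩ := existsUnique_single N (t := -(((0 : ℕ) : ℤ) * ∑ i ∈ S, d i)) (by simp)
      ⟨1, by simpa using SetLike.GradedOne.one_mem⟩ rfl (y ⟨.inr 0, fun _ => rfl⟩)
    refine ⟨fun n => (eqToHom (cechObj_empty hf h)).f n ≫ g n, ?_, fun g' h' => funext fun n => ?_⟩
    · rintro ⟨s, hs⟩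
      obtain rfl := hs h
      refine (congrArg (app ((eqToHom (cechObj_empty hf h)).f 0 ≫ g 0) _) e2).trans ?_
      exact (congrArg (app (g 0) _) (app_eqToHom_symm _ _ _ _)).trans hg
    · have := congrFun (hg' (fun n => (eqToHom (cechObj_empty hf h).symm).f n ≫ g' n)
        ((congrArg (app (g' 0) _) e2.symm).trans (h' ⟨.inr 0, fun _ => rfl⟩))) n
      rw [← this, ← Category.assoc, ← HomologicalComplex.comp_f, eqToHom_trans, eqToHom_refl]
      exact (Category.id_comp _).symm
  · have h1 := isBasis_of_eq (cechObj_of_ne hf h).symm (isBasis_locGen (famProd hf S))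
    obtain ⟨g, hg, hg'⟩ := h1 N fun s => y ⟨s, fun e => absurd e h⟩
    refine ⟨g, fun s => ?_, fun g' h' => hg' _ fun s => ?_⟩
    · exact (congrArg (app (g (locDeg s.1)) _) (cechGen_of_ne hf h s.1)).trans (hg s.1)
    · exact (congrArg (app (g' (locDeg s)) _) (cechGen_of_ne hf h s).symm).trans
        (h' ⟨s, fun e => absurd e h⟩)

/-- Over `S = ∅` the only position is `0`, where the power of the product is `1`; so the map `A ⟶
A_{f_T}` obeys the same formula as the transitions between telescopes. -/
lemma app_cechMap {S T : Finset (Fin r)} (hST : S ⊆ T) (hT : T ≠ ∅) (s : ℕ ⊕ ℕ)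
    (hs : S = ∅ → s = .inr 0) {i : ℤ} (c : 𝒜 i) (hc : (c : A) = (∏ i ∈ T \ S, f i) ^ locPos s)
    (h : i + -(locPos s * ∑ i ∈ T, d i) = -(locPos s * ∑ i ∈ S, d i)) :
    app ((cechMap hf hST).f (locDeg s)) _ (cechGen hf S s) =
      ((cechObj hf T).X (locDeg s)).smul h c (cechGen hf T s) := by
  by_cases hS : S = ∅
  · obtain rfl := hs hS
    have e1 : cechMap hf hST = eqToHom (cechObj_empty hf hS) ≫ locι (famProd hf T) ≫
        eqToHom (cechObj_of_ne hf hT).symm := (dif_neg hT).trans (dif_pos hS)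
    rw [e1, cechGen_of_ne hf hT]
    refine Eq.trans ?_ (app_smul ((eqToHom (cechObj_of_ne hf hT).symm).f 0) h c
      (locGenR (famProd hf T) 0))
    refine congrArg (app ((eqToHom (cechObj_of_ne hf hT).symm).f 0) _) ?_
    refine Eq.trans ?_ (app_locι (famProd hf T) h ⟨1, by
      subst hS
      simpa [locPos] using SetLike.GradedOne.one_mem⟩ rfl c (by rw [hc]; exact pow_zero _))
    refine congrArg (app ((locι (famProd hf T)).f 0) _) ?_
    have e2 : cechGen hf S (.inr 0) = _ := dif_pos hS
    refine (congrArg (app ((eqToHom (cechObj_empty hf hS)).f 0) _) e2).trans ?_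
    exact app_eqToHom_symm _ _ _ _
  · have e1 : cechMap hf hST = eqToHom (cechObj_of_ne hf hS) ≫ famMap hf hST ≫
        eqToHom (cechObj_of_ne hf hT).symm := (dif_neg hT).trans (dif_neg hS)
    rw [e1, cechGen_of_ne hf hT, cechGen_of_ne hf hS]
    refine Eq.trans ?_ (app_smul ((eqToHom (cechObj_of_ne hf hT).symm).f _) h c
      (locGen (famProd hf T) s))
    refine congrArg (app ((eqToHom (cechObj_of_ne hf hT).symm).f _) _) ?_
    refine (congrArg (app ((famMap hf hST).f _) _) (app_eqToHom_symm (cechObj_of_ne hf hS) _ _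
      (locGen (famProd hf S) s))).trans ?_
    refine (app_locMap_locGen (Finset.sum_sdiff hST) (famProd hf (T \ S)) _ _
      (Finset.prod_sdiff hST).symm s ?_).trans (smul_congr _ _ _ hc.symm _)
    rw [← Finset.sum_sdiff hST]
    ring

lemma d_cechGenR (S : Finset (Fin r)) (k : ℕ) (n : ℤ) :
    app ((cechObj hf S).d 0 n) _ (cechGenR hf S k) = 0 := by
  by_cases hS : S = ∅
  · have e2 : cechGenR hf S k = _ := dif_pos hS
    rw [e2, ← app_f_d]
    refine (congrArg (app ((eqToHom (cechObj_empty hf hS).symm).f n) _) ?_).trans (map_zero _)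
    exact congrArg (fun z => app z _ (app (singleIso (self 𝒜)).hom _ _))
      (HomologicalComplex.single_obj_d (ComplexShape.up ℤ) 0 (self 𝒜) 0 n)
  · have e2 : cechGenR hf S k = _ := dif_neg hS
    rw [e2, ← app_f_d]
    refine (congrArg (app ((eqToHom (cechObj_of_ne hf hS).symm).f n) _)
      (d_locGenR _ k n)).trans (map_zero _)

lemma d_cechGenL {S : Finset (Fin r)} (hS : S ≠ ∅) (k : ℕ)
    (h : ∑ i ∈ S, d i + -(((k + 1 : ℕ) : ℤ) * ∑ i ∈ S, d i) = -(k * ∑ i ∈ S, d i)) :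
    app ((cechObj hf S).d (-1) 0) _ (cechGenL hf S k) =
      cechGenR hf S k - ((cechObj hf S).X 0).smul h (famProd hf S) (cechGenR hf S (k + 1)) := by
  have e1 : cechGenL hf S k = _ := dif_neg hS
  have e2 : ∀ k, cechGenR hf S k = _ := fun k => dif_neg hS
  rw [e1, e2, e2, ← app_f_d]
  refine (congrArg (app ((eqToHom (cechObj_of_ne hf hS).symm).f 0) _)
    (d_locGenL _ k h)).trans ?_
  refine (map_sub (app ((eqToHom (cechObj_of_ne hf hS).symm).f 0) _) _ _).trans ?_
  exact congrArg (fun z => _ - z) (app_smul _ _ _ _)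

end Cech

end GrMod

namespace GrMod

variable {A : Type u} [CommRing A] {𝒜 : ℤ → AddSubgroup A} [GradedRing 𝒜]

/-! ### The total complex of a cube of complexes. -/

section CubeTotal

variable {r : ℕ} (F : Finset (Fin r) ⥤ CochainComplex (GrMod 𝒜) ℤ)

/-- The complex attached to a cube of complexes, as a double complex. -/
abbrev cubeBicomplex : HomologicalComplex₂ (GrMod 𝒜) (ComplexShape.up ℤ) (ComplexShape.up ℤ) :=
  cubeComplex F

/-- The inclusion of a term of the double complex in the total complex of a cube. -/
def cubeι (p q n : ℤ) (h : p + q = n) :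
    (cubeX F p).X q ⟶ ((cubeBicomplex F).total (ComplexShape.up ℤ)).X n :=
  (cubeBicomplex F).ιTotal (ComplexShape.up ℤ) p q n h

lemma cubeι_d (p q q' n n' : ℤ) (h : p + q = n) (hq : q + 1 = q') (hn : n + 1 = n') :
    cubeι F p q n h ≫ ((cubeBicomplex F).total (ComplexShape.up ℤ)).d n n' =
      (cubeD F p (p + 1)).f q ≫ cubeι F (p + 1) q n' (by lia) +
      p.negOnePow • ((cubeX F p).d q q' ≫ cubeι F p q' n' (by lia)) := by
  refine (congrArg (fun z => (cubeBicomplex F).ιTotal (ComplexShape.up ℤ) p q n h ≫ z)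
    (HomologicalComplex₂.total_d _ _ n n')).trans ?_
  rw [Preadditive.comp_add, HomologicalComplex₂.ι_D₁, HomologicalComplex₂.ι_D₂,
    HomologicalComplex₂.d₁_eq _ _ (show (ComplexShape.up ℤ).Rel p (p + 1) from rfl)
      q n' (show p + 1 + q = n' by lia),
    HomologicalComplex₂.d₂_eq _ _ p (show (ComplexShape.up ℤ).Rel q q' from hq) n'
      (show p + q' = n' by lia)]
  refine congrArg₂ (· + ·) ?_ rfl
  exact _root_.one_smul ℤˣ _

lemma exists_cubeι_desc {n : ℤ} {Z : GrMod 𝒜}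
    (φ : ∀ p q, p + q = n → ((cubeX F p).X q ⟶ Z)) :
    ∃ f : ((cubeBicomplex F).total (ComplexShape.up ℤ)).X n ⟶ Z,
      ∀ p q h, cubeι F p q n h ≫ f = φ p q h :=
  ⟨(cubeBicomplex F).totalDesc φ, fun p q h => HomologicalComplex₂.ι_totalDesc _ _ p q h⟩

lemma cubeι_hom_ext {n : ℤ} {Z : GrMod 𝒜}
    {f g : ((cubeBicomplex F).total (ComplexShape.up ℤ)).X n ⟶ Z}
    (h : ∀ p q h, cubeι F p q n h ≫ f = cubeι F p q n h ≫ g) : f = g :=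
  HomologicalComplex₂.total.hom_ext _ h

/-- The inclusion of a summand in the total complex of a cube. -/
def cubeTotInc (S : Finset (Fin r)) (q n : ℤ) (h : S.card + q = n) :
    (F.obj S).X q ⟶ ((cubeBicomplex F).total (ComplexShape.up ℤ)).X n :=
  (cubeInc F S.card S).f q ≫ cubeι F S.card q n h

lemma cubeX_hom_ext_f {p q : ℤ} {Z : GrMod 𝒜} {f g : (cubeX F p).X q ⟶ Z}
    (h : ∀ S : Finset (Fin r), (S.card : ℤ) = p →
      (cubeInc F p S).f q ≫ f = (cubeInc F p S).f q ≫ g) : f = g := by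
  have e : ∑ S, (cubeπ F p S).f q ≫ (cubeInc F p S).f q = 𝟙 _ := by
    have := congrArg (fun z => HomologicalComplex.Hom.f z q) (sum_cubeπ_cubeInc F p)
    refine Eq.trans ?_ this
    exact (map_sum (HomologicalComplex.eval (GrMod 𝒜) (ComplexShape.up ℤ) q).mapAddHom
      (fun S => cubeπ F p S ≫ cubeInc F p S) Finset.univ).symm
  rw [← Category.id_comp f, ← Category.id_comp g, ← e, Preadditive.sum_comp, Preadditive.sum_comp]
  refine Finset.sum_congr rfl fun S _ => ?_
  rw [Category.assoc, Category.assoc]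
  by_cases hS : (S.card : ℤ) = p
  · rw [h S hS]
  · rw [cubeπ, dif_neg hS]
    exact zero_comp.trans zero_comp.symm

lemma cubeTot_hom_ext {n : ℤ} {Z : GrMod 𝒜}
    {f g : ((cubeBicomplex F).total (ComplexShape.up ℤ)).X n ⟶ Z}
    (h : ∀ S q h, cubeTotInc F S q n h ≫ f = cubeTotInc F S q n h ≫ g) : f = g := by
  refine cubeι_hom_ext F fun p q hpq => cubeX_hom_ext_f F fun S hS => ?_
  subst hS
  rw [← Category.assoc, ← Category.assoc]
  exact h S q hpq

lemma exists_cubeTot_desc {n : ℤ} {Z : GrMod 𝒜}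
    (φ : ∀ (S : Finset (Fin r)) (q : ℤ), S.card + q = n → ((F.obj S).X q ⟶ Z)) :
    ∃ f : ((cubeBicomplex F).total (ComplexShape.up ℤ)).X n ⟶ Z,
      ∀ S q h, cubeTotInc F S q n h ≫ f = φ S q h := by
  -- The sum runs over all `S`; those of the wrong size contribute zero.
  obtain ⟨f, hf⟩ := exists_cubeι_desc F (n := n) fun p q h => ∑ S, (cubeπ F p S).f q ≫
    if hS : (S.card : ℤ) = p then φ S q (hS ▸ h) else 0
  refine ⟨f, fun S q h => ?_⟩
  rw [cubeTotInc, Category.assoc, hf]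
  refine (Preadditive.comp_sum _ _ _).trans ?_
  rw [Finset.sum_eq_single S]
  · rw [dif_pos rfl, ← Category.assoc, ← HomologicalComplex.comp_f, cubeInc_π_self F _ S rfl]
    exact Category.id_comp _
  · intro T _ hT
    rw [← Category.assoc, ← HomologicalComplex.comp_f, cubeInc_π_of_ne F _ hT.symm]
    exact zero_comp
  · simp

/-- The sum is taken over `attach` because the degree of the summand for `insert i S` depends on the
proof that `i ∉ S`. -/
lemma cubeTotInc_d (S : Finset (Fin r)) (q q' n n' : ℤ) (h : S.card + q = n) (hq : q + 1 = q')
    (hn : n + 1 = n') :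
    cubeTotInc F S q n h ≫ ((cubeBicomplex F).total (ComplexShape.up ℤ)).d n n' =
      ∑ i ∈ Sᶜ.attach, cubeSign (insert i.1 S) i.1 •
        ((F.map (homOfLE (Finset.subset_insert i.1 S))).f q ≫
          cubeTotInc F (insert i.1 S) q n' (by
            rw [Finset.card_insert_of_notMem (Finset.mem_compl.1 i.2)]
            push_cast
            lia)) +
      (S.card : ℤ).negOnePow • ((F.obj S).d q q' ≫ cubeTotInc F S q' n' (by lia)) := by
  rw [cubeTotInc, Category.assoc, cubeι_d F _ _ q' _ _ _ hq hn, Preadditive.comp_add]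
  refine congrArg₂ (· + ·) ?_ ?_
  · have e1 := congrArg (fun z => HomologicalComplex.Hom.f z q)
      (cubeInc_cubeD F (rfl : (S.card : ℤ) + 1 = S.card + 1) S rfl)
    rw [← Category.assoc]
    refine (congrArg (fun z => z ≫ cubeι F (S.card + 1) q n' (by lia)) e1).trans ?_
    have e2 : (∑ i ∈ Sᶜ, cubeSign (insert i S) i •
        (F.map (homOfLE (Finset.subset_insert i S)) ≫ cubeInc F (S.card + 1) (insert i S))).f q =
        ∑ i ∈ Sᶜ, cubeSign (insert i S) i • ((F.map (homOfLE (Finset.subset_insert i S))).f q ≫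
          (cubeInc F (S.card + 1) (insert i S)).f q) :=
      (map_sum (HomologicalComplex.eval (GrMod 𝒜) (ComplexShape.up ℤ) q).mapAddHom _ _).trans
        (Finset.sum_congr rfl fun i _ =>
          map_zsmul (HomologicalComplex.eval (GrMod 𝒜) (ComplexShape.up ℤ) q).mapAddHom _ _)
    refine (congrArg (fun z => z ≫ cubeι F (S.card + 1) q n' (by lia)) e2).trans ?_
    rw [Preadditive.sum_comp, ← Finset.sum_attach]
    refine Finset.sum_congr rfl fun i _ => ?_
    rw [Preadditive.zsmul_comp]
    refine congrArg (cubeSign (insert i.1 S) i.1 • ·) ?_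
    have hc : ∀ (p : ℤ) (hp : ((insert i.1 S).card : ℤ) = p) (h : p + q = n'),
        (cubeInc F p (insert i.1 S)).f q ≫ cubeι F p q n' h =
          cubeTotInc F (insert i.1 S) q n' (by lia) := by
      rintro _ rfl h
      rfl
    refine (Category.assoc _ _ _).trans ?_
    refine congrArg (fun z => (F.map (homOfLE (Finset.subset_insert i.1 S))).f q ≫ z) (hc _ ?_ _)
    rw [Finset.card_insert_of_notMem (Finset.mem_compl.1 i.2)]
    push_cast
    rfl
  · rw [Linear.comp_units_smul, ← Category.assoc, (cubeInc F S.card S).comm, Category.assoc]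
    rfl

end CubeTotal

end GrMod

namespace GrMod

variable {A : Type u} [CommRing A] {𝒜 : ℤ → AddSubgroup A} [GradedRing 𝒜]

/-! ### Basis and differential of `freeRΓ`. -/

section FreeRΓ

open DiffMod CochainComplex

variable {r : ℕ} {f : Fin r → A} {d : Fin r → ℤ} (hf : ∀ i, f i ∈ 𝒜 (d i))

/-- The inclusion of a summand in `freeRΓ hf`. -/
def rgInc (S : Finset (Fin r)) (q n : ℤ) (h : S.card + q = n) :
    (cechObj hf S).X q ⟶ (freeRΓ hf).X n :=
  cubeTotInc (cechDiagram hf) S q n h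

lemma rgInc_hom_ext {n : ℤ} {Z : GrMod 𝒜} {g g' : (freeRΓ hf).X n ⟶ Z}
    (h : ∀ S q h, rgInc hf S q n h ≫ g = rgInc hf S q n h ≫ g') : g = g' :=
  cubeTot_hom_ext (cechDiagram hf) h

lemma exists_rgInc_desc {n : ℤ} {Z : GrMod 𝒜}
    (φ : ∀ (S : Finset (Fin r)) (q : ℤ), S.card + q = n → ((cechObj hf S).X q ⟶ Z)) :
    ∃ g : (freeRΓ hf).X n ⟶ Z, ∀ S q h, rgInc hf S q n h ≫ g = φ S q h :=
  exists_cubeTot_desc (cechDiagram hf) φ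

lemma rgInc_d (S : Finset (Fin r)) (q q' n n' : ℤ) (h : S.card + q = n) (hq : q + 1 = q')
    (hn : n + 1 = n') : rgInc hf S q n h ≫ (freeRΓ hf).d n n' =
      ∑ i ∈ Sᶜ.attach, cubeSign (insert i.1 S) i.1 •
        ((cechMap hf (Finset.subset_insert i.1 S)).f q ≫
          rgInc hf (insert i.1 S) q n' (by
            rw [Finset.card_insert_of_notMem (Finset.mem_compl.1 i.2)]
            push_cast
            lia)) +
      (S.card : ℤ).negOnePow • ((cechObj hf S).d q q' ≫ rgInc hf S q' n' (by lia)) :=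
  cubeTotInc_d (cechDiagram hf) S q q' n n' h hq hn

/-- The cohomological degree of a generator of `freeRΓ hf`. -/
def rgDeg (s : CechIdx r) : ℤ := s.1.1.card + locDeg s.1.2

variable (d) in
/-- The internal degree of a generator of `freeRΓ hf`. -/
def rgTw (s : CechIdx r) : ℤ := -(locPos s.1.2 * ∑ i ∈ s.1.1, d i)

/-- The generators of `freeRΓ hf`. -/
def rgGen (s : CechIdx r) : ((freeRΓ hf).X (rgDeg s)).obj (rgTw d s) :=
  app (rgInc hf s.1.1 (locDeg s.1.2) (rgDeg s) rfl) (rgTw d s) (cechGen hf s.1.1 s.1.2)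

/-- In degree `n` the total complex is the direct sum of the terms of degree `n - |S|` of the
vertices `cechObj hf S`, so their bases are put together. -/
lemma isBasis_rgGen : IsBasis (fun n => (freeRΓ hf).X n) (rgGen hf) := by
  intro N y
  choose g hg hg' using fun S => isBasis_cechGen hf S (fun q => N (S.card + q))
    (fun t => y ⟨(S, t.1), t.2⟩)
  choose G hG using fun n => exists_rgInc_desc hf (n := n) (Z := N n) fun S q h => by
    subst h
    exact g S q
  refine ⟨G, fun s => ?_, fun G' hG' => funext fun n => rgInc_hom_ext hf fun S q h => ?_⟩
  · exact (congrArg (fun z => app z _ (cechGen hf s.1.1 s.1.2)) (hG _ s.1.1 (locDeg s.1.2) rfl)).trans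
      (hg s.1.1 ⟨s.1.2, s.2⟩)
  · subst h
    rw [hG]
    exact congrFun (hg' S (fun q => rgInc hf S q (S.card + q) rfl ≫ G' (S.card + q))
      fun t => hG' ⟨(S, t.1), t.2⟩) q

variable {V : Type*} [AddCommGroup V]
  (ν : ∀ p t, ((freeRΓ hf).X p).obj t →+ V)

lemma rgInc_cechGen (s : CechIdx r) (n : ℤ) (h : s.1.1.card + locDeg s.1.2 = n) :
    ν n _ (app (rgInc hf s.1.1 (locDeg s.1.2) n h) _ (cechGen hf s.1.1 s.1.2)) =
      ν (rgDeg s) _ (rgGen hf s) := by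
  subst h
  rfl

lemma map_units_smul {G H : Type*} [AddCommGroup G] [AddCommGroup H] (g : G →+ H) (e : ℤˣ) (x : G) :
    g (e • x) = e • g x :=
  map_zsmul g (e : ℤ) x

variable [Module A V]

lemma negOnePow_smul_eq (k : ℕ) (v : V) : (k : ℤ).negOnePow • v = ((-1) ^ k : A) • v := by
  rcases Nat.even_or_odd k with h | h
  · rw [Int.negOnePow_even _ (by exact_mod_cast h), h.neg_one_pow, _root_.one_smul,
      _root_.one_smul]
  · rw [Int.negOnePow_odd _ (by exact_mod_cast h), h.neg_one_pow, Units.neg_smul, neg_smul,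
      _root_.one_smul, _root_.one_smul]

/-- The generators lie in different graded pieces, so their `A`-linear combinations are formed only
after applying additive maps `ν` into an ungraded module that are compatible with homogeneous
scalars. In the application `ν` evaluates a cochain. -/
lemma map_d_rgGen
    (hν : ∀ {i j k : ℤ} (p : ℤ) (h : i + j = k) (a : 𝒜 i) (x : ((freeRΓ hf).X p).obj j),
      ν p k (((freeRΓ hf).X p).smul h a x) = (a : A) • ν p j x)
    (s : CechIdx r) (n : ℤ) (hn : rgDeg s + 1 = n) :
    ν n _ (app ((freeRΓ hf).d (rgDeg s) n) _ (rgGen hf s)) =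
      Finsupp.linearCombination A (fun t => ν (rgDeg t) _ (rgGen hf t)) (cechMat f s) := by
  have e1 := congrArg (fun z => ν n _ (app z _ (cechGen hf s.1.1 s.1.2)))
    (rgInc_d hf s.1.1 (locDeg s.1.2) (locDeg s.1.2 + 1) (rgDeg s) n rfl rfl hn)
  refine e1.trans ?_
  rw [app_add_apply, map_add, cechMat, map_add, add_comm, app_sum, map_sum]
  refine congrArg₂ (· + ·) ?_ ?_
  · rw [app_intUnits_smul]
    refine (map_units_smul (ν n _) _ _).trans ?_
    rw [negOnePow_smul_eq (A := A)]
    obtain ⟨⟨S, k | k⟩, hs⟩ := s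
    · have hS : S ≠ ∅ := fun e => nomatch hs e
      obtain rfl : n = S.card + 0 := by
        rw [← hn]
        exact (add_assoc (S.card : ℤ) (-1) 1).trans rfl
      have hd := d_cechGenL hf hS k (by push_cast; ring)
      refine Eq.trans ?_ (congrArg (Finsupp.linearCombination A fun t => ν (rgDeg t) _ (rgGen hf t))
        (cechLocMat_inl f S hS k)).symm
      rw [map_smul, map_sub, Finsupp.linearCombination_single, Finsupp.linearCombination_single,
        _root_.one_smul]
      refine congrArg (((-1) ^ S.card : A) • ·) ?_
      refine (congrArg (fun z => ν (S.card + 0) _ (app (rgInc hf S 0 (S.card + 0) rfl) _ z))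
        hd).trans ?_
      rw [map_sub, app_smul]
      refine (map_sub (ν (S.card + 0) _) _ _).trans ?_
      exact congrArg (fun z => _ - z) (hν _ _ _ _)
    · rw [cechLocMat_inr f _ k rfl, map_zero]
      refine (congrArg (((-1) ^ S.card : A) • ·) ?_).trans (_root_.smul_zero _)
      refine (congrArg (fun z => ν n _ (app (rgInc hf S (0 + 1) n _) _ z))
        (d_cechGenR hf S k (0 + 1))).trans ?_
      rw [map_zero]
      exact map_zero _
  · rw [linearCombination_cechUpMat]
    refine Eq.trans ?_ (Finset.sum_attach _ _)
    refine Finset.sum_congr rfl fun i _ => ?_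
    rw [app_zsmul, map_zsmul, SemigroupAction.mul_smul, Int.cast_smul_eq_zsmul]
    refine congrArg (cubeSign (insert i.1 s.1.1) i.1 • ·) ?_
    -- Passing from `S` to `S ∪ {i}` multiplies by the power of the product over the difference
    -- `{i}`, that is, of `f i`.
    have e2 := app_cechMap hf (Finset.subset_insert i.1 s.1.1) (Finset.insert_ne_empty _ _) s.1.2 s.2
      (hpow ⟨f i.1, hf i.1⟩ (locPos s.1.2)) (by
        rw [Finset.insert_sdiff_cancel (Finset.mem_compl.1 i.2), Finset.prod_singleton]
        rfl) (by
        rw [Finset.sum_insert (Finset.mem_compl.1 i.2)]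
        ring)
    refine (congrArg (fun z => ν n _ (app (rgInc hf (insert i.1 s.1.1) (locDeg s.1.2) n _) _ z))
      e2).trans ?_
    refine (congrArg (ν n _) (app_smul _ _ _ _)).trans ((hν _ _ _ _).trans ?_)
    exact congrArg (fun z => f i.1 ^ s.pos • z) (rgInc_cechGen hf ν (s.ins i.1) n _)

end FreeRΓ

end GrMod

namespace GrMod

variable {A : Type u} [CommRing A] {𝒜 : ℤ → AddSubgroup A} [GradedRing 𝒜]

/-! ### Evaluation of cochains. -/

section Pairing

open CochainComplex HomComplex

variable {K M : CochainComplex (GrMod 𝒜) ℤ}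

/-- A component of an element of the product of the components of the internal Hom complex. -/
def cochainAt (z : TotCh (ihomObj K M)) (n j : ℤ) : Cochain K ((twistCh j).obj M) n := z n j

/-- The value of a cochain, transported to a given degree. -/
def evalAt {j n : ℤ} (z : Cochain K ((twistCh j).obj M) n) {p q t j' : ℤ} (h : p + n = q)
    (h' : j + t = j') : (K.X p).obj t →+ (M.X q).obj j' :=
  ((M.X q).tr h').comp (app (z.v p q h) t)

lemma evalAt_smul {j n : ℤ} (z : Cochain K ((twistCh j).obj M) n) {p q t t' i j' k' : ℤ}
    (h : p + n = q) (h' : j + t = j') (h'' : j + t' = k') (hi : i + t = t') (hi' : i + j' = k')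
    (a : 𝒜 i) (ξ : (K.X p).obj t) :
    evalAt z h h'' ((K.X p).smul hi a ξ) = (M.X q).smul hi' a (evalAt z h h' ξ) := by
  subst h' h''
  exact app_smul (z.v p q h) hi a ξ

lemma evalAt_postcomp_mulCh {i j k n : ℤ} (hi : i + j = k) (a : 𝒜 i)
    (z : Cochain K ((twistCh j).obj M) n) {p q t j' k' : ℤ}
    (h : p + n = q) (h' : j + t = j') (h'' : k + t = k') (hi' : i + j' = k') (ξ : (K.X p).obj t) :
    evalAt (postcomp K (mulCh M hi a) n z) h h'' ξ = (M.X q).smul hi' a (evalAt z h h' ξ) := by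
  subst h' h''
  exact congrArg (fun y => app y t ξ) (Cochain.comp_zero_cochain_v z (Cochain.ofHom (mulCh M hi a)) p q h)

lemma evalAt_postcomp {N : CochainComplex (GrMod 𝒜) ℤ} (g : M ⟶ N) {j n : ℤ}
    (z : Cochain K ((twistCh j).obj M) n) {p q t j' : ℤ} (h : p + n = q) (h' : j + t = j')
    (ξ : (K.X p).obj t) :
    evalAt (postcomp K ((twistCh j).map g) n z) h h' ξ = app (g.f q) j' (evalAt z h h' ξ) := by
  subst h'
  exact congrArg (fun y => app y t ξ)
    (Cochain.comp_zero_cochain_v z (Cochain.ofHom ((twistCh j).map g)) p q h)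

lemma evalAt_δ {j n n' : ℤ} (hn : n + 1 = n') (z : Cochain K ((twistCh j).obj M) n)
    {p p' q q' t j' : ℤ} (h : p + n' = q') (hq : q + 1 = q') (hp : p + 1 = p') (h' : j + t = j')
    (ξ : (K.X p).obj t) :
    evalAt (δ n n' z) h h' ξ = app (M.d q q') j' (evalAt z (by lia) h' ξ) +
      n'.negOnePow • evalAt z (by lia) h' (app (K.d p p') t ξ) := by
  subst h'
  have e := δ_v n n' hn z p q' h q p' (by lia) hp
  refine (congrArg (fun y => app y t ξ) e).trans ?_
  refine (app_add_apply _ _ _ _).trans (congrArg₂ (· + ·) rfl ?_)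
  exact app_intUnits_smul _ _ _ _

/-- The signed evaluation of an element of the internal Hom complex. -/
def pairing (z : TotCh (ihomObj K M)) (p t : ℤ) : (K.X p).obj t →+ TotCh M :=
  -- The Koszul sign `(-1) ^ (p * n)` for a cochain of degree `n = q - p` evaluated in degree `p`.
  AddMonoidHom.mk' (fun ξ => TotCh.mk fun q j' => (p * (q - p)).negOnePow •
      evalAt (cochainAt z (q - p) (j' - t)) (by lia) (by lia) ξ)
    (fun ξ ξ' => TotCh.ext fun q j' => (congrArg ((p * (q - p)).negOnePow • ·)
      (map_add (evalAt (cochainAt z (q - p) (j' - t)) _ _) ξ ξ')).trans (smul_add _ _ _))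

lemma pairing_apply (z : TotCh (ihomObj K M)) {p t q j' n j : ℤ} (h : p + n = q) (h' : j + t = j')
    (ξ : (K.X p).obj t) :
    pairing z p t ξ q j' = (p * n).negOnePow • evalAt (cochainAt z n j) h h' ξ := by
  obtain rfl : n = q - p := by lia
  obtain rfl : j = j' - t := by lia
  rfl

lemma pairing_add (z z' : TotCh (ihomObj K M)) (p t : ℤ) (ξ : (K.X p).obj t) :
    pairing (z + z') p t ξ = pairing z p t ξ + pairing z' p t ξ := by
  refine TotCh.ext fun q j' => ?_
  have h1 : p + (q - p) = q := by lia
  have h2 : j' - t + t = j' := by lia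
  have e : evalAt (cochainAt (z + z') (q - p) (j' - t)) h1 h2 ξ =
      evalAt (cochainAt z (q - p) (j' - t)) h1 h2 ξ +
        evalAt (cochainAt z' (q - p) (j' - t)) h1 h2 ξ := map_add ((M.X q).tr h2) _ _
  refine (pairing_apply _ h1 h2 ξ).trans (Eq.trans ?_ (congrArg₂ (· + ·)
    (pairing_apply z h1 h2 ξ).symm (pairing_apply z' h1 h2 ξ).symm))
  rw [e, smul_add]

lemma pairing_smul_right (z : TotCh (ihomObj K M)) {i j k : ℤ} (p : ℤ) (h : i + j = k) (a : 𝒜 i)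
    (ξ : (K.X p).obj j) : pairing z p k ((K.X p).smul h a ξ) = (a : A) • pairing z p j ξ := by
  refine TotCh.ext fun q j' => ?_
  have h1 : p + (q - p) = q := by lia
  have h3 : i + (j' - i) = j' := by lia
  refine Eq.trans ?_ (Tot.smul_apply (M.X q) h3 a _).symm
  rw [pairing_apply z h1 (show (j' - k) + k = j' by lia),
    pairing_apply z h1 (show (j' - k) + j = j' - i by lia),
    evalAt_smul _ _ (show (j' - k) + j = j' - i by lia) _ _ h3]
  exact (map_units_smul ((M.X q).smul h3 a) _ _).symm

lemma pairing_smul_left {i : ℤ} (a : 𝒜 i) (z : TotCh (ihomObj K M)) (p t : ℤ)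
    (ξ : (K.X p).obj t) : pairing ((a : A) • z) p t ξ = (a : A) • pairing z p t ξ := by
  refine TotCh.ext fun q j' => ?_
  have h1 : p + (q - p) = q := by lia
  have h3 : i + (j' - i) = j' := by lia
  have h4 : i + (j' - i - t) = j' - t := by lia
  have e : cochainAt ((a : A) • z) (q - p) (j' - t) =
      postcomp K (mulCh M h4 a) (q - p) (cochainAt z (q - p) (j' - i - t)) :=
    Tot.smul_apply (ihomX K M (q - p)) h4 a (z (q - p))
  refine Eq.trans ?_ (Tot.smul_apply (M.X q) h3 a _).symm
  rw [pairing_apply _ h1 (show (j' - t) + t = j' by lia),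
    pairing_apply z h1 (show (j' - i - t) + t = j' - i by lia), e,
    evalAt_postcomp_mulCh h4 a _ _ (show (j' - i - t) + t = j' - i by lia) _ h3]
  exact (map_units_smul ((M.X q).smul h3 a) _ _).symm

lemma pairing_totMap {N : CochainComplex (GrMod 𝒜) ℤ} (g : M ⟶ N) (z : TotCh (ihomObj K M))
    (p t : ℤ) (ξ : (K.X p).obj t) :
    pairing (totMap (ihomMap K g) z) p t ξ = totMap g (pairing z p t ξ) := by
  refine TotCh.ext fun q j' => ?_
  have h1 : p + (q - p) = q := by lia
  have h2 : j' - t + t = j' := by lia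
  rw [totMap_apply, pairing_apply _ h1 h2, pairing_apply z h1 h2]
  refine Eq.trans ?_ (map_units_smul (app (g.f q) j') _ _).symm
  exact congrArg ((p * (q - p)).negOnePow • ·) (evalAt_postcomp g _ h1 h2 ξ)

/-- With the Koszul sign built in, the sign of the differential depends on `p` alone and not on the
degree of the cochain, as the form of `cellD` requires. -/
lemma pairing_totD (z : TotCh (ihomObj K M)) {p p' : ℤ} (hp : p + 1 = p') (t : ℤ)
    (ξ : (K.X p).obj t) : pairing (totD _ z) p t ξ =
      p.negOnePow • (totD M (pairing z p t ξ) - pairing z p' t (app (K.d p p') t ξ)) := by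
  refine TotCh.ext fun q j' => ?_
  have h1 : p + (q - p) = q := by lia
  have h2 : j' - t + t = j' := by lia
  have h3 : p + (q - p - 1) = q - 1 := by lia
  have h4 : q - p - 1 + 1 = q - p := by lia
  have e : cochainAt (totD _ z) (q - p) (j' - t) =
      δ (q - p - 1) (q - p) (cochainAt z (q - p - 1) (j' - t)) :=
    totD_apply (ihomObj K M) h4 z (j' - t)
  change _ = p.negOnePow • (totD M (pairing z p t ξ) q j' -
    pairing z p' t (app (K.d p p') t ξ) q j')
  rw [totD_apply M (show q - 1 + 1 = q by lia), pairing_apply _ h1 h2, pairing_apply z h3 h2,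
    pairing_apply z (show p' + (q - p - 1) = q by lia) h2, e,
    evalAt_δ h4 _ h1 (show q - 1 + 1 = q by lia) hp h2, map_units_smul, smul_add, smul_sub,
    smul_smul, smul_smul, smul_smul, ← Int.negOnePow_add, ← Int.negOnePow_add, ← Int.negOnePow_add]
  have s1 : (p * (q - p)).negOnePow = (p + p * (q - p - 1)).negOnePow :=
    congrArg Int.negOnePow (by ring)
  have s2 : (p * (q - p) + (q - p)).negOnePow = -(p + p' * (q - p - 1)).negOnePow := by
    rw [← Int.negOnePow_succ]
    exact congrArg Int.negOnePow (by subst hp; ring)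
  rw [s1, s2, Units.neg_smul]
  exact (sub_eq_add_neg _ _).symm

end Pairing

end GrMod

namespace GrMod

variable {A : Type u} [CommRing A] {𝒜 : ℤ → AddSubgroup A} [GradedRing 𝒜]

/-! ### The local homology complex in coordinates. -/

section Coordinates

open DiffMod CochainComplex HomComplex

variable {r : ℕ} {f : Fin r → A} {d : Fin r → ℤ} (hf : ∀ i, f i ∈ 𝒜 (d i))
  {M : CochainComplex (GrMod 𝒜) ℤ}

variable (M) in
/-- The coordinates of an element of the local homology complex with respect to the generators
of `freeRΓ hf`. -/
def coord : TotCh ((LΛ hf).obj M) →ₗ[A] (CechIdx r → TotCh M) :=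
  linearOfHomogeneous 𝒜
    (AddMonoidHom.mk' (fun (z : TotCh (ihomObj (freeRΓ hf) M)) s =>
        pairing z (rgDeg s) (rgTw d s) (rgGen hf s))
      (fun z z' => funext fun _ => pairing_add z z' _ _ _))
    (fun _ a z => funext fun _ => pairing_smul_left a z _ _ _)

lemma coord_apply_apply (z : TotCh (ihomObj (freeRΓ hf) M)) (s : CechIdx r) {n j q j' : ℤ}
    (h : rgDeg s + n = q) (h' : j + rgTw d s = j') :
    coord hf M z s q j' =
      (rgDeg s * n).negOnePow • evalAt (cochainAt z n j) h h' (rgGen hf s) :=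
  pairing_apply z h h' _

lemma negOnePow_rgDeg (s : CechIdx r) : (rgDeg s).negOnePow = cechSign s := by
  obtain ⟨⟨S, k | k⟩, hs⟩ := s
  · change ((S.card : ℤ) + -1).negOnePow = (-1) ^ S.card * -1
    rw [Int.negOnePow_add, Int.negOnePow_neg, Int.negOnePow_one]
    rfl
  · change ((S.card : ℤ) + 0).negOnePow = (-1) ^ S.card * 1
    rw [add_zero, mul_one]
    rfl

/-- `pairing_totD` produces the shape of a twisted differential, and `map_d_rgGen` identifies its
matrix. -/
lemma coord_totD (z : TotCh ((LΛ hf).obj M)) :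
    coord hf M (totD _ z) = cechD f (totD M) (coord hf M z) := by
  funext s
  have e := map_d_rgGen hf (pairing (K := freeRΓ hf) (M := M) z)
    (fun p h a x => pairing_smul_right z p h a x) s (rgDeg s + 1) rfl
  refine (pairing_totD (K := freeRΓ hf) z rfl _ _).trans ?_
  refine Eq.trans ?_ (cellD_apply _ _).symm
  rw [negOnePow_rgDeg]
  exact congrArg (fun y => cechSign s • (totD M (coord hf M z s) - y)) e

/-- This is uniqueness in the basis property, applied to the modules `M^{p+n}(j)`; surjectivity is
existence, with the Koszul sign undone. -/
lemma coord_injective : Function.Injective (coord hf M) := by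
  refine (injective_iff_map_eq_zero _).2 fun z hz => TotCh.ext fun n j => ?_
  let c : Cochain (freeRΓ hf) ((twistCh j).obj M) n := cochainAt z n j
  change c = 0
  have h0 : ∀ s, app (c.v (rgDeg s) (rgDeg s + n) rfl) (rgTw d s) (rgGen hf s) = 0 := fun s => by
    have e := (coord_apply_apply hf z s rfl rfl).symm.trans
      (congrArg (fun y : CechIdx r → TotCh M => y s (rgDeg s + n) (j + rgTw d s)) hz)
    exact (smul_eq_zero_iff_eq _).1 e
  have key := (isBasis_rgGen hf (fun p => ((twistCh j).obj M).X (p + n)) fun s => 0).unique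
    (y₁ := fun p => c.v p (p + n) rfl) (y₂ := fun p => 0) h0 fun s => rfl
  refine Cochain.ext _ _ fun p q h => ?_
  subst h
  exact congrFun key p

lemma coord_surjective : Function.Surjective (coord hf M) := by
  intro y
  choose g hg _ using fun n j : ℤ => isBasis_rgGen hf (fun p => ((twistCh j).obj M).X (p + n))
    fun s => (rgDeg s * n).negOnePow • y s (rgDeg s + n) (j + rgTw d s)
  let z : TotCh (ihomObj (freeRΓ hf) M) := fun n j =>
    (Cochain.mk (fun p q h => by
      subst h
      exact g n j p) : Cochain (freeRΓ hf) ((twistCh j).obj M) n)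
  refine ⟨z, funext fun s => TotCh.ext fun q j' => ?_⟩
  obtain ⟨n, rfl⟩ : ∃ n, q = rgDeg s + n := ⟨q - rgDeg s, by lia⟩
  obtain ⟨j, rfl⟩ : ∃ j, j' = j + rgTw d s := ⟨j' - rgTw d s, by lia⟩
  refine (coord_apply_apply hf z s rfl rfl).trans ?_
  have e : evalAt (cochainAt z n j) rfl rfl (rgGen hf s) =
      (rgDeg s * n).negOnePow • y s (rgDeg s + n) (j + rgTw d s) := hg n j s
  rw [e, smul_smul, ← Int.negOnePow_add, Int.negOnePow_even _ ⟨_, rfl⟩]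
  exact _root_.one_smul ℤˣ _

lemma coord_bijective : Function.Bijective (coord hf M) :=
  ⟨coord_injective hf, coord_surjective hf⟩

lemma coord_totMap {N : CochainComplex (GrMod 𝒜) ℤ} (g : M ⟶ N) (z : TotCh ((LΛ hf).obj M)) :
    coord hf N (totMap ((LΛ hf).map g) z) = cellMap (CechIdx r) (totMap g) (coord hf M z) :=
  funext fun _ => pairing_totMap g z _ _ _

lemma cubeι_totalTo (F : Finset (Fin r) ⥤ CochainComplex (GrMod 𝒜) ℤ)
    {B : CochainComplex (GrMod 𝒜) ℤ} (φ : (cubeBicomplex F).X 0 ⟶ B)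
    (hφ : (cubeBicomplex F).d (-1) 0 ≫ φ = 0) (p q n : ℤ) (h : p + q = n) :
    cubeι F p q n h ≫ (totalTo (cubeBicomplex F) φ hφ).f n =
      totalToAux (cubeBicomplex F) φ p q n h :=
  HomologicalComplex₂.ι_totalDesc (c₁₂ := ComplexShape.up ℤ) (i₁₂ := n) (cubeBicomplex F)
    (fun p q h => totalToAux (cubeBicomplex F) φ p q n h) p q h

lemma rgInc_π_of_ne {S : Finset (Fin r)} (hS : S ≠ ∅) (q n : ℤ) (h : S.card + q = n) :
    rgInc hf S q n h ≫ (freeRΓπ hf).f n = 0 := by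
  refine (Category.assoc _ _ _).trans ?_
  have e : cubeι (cechDiagram hf) S.card q n h ≫ (freeRΓπ hf).f n =
      totalToAux (cechBicomplex hf) (cechColumnZero hf) S.card q n h :=
    cubeι_totalTo _ _ _ _ _ _ _
  rw [totalToAux, dif_neg (by simpa using hS)] at e
  exact (congrArg (fun y => (cubeInc (cechDiagram hf) S.card S).f q ≫ y) e).trans comp_zero

lemma rgInc_empty_π : rgInc hf ∅ 0 0 rfl ≫ (freeRΓπ hf).f 0 =
    (eqToHom (cechObj_empty hf rfl)).f 0 := by
  refine (Category.assoc _ _ _).trans ?_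
  have e : cubeι (cechDiagram hf) 0 0 0 rfl ≫ (freeRΓπ hf).f 0 =
      (cechColumnZero hf).f 0 :=
    (cubeι_totalTo _ _ _ _ _ _ _).trans (totalToAux_zero _ _ _)
  refine (congrArg (fun y => (cubeInc (cechDiagram hf) 0 ∅).f 0 ≫ y) e).trans ?_
  have e' : cubeInc (cechDiagram hf) 0 ∅ ≫ cechColumnZero hf =
      eqToHom (cechObj_empty hf rfl) :=
    (Category.assoc _ _ _).symm.trans
      ((congrArg (fun y => y ≫ eqToHom (cechObj_empty hf rfl))
        (cubeInc_π_self (cechDiagram hf) 0 ∅ rfl)).trans (Category.id_comp _))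
  exact congrArg (fun y => HomologicalComplex.Hom.f y 0) e'

lemma app_π_rgGen_of_ne {s : CechIdx r} (hs : s ≠ .empty) :
    app ((freeRΓπ hf).f (rgDeg s)) _ (rgGen hf s) = 0 := by
  have hS : s.1.1 ≠ ∅ := fun h => hs (Subtype.ext (Prod.ext h (s.2 h)))
  exact congrArg (fun y => app y _ (cechGen hf s.1.1 s.1.2)) (rgInc_π_of_ne hf hS _ _ rfl)

lemma rgTw_empty : rgTw d CechIdx.empty = 0 := by
  simp [rgTw, CechIdx.empty]

lemma app_π_rgGen_empty : app ((freeRΓπ hf).f 0) (rgTw d CechIdx.empty) (rgGen hf .empty) =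
    app (singleIso (self 𝒜)).hom (rgTw d CechIdx.empty)
      (⟨1, by rw [rgTw_empty]; exact SetLike.GradedOne.one_mem⟩ : 𝒜 (rgTw d CechIdx.empty)) := by
  refine (congrArg (fun y => app y (rgTw d CechIdx.empty) (cechGenR hf ∅ 0))
    (rgInc_empty_π hf)).trans ?_
  have e : cechGenR hf ∅ 0 = _ := dif_pos rfl
  rw [e]
  exact app_eqToHom_symm _ _ _ _

lemma tr_smul_one (N : GrMod 𝒜) {t j k : ℤ} (ht : t = 0) (h : t + j = k) (h' : k = j) (c : 𝒜 t)
    (hc : (c : A) = 1) (x : N.obj j) : N.tr h' (N.smul h c x) = x := by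
  subst ht
  rw [tr_smul]
  obtain rfl : c = ⟨1, SetLike.GradedOne.one_mem⟩ := Subtype.ext hc
  exact N.one_smul j x

lemma evalAt_augCochain_of_ne {n j q j' : ℤ} (x : (M.X n).obj j) {s : CechIdx r}
    (hs : s ≠ .empty) (h : rgDeg s + n = q) (h' : j + rgTw d s = j') :
    evalAt (augCochain (freeRΓπ hf) M n j x) h h' (rgGen hf s) = 0 := by
  subst h'
  refine (congrArg (fun y => app y (rgTw d s) (rgGen hf s))
    (Cochain.zero_cochain_comp_v (Cochain.ofHom (freeRΓπ hf)) _ _ _ h)).trans ?_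
  rw [Cochain.ofHom_v]
  refine (congrArg (app (Cochain.v _ (rgDeg s) q h) (rgTw d s)) (app_π_rgGen_of_ne hf hs)).trans ?_
  exact map_zero _

lemma evalAt_augCochain_empty {n j : ℤ} (x : (M.X n).obj j)
    (h' : j + rgTw d CechIdx.empty = j) :
    evalAt (augCochain (freeRΓπ hf) M n j x) (zero_add n) h' (rgGen hf .empty) = x := by
  let φ := selfHom (M.X n) j x
  let e₀ := HomologicalComplex.singleObjXSelf (ComplexShape.up ℤ) 0 (self 𝒜)
  have e : (augCochain (freeRΓπ hf) M n j x).v 0 n (zero_add n) =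
      (freeRΓπ hf).f 0 ≫ e₀.hom ≫ φ := by
    refine (Cochain.zero_cochain_comp_v (Cochain.ofHom (freeRΓπ hf)) _ _ _ (zero_add n)).trans ?_
    rw [Cochain.ofHom_v]
    exact congrArg (fun y => (freeRΓπ hf).f 0 ≫ y)
      (Cochain.fromSingleMk_v (K := (twistCh j).obj M) φ (zero_add n))
  have e' : app ((augCochain (freeRΓπ hf) M n j x).v 0 n (zero_add n)) (rgTw d CechIdx.empty)
      (rgGen hf .empty) = app φ (rgTw d CechIdx.empty)
        (⟨1, by rw [rgTw_empty]; exact SetLike.GradedOne.one_mem⟩ : 𝒜 (rgTw d CechIdx.empty)) := by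
    refine (congrArg (fun y => app y (rgTw d CechIdx.empty) (rgGen hf .empty)) e).trans ?_
    refine (congrArg (app (e₀.hom ≫ φ) (rgTw d CechIdx.empty)) (app_π_rgGen_empty hf)).trans ?_
    exact congrArg (fun y => app y (rgTw d CechIdx.empty)
      (⟨1, by rw [rgTw_empty]; exact SetLike.GradedOne.one_mem⟩ : 𝒜 (rgTw d CechIdx.empty)))
      (Iso.inv_hom_id_assoc e₀ φ)
  exact (congrArg ((M.X n).tr h') e').trans (tr_smul_one _ rgTw_empty _ _ _ rfl _)

/-- The projection `freeRΓπ` kills every generator except the one at `∅`, which it sends to `1`. -/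
lemma coord_toLΛ (x : TotCh M) :
    coord hf M (totMap ((toLΛ hf).app M) x) = cechη A (TotCh M) r x := by
  funext s
  refine TotCh.ext fun q j' => ?_
  by_cases hs : s = .empty
  · subst hs
    rw [cechη_empty]
    have h' : j' + rgTw d (CechIdx.empty (r := r)) = j' := by rw [rgTw_empty, add_zero]
    refine (coord_apply_apply hf _ .empty (zero_add q) h').trans ?_
    refine (congrArg (((0 : ℤ) * q).negOnePow • ·)
      (evalAt_augCochain_empty hf (x q j') h')).trans ?_
    rw [zero_mul, Int.negOnePow_zero]
    exact _root_.one_smul ℤˣ _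
  · rw [cechη_of_ne _ hs]
    refine (coord_apply_apply hf _ s (show rgDeg s + (q - rgDeg s) = q by lia)
      (show (j' - rgTw d s) + rgTw d s = j' by lia)).trans ?_
    exact (congrArg (((rgDeg s) * _).negOnePow • ·)
      (evalAt_augCochain_of_ne hf _ hs _ _)).trans (smul_zero _)

end Coordinates

end GrMod

namespace GrMod

variable {A : Type u} [CommRing A] {𝒜 : ℤ → AddSubgroup A} [GradedRing 𝒜]

/-! ### Completeness and quasi-isomorphisms for complexes. -/

section LocalHomologyQuasiIso

open DiffMod

variable {r : ℕ} {f : Fin r → A} {d : Fin r → ℤ} (hf : ∀ i, f i ∈ 𝒜 (d i))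
  {M N : CochainComplex (GrMod 𝒜) ℤ}

lemma quasiIso_LΛ_map_iff (g : M ⟶ N) :
    HomologicalComplex.quasiIso (GrMod 𝒜) (ComplexShape.up ℤ) ((LΛ hf).map g) ↔
      Qis (cechD f (totD M)) (cechD f (totD N)) (cellMap (CechIdx r) (totMap g)) :=
  (quasiIso_iff_qis _).trans (qis_iff_of_bijective (e := (coord hf M).toAddMonoidHom)
    (e' := (coord hf N).toAddMonoidHom) (coord_bijective hf) (coord_bijective hf)
    (coord_totD hf) (coord_totD hf) (coord_totMap hf g))

lemma quasiIso_LΛ_map {g : M ⟶ N}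
    (hg : HomologicalComplex.quasiIso (GrMod 𝒜) (ComplexShape.up ℤ) g) :
    HomologicalComplex.quasiIso (GrMod 𝒜) (ComplexShape.up ℤ) ((LΛ hf).map g) :=
  (quasiIso_LΛ_map_iff hf g).2 (qis_cellMap_cech f (totD_totD M) (totD_totD N) (totMap_totD g)
    ((quasiIso_iff_qis g).1 hg))

lemma quasiIso_toLΛ_iff :
    HomologicalComplex.quasiIso (GrMod 𝒜) (ComplexShape.up ℤ) ((toLΛ hf).app M) ↔
      Qis (totD M) (cechD f (totD M)) (cechη A (TotCh M) r) :=
  (quasiIso_iff_qis _).trans (qis_iff_of_bijective (e := AddMonoidHom.id _)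
    (e' := (coord hf M).toAddMonoidHom) Function.bijective_id (coord_bijective hf)
    (fun _ => rfl) (coord_totD hf) (coord_toLΛ hf))

-- By `coord_toLΛ`, in coordinates this map is `cechη` applied in every coordinate, which is
-- `qis_cellMap_cechη`.
variable (M) in
lemma quasiIso_LΛ_map_toLΛ : HomologicalComplex.quasiIso (GrMod 𝒜) (ComplexShape.up ℤ)
    ((LΛ hf).map ((toLΛ hf).app M)) := by
  rw [quasiIso_LΛ_map_iff]
  refine (qis_iff_of_bijective (e := AddMonoidHom.id _)
    (e' := (cellMap (CechIdx r) (coord hf M)).toAddMonoidHom) Function.bijective_id ?_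
    (fun _ => rfl) (cellMap_cellD (coord_totD hf)) fun z => ?_).2
    (qis_cellMap_cechη f (totD_totD M))
  · exact (coord_bijective hf).comp_left
  · funext s
    exact coord_toLΛ hf (z s)

variable (I : HomogeneousIdeal 𝒜)

variable (M) in
/-- A complex is complete with respect to `I` if all the complexes `T(M, a)` for `a ∈ I` homogeneous
are acyclic. -/
def IsComplete : Prop := ∀ (m : ℤ) (a : 𝒜 m), (a : A) ∈ I.toIdeal → (T M a).Acyclic

lemma isComplete_iff_of_quasiIso {g : M ⟶ N}
    (hg : HomologicalComplex.quasiIso (GrMod 𝒜) (ComplexShape.up ℤ) g) :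
    IsComplete M I ↔ IsComplete N I :=
  forall_congr' fun _ => forall_congr' fun _ => forall_congr' fun _ =>
    (acyclic_T_iff M _).trans ((acyc_locD_of_qis (totD_totD M) (totD_totD N) (totMap_totD g)
      ((quasiIso_iff_qis g).1 hg)).trans (acyclic_T_iff N _).symm)

variable {I}

lemma isComplete_LΛ (hI : I.toIdeal = Ideal.span (Set.range f)) :
    IsComplete ((LΛ hf).obj M) I := fun _ a ha =>
  (acyclic_T_iff _ a).2 ((acyc_locD_of_qis (totD_totD _) (cechD_cechD f (totD_totD M))
    (coord_totD hf) (Qis.of_bijective (coord_totD hf) (coord_bijective hf))).2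
      (acyc_locD_cechD f (totD_totD M) (hI ▸ ha)))

/-- Each product `f_S` with `S ≠ ∅` is divisible by a generator, hence lies in `I`, so `qis_cechη`
applies. -/
lemma quasiIso_toLΛ (hI : I.toIdeal = Ideal.span (Set.range f)) (hM : IsComplete M I) :
    HomologicalComplex.quasiIso (GrMod 𝒜) (ComplexShape.up ℤ) ((toLΛ hf).app M) := by
  refine (quasiIso_toLΛ_iff hf).2 (qis_cechη f (totD_totD M) fun S hS => ?_)
  refine (acyclic_T_iff M (famProd hf S)).1 (hM _ _ ?_)
  obtain ⟨i, hi⟩ := Finset.nonempty_iff_ne_empty.2 hS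
  rw [hI]
  refine Ideal.mem_of_dvd _ (Finset.dvd_prod_of_mem f hi) (Ideal.subset_span ⟨i, rfl⟩)

end LocalHomologyQuasiIso

end GrMod

/-! ### Reflections from idempotent pointed endofunctors. -/

section PointedEndofunctor

variable {D : Type*} [Category* D] {L : D ⥤ D} (η : 𝟭 D ⟶ L) {P : ObjectProperty D}

/-- An idempotent pointed endofunctor is well-pointed. -/
lemma map_app_eq_app_obj (hc : ∀ X, P (L.obj X)) (hP : ∀ X, P X → IsIso (η.app X))
    (hL : ∀ X, IsIso (L.map (η.app X))) (X : D) : L.map (η.app X) = η.app (L.obj X) := by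
  have e : η.app X ≫ L.map (η.app X) = η.app X ≫ η.app (L.obj X) :=
    (η.naturality (η.app X)).symm
  have := hL X
  have := hP _ (hc (L.obj X))
  -- Apply `L` to the naturality relation `e` and cancel the isomorphism `L.map (η.app X)`.
  have e' : L.map (L.map (η.app X)) = L.map (η.app (L.obj X)) := by
    rw [← cancel_epi (L.map (η.app X)), ← L.map_comp, e, L.map_comp]
  -- The outer `L` in `e'` is removed by naturality of `η`, which is invertible at `L (L X)`.
  rw [← cancel_mono (η.app (L.obj (L.obj X)))]
  exact (η.naturality (L.map (η.app X))).trans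
    ((congrArg (η.app (L.obj X) ≫ ·) e').trans (η.naturality (η.app (L.obj X))).symm)

/-- The reflection attached to an idempotent pointed endofunctor. -/
def adjunctionOfPointed (hc : ∀ X, P (L.obj X)) (hP : ∀ X, P X → IsIso (η.app X))
    (hL : ∀ X, IsIso (L.map (η.app X))) : P.lift L hc ⊣ P.ι :=
  Adjunction.mkOfUnitCounit
    { unit := { app X := η.app X, naturality _ _ g := η.naturality g }
      counit :=
        { app Y := haveI := hP _ Y.2; ObjectProperty.homMk (inv (η.app Y.obj))
          naturality Y Z g := by
            have := hP _ Y.2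
            have := hP _ Z.2
            refine ObjectProperty.hom_ext _ ?_
            change L.map g.hom ≫ inv (η.app Z.obj) = inv (η.app Y.obj) ≫ g.hom
            rw [IsIso.comp_inv_eq, Category.assoc, IsIso.eq_inv_comp]
            exact (η.naturality g.hom).symm }
      left_triangle := by
        refine NatTrans.ext (funext fun X => ObjectProperty.hom_ext _ ?_)
        have := hP _ (hc X)
        have e : L.map (η.app X) ≫ inv (η.app (L.obj X)) = 𝟙 _ := by
          rw [map_app_eq_app_obj η hc hP hL, IsIso.hom_inv_id]
        exact (congrArg (L.map (η.app X) ≫ ·) (Category.id_comp _)).trans e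
      right_triangle := by
        refine NatTrans.ext (funext fun Y => ?_)
        have := hP _ Y.2
        exact (congrArg (η.app Y.obj ≫ ·) (Category.id_comp _)).trans (IsIso.hom_inv_id _) }

end PointedEndofunctor

namespace GrMod

variable {A : Type u} [CommRing A] {𝒜 : ℤ → AddSubgroup A} [GradedRing 𝒜]
  [HasDerivedCategory.{w} (GrMod 𝒜)]

/-! ### Passage to the derived category. -/

section Derived

open HomologicalComplex

lemma isIso_Q_map_iff {M N : CochainComplex (GrMod 𝒜) ℤ} (g : M ⟶ N) :
    IsIso (DerivedCategory.Q.map g) ↔ quasiIso (GrMod 𝒜) (ComplexShape.up ℤ) g :=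
  (DerivedCategory.isIso_Q_map_iff_quasiIso _ g).trans (mem_quasiIso_iff _).symm

variable {I : HomogeneousIdeal 𝒜}

/-- An isomorphism in the derived category is a roof of maps of complexes, and both legs are then
quasi-isomorphisms. -/
lemma isComplete_iff_of_iso {M N : CochainComplex (GrMod 𝒜) ℤ}
    (e : DerivedCategory.Q.obj M ≅ DerivedCategory.Q.obj N) :
    IsComplete M I ↔ IsComplete N I := by
  obtain ⟨N', g, s, hs, h⟩ := DerivedCategory.left_fac e.hom
  have hg : IsIso (DerivedCategory.Q.map g) := by
    rw [IsIso.eq_comp_inv] at h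
    rw [← h]
    infer_instance
  exact (isComplete_iff_of_quasiIso I ((isIso_Q_map_iff g).1 hg)).trans
    (isComplete_iff_of_quasiIso I ((isIso_Q_map_iff s).1 hs)).symm

/-- Completeness may therefore be tested on a single representing complex. -/
lemma derivedComplete_iff {X : DerivedCategory (GrMod 𝒜)} {M : CochainComplex (GrMod 𝒜) ℤ}
    (e : DerivedCategory.Q.obj M ≅ X) : derivedComplete I X ↔ IsComplete M I :=
  ⟨fun h m a ha => h m a ha M ⟨e⟩, fun h m a ha _ ⟨e'⟩ =>
    (isComplete_iff_of_iso (e ≪≫ e'.symm)).1 h m a ha⟩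

variable {r : ℕ} {f : Fin r → A} {d : Fin r → ℤ} (hf : ∀ i, f i ∈ 𝒜 (d i))

lemma isInvertedBy_LΛ : (quasiIso (GrMod 𝒜) (ComplexShape.up ℤ)).IsInvertedBy
    (LΛ hf ⋙ DerivedCategory.Q) := fun _ _ _ hg =>
  (isIso_Q_map_iff _).2 (quasiIso_LΛ_map hf hg)

variable (h : (quasiIso (GrMod 𝒜) (ComplexShape.up ℤ)).IsInvertedBy (LΛ hf ⋙ DerivedCategory.Q))

/-- The derived local homology functor is induced by the local homology functor on complexes. -/
def derivedLΛFac : DerivedCategory.Q ⋙ derivedLΛ hf h ≅ LΛ hf ⋙ DerivedCategory.Q :=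
  Localization.fac (LΛ hf ⋙ DerivedCategory.Q) h DerivedCategory.Q

/-- The comparison of local homology in the derived category with that of complexes. -/
def derivedLΛObjIso (M : CochainComplex (GrMod 𝒜) ℤ) :
    (derivedLΛ hf h).obj (DerivedCategory.Q.obj M) ≅ DerivedCategory.Q.obj ((LΛ hf).obj M) :=
  (derivedLΛFac hf h).app M

/-- The natural map from an object to its local homology. -/
def derivedUnit : 𝟭 (DerivedCategory (GrMod 𝒜)) ⟶ derivedLΛ hf h :=
  letI : Localization.Lifting DerivedCategory.Q (quasiIso (GrMod 𝒜) (ComplexShape.up ℤ))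
    (LΛ hf ⋙ DerivedCategory.Q) (derivedLΛ hf h) := ⟨derivedLΛFac hf h⟩
  Localization.liftNatTrans DerivedCategory.Q (quasiIso (GrMod 𝒜) (ComplexShape.up ℤ))
    DerivedCategory.Q (LΛ hf ⋙ DerivedCategory.Q) (𝟭 _) (derivedLΛ hf h)
    (Functor.whiskerRight (toLΛ hf) DerivedCategory.Q)

lemma derivedUnit_app (M : CochainComplex (GrMod 𝒜) ℤ) :
    (derivedUnit hf h).app (DerivedCategory.Q.obj M) = toDerivedLΛ hf h M :=
  letI : Localization.Lifting DerivedCategory.Q (quasiIso (GrMod 𝒜) (ComplexShape.up ℤ))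
    (LΛ hf ⋙ DerivedCategory.Q) (derivedLΛ hf h) := ⟨derivedLΛFac hf h⟩
  (Localization.liftNatTrans_app _ _ _ _ _ _ _ _).trans (Category.id_comp _)

lemma toDerivedLΛ_eq (M : CochainComplex (GrMod 𝒜) ℤ) : toDerivedLΛ hf h M =
    DerivedCategory.Q.map ((toLΛ hf).app M) ≫ (derivedLΛObjIso hf h M).inv := rfl

lemma isIso_toDerivedLΛ_iff (M : CochainComplex (GrMod 𝒜) ℤ) :
    IsIso (toDerivedLΛ hf h M) ↔
      quasiIso (GrMod 𝒜) (ComplexShape.up ℤ) ((toLΛ hf).app M) := by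
  rw [toDerivedLΛ_eq]
  exact (isIso_comp_right_iff _ _).trans (isIso_Q_map_iff _)

/-- Every object is isomorphic to the image of a complex, where the unit is `toLΛ` up to an
isomorphism. -/
lemma isIso_derivedUnit_app (hI : I.toIdeal = Ideal.span (Set.range f))
    (X : DerivedCategory (GrMod 𝒜)) (hX : derivedComplete I X) :
    IsIso ((derivedUnit hf h).app X) := by
  let e := DerivedCategory.Q.objObjPreimageIso X
  rw [← NatTrans.isIso_app_iff_of_iso _ e, derivedUnit_app, isIso_toDerivedLΛ_iff]
  exact quasiIso_toLΛ hf hI ((derivedComplete_iff e).1 hX)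

lemma isIso_map_derivedUnit_app (X : DerivedCategory (GrMod 𝒜)) :
    IsIso ((derivedLΛ hf h).map ((derivedUnit hf h).app X)) := by
  have key := NatTrans.isIso_app_iff_of_iso
    (Functor.whiskerRight (derivedUnit hf h) (derivedLΛ hf h))
    (DerivedCategory.Q.objObjPreimageIso X)
  refine key.1 ?_
  let M := DerivedCategory.Q.objPreimage X
  -- On images of complexes the derived functor is `LΛ`, so `quasiIso_LΛ_map_toLΛ` applies.
  have e : IsIso ((derivedLΛ hf h).map (DerivedCategory.Q.map ((toLΛ hf).app M))) :=
    (NatIso.isIso_map_iff (derivedLΛFac hf h) ((toLΛ hf).app M)).2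
      ((isIso_Q_map_iff _).2 (quasiIso_LΛ_map_toLΛ hf M))
  have e' : (derivedLΛ hf h).map ((derivedUnit hf h).app (DerivedCategory.Q.obj M)) =
      (derivedLΛ hf h).map (DerivedCategory.Q.map ((toLΛ hf).app M)) ≫
        (derivedLΛ hf h).map (derivedLΛObjIso hf h M).inv :=
    (congrArg (derivedLΛ hf h).map (derivedUnit_app hf h M)).trans
      ((derivedLΛ hf h).map_comp _ _)
  change IsIso ((derivedLΛ hf h).map ((derivedUnit hf h).app (DerivedCategory.Q.obj M)))
  rw [e']
  infer_instance

lemma derivedComplete_derivedLΛ (hI : I.toIdeal = Ideal.span (Set.range f))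
    (X : DerivedCategory (GrMod 𝒜)) : derivedComplete I ((derivedLΛ hf h).obj X) := by
  let M := DerivedCategory.Q.objPreimage X
  refine (derivedComplete_iff (M := (LΛ hf).obj M) ?_).2 (isComplete_LΛ hf hI)
  exact (derivedLΛObjIso hf h M).symm ≪≫
    (derivedLΛ hf h).mapIso (DerivedCategory.Q.objObjPreimageIso X)

end Derived

end GrMod

theorem mainTheorem5 {A : Type u} [CommRing A] (𝒜 : ℤ → AddSubgroup A) [GradedRing 𝒜]
    [HasDerivedCategory.{w} (GrMod 𝒜)] (I : HomogeneousIdeal 𝒜) {r : ℕ} (f : Fin r → A)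
    (d : Fin r → ℤ) (hf : ∀ i, f i ∈ 𝒜 (d i)) (hI : I.toIdeal = Ideal.span (Set.range f)) :
    ∃ (h : (HomologicalComplex.quasiIso (GrMod 𝒜) (ComplexShape.up ℤ)).IsInvertedBy
          (GrMod.LΛ hf ⋙ DerivedCategory.Q))
      (hc : ∀ X, GrMod.derivedComplete I ((GrMod.derivedLΛ hf h).obj X))
      (adj : (GrMod.derivedComplete I).lift (GrMod.derivedLΛ hf h) hc ⊣
          (GrMod.derivedComplete I).ι),
      ∀ M : CochainComplex (GrMod 𝒜) ℤ,
        adj.unit.app (DerivedCategory.Q.obj M) = GrMod.toDerivedLΛ hf h M :=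
  let h := GrMod.isInvertedBy_LΛ hf
  ⟨h, GrMod.derivedComplete_derivedLΛ hf h hI,
    adjunctionOfPointed (GrMod.derivedUnit hf h) _ (GrMod.isIso_derivedUnit_app hf h hI)
      (GrMod.isIso_map_derivedUnit_app hf h),
    GrMod.derivedUnit_app hf h⟩

end
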